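/- Let $K$ be a field of characteristic $0$ and let $q,t,u,v\in K$ with $q,t,u\neq 0$ and $q^at^b\neq 1$ for all $(a,b)\in\mathbb N^2\setminus\{(0,0)\}$ (for instance $K=\mathbb C(q,t,u,v)$ with four independent variables). Let $\Lambda_K$ be the ring of symmetric functions over $K$, and let $\{P_\mu\}$ be its basis of Macdonald functions $P_\mu(x;q,t)$: $P_\lambda=m_\lambda+\sum_{\mu<\lambda}u_{\lambda\mu}m_\mu$ (dominance order), and the $P_\lambda$ are pairwise orthogonal for $(p_\lambda,p_\mu)_{q,t}=\delta_{\lambda\mu}z_\lambda\prod_i\frac{1-q^{\lambda_i}}{1-t^{\lambda_i}}$. For a box $s=(i,j)$ of a partition $\mu$ put $a(s)=\mu_i-j$, $l(s)=\mu^t_j-i$, $a'(s)=j-1$, $l'(s)=i-1$. For an operator $A$ on $\Lambda_K$ with $AP_\mu=a_\mu P_\mu$ for all $\mu$, define the formal power series in $Q$ $$\langle A\rangle_{u,v}=\sum_\mu(-uQ)^{|\mu|}\,a_\mu\prod_{s\in\mu}\frac{q^{a'(s)}-vt^{l'(s)}}{1-t^{l(s)}q^{a(s)+1}}\cdot\frac{t^{-l'(s)}-u^{-1}q^{-a'(s)}}{1-q^{-a(s)}t^{-(l(s)+1)}},\qquad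 \langle A\rangle'_{u,v}=\frac{\langle A\rangle_{u,v}}{\langle 1\rangle_{u,v}}.$$ There is a unique operator $\tilde E^1$ on $\Lambda_K$ that, for every $n\ge 0$, restricts to $n$ variables as $$\tilde E^1_n=t^{-n}\sum_{i=1}^n\prod_{j\ne i}\frac{tx_i-x_j}{x_i-x_j}\,T_{q,x_i}+\frac{t^{-n-1}}{1-t^{-1}},$$ where $T_{q,x_i}$ replaces $x_i$ by $qx_i$. It satisfies $\tilde E^1P_\mu=\bigl(\sum_{i\ge1}q^{\mu_i}t^{-i}\bigr)P_\mu$, where the sum is read as the rational function $\sum_{i=1}^{n}q^{\mu_i}t^{-i}+\frac{t^{-n-1}}{1-t^{-1}}$ with $n=|\mu|$. Let $\Psi^m$ and $\Lambda^m$ be the operators with eigenvectors $P_\mu$ and eigenvalues $p_m$, respectively $e_m$, of the family $\{t^{-l'(s)}q^{a'(s)}\}_{s\in\mu}$. Put $$A=1-Q\frac{(1-u)(1-v)}{1-uQ},\qquad W=\frac{Q(1-Q)(1-u)(1-v)(1-uvQ)}{(1-uQ)^2(1-uqQ)(1-ut^{-1}Q)},\qquad B=\frac{Q(1-u)(1-v)}{(1-q)(1-t^{-1})(1-uQ)}.$$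 Then, as formal power series in $Q$, $$\langle\tilde E^1\tilde E^1\rangle'_{u,v}=\Bigl(\frac{t^{-1}}{1-t^{-1}}\Bigr)^2\bigl[A^2+(1-q)(1-t^{-1})W\bigr],$$ $$\langle(\Psi^1)^2\rangle'_{u,v}=B^2+\frac{W}{(1-q)(1-t^{-1})},$$ $$\langle\Psi^2\rangle'_{u,v}=\frac{1-A^2}{(1-q^2)(1-t^{-2})}+\frac{-1+q+t^{-1}+qt^{-1}-2uqt^{-1}Q}{(1-q^2)(1-t^{-2})}\,W,$$ $$2\langle\Lambda^2\rangle'_{u,v}=B^2-\frac{1-A^2}{(1-q^2)(1-t^{-2})}+\frac{2+2uqt^{-1}Q}{(1-q^2)(1-t^{-2})}\,W.$$ -/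

import Mathlib

namespace MacFock

/-- The Young diagram of a partition: `(i, j)` is the box in row `i` and column `j`, both counted
from `0`, so `rowLen i` is the `(i+1)`-st part. -/
def young {n : ℕ} (μ : n.Partition) : YoungDiagram :=
  YoungDiagram.ofRowLens (μ.parts.sort (· ≥ ·)) (Multiset.pairwise_sort μ.parts (· ≥ ·)).sortedGE

/-- Arm length of a box. -/
def arm (Y : YoungDiagram) (s : ℕ × ℕ) : ℕ := Y.rowLen s.1 - s.2 - 1

/-- Leg length of a box. -/
def leg (Y : YoungDiagram) (s : ℕ × ℕ) : ℕ := Y.colLen s.2 - s.1 - 1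

/-- Co-arm length `a'` of a box. -/
def coarm (s : ℕ × ℕ) : ℕ := s.2

/-- Co-leg length `l'` of a box. -/
def coleg (s : ℕ × ℕ) : ℕ := s.1

/-- Strict dominance order on the partitions of `n`. -/
def StrictlyDominated {n : ℕ} (μ lam : n.Partition) : Prop :=
  μ ≠ lam ∧ ∀ k : ℕ, ∑ i ∈ Finset.range k, (young μ).rowLen i
    ≤ ∑ i ∈ Finset.range k, (young lam).rowLen i

/-- All partitions. -/
abbrev Parts : Type := Σ n : ℕ, n.Partition

/-- The ring of symmetric functions over a field `K` of characteristic zero, as the polynomial ring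
in the power sums: the variable `X k` is the power sum `p_k`, `k ≥ 1`. -/
abbrev Sym (K : Type*) [Field K] : Type _ := MvPolynomial ℕ+ K

section Defs

variable {K : Type*} [Field K]

/-- Restriction of a symmetric function to `N` variables `x_1, …, x_N`. -/
noncomputable def restrict (N : ℕ) : Sym K →ₐ[K] MvPolynomial (Fin N) K :=
  MvPolynomial.aeval fun k : ℕ+ => MvPolynomial.psum (Fin N) K (k : ℕ)

/-- The number `(p_μ, p_μ)_{q,t} = z_μ ∏ᵢ (1 - q^{μᵢ}) / (1 - t^{μᵢ})`, where `μ` is the partition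
in which the part `k` occurs `f k` times. -/
noncomputable def psumNorm (q t : K) (f : ℕ+ →₀ ℕ) : K :=
  f.prod fun k m =>
    ((k : ℕ) : K) ^ m * (m.factorial : K) * ((1 - q ^ (k : ℕ)) / (1 - t ^ (k : ℕ))) ^ m

/-- Macdonald's scalar product: the products of power sums are orthogonal, with the above
square norms. -/
noncomputable def scalarProd (q t : K) (A B : Sym K) : K :=
  ∑ f ∈ A.support, A.coeff f * B.coeff f * psumNorm q t f

/-- `P` is the basis of Macdonald functions `P_μ(x; q, t)`: `P_λ = m_λ + ∑_{μ < λ} u_{λμ} m_μ` with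
the monomial symmetric functions `m_μ`, and the `P_λ` are pairwise orthogonal. The identity between
symmetric functions is expressed in every finite number of variables, with coefficients
independent of this number. -/
def IsMacdonaldBasis (q t : K) (P : Module.Basis Parts K (Sym K)) : Prop :=
  (∀ (n : ℕ) (lam : n.Partition), ∃ c : n.Partition → K,
    (∀ μ, c μ ≠ 0 → StrictlyDominated μ lam) ∧
    ∀ N : ℕ, restrict N (P ⟨n, lam⟩) =
      MvPolynomial.msymm (Fin N) K lam + ∑ μ, c μ • MvPolynomial.msymm (Fin N) K μ) ∧
  ∀ lam μ : Parts, lam ≠ μ → scalarProd q t (P lam) (P μ) = 0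

/-- The operator with eigenvectors `P_μ` and eigenvalues `a μ`. -/
noncomputable def diagOp (P : Module.Basis Parts K (Sym K)) (a : Parts → K) :
    Module.End K (Sym K) :=
  P.constr K fun μ => a μ • P μ

/-- The multiset `{t^{-l'(s)} q^{a'(s)}}`, `s` running over the boxes of `μ`. -/
noncomputable def contents (q t : K) (μ : Parts) : Multiset K :=
  (young μ.2).cells.val.map fun s => t⁻¹ ^ coleg s * q ^ coarm s

/-- `Ψ^m`: the eigenvalue on `P_μ` is the power sum `p_m` of the box contents. -/
noncomputable def Psi (q t : K) (P : Module.Basis Parts K (Sym K)) (m : ℕ) :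
    Module.End K (Sym K) :=
  diagOp P fun μ => ((contents q t μ).map (· ^ m)).sum

/-- `Λ^m`: the eigenvalue on `P_μ` is the elementary symmetric function `e_m` of the box
contents. -/
noncomputable def Lam (q t : K) (P : Module.Basis Parts K (Sym K)) (m : ℕ) :
    Module.End K (Sym K) :=
  diagOp P fun μ => (contents q t μ).esymm m

/-- The Macdonald operator
`D_n^1 = ∑_i ∏_{j ≠ i} (t x_i - x_j) / (x_i - x_j) · T_{q, x_i}`, where `T_{q, x_i}` replaces
`x_i` by `q x_i`, with values in the rational functions in `x_1, …, x_n`. -/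
noncomputable def macdonaldD (q t : K) (n : ℕ) (f : MvPolynomial (Fin n) K) :
    FractionRing (MvPolynomial (Fin n) K) :=
  let x : Fin n → FractionRing (MvPolynomial (Fin n) K) := fun i =>
    algebraMap (MvPolynomial (Fin n) K) _ (MvPolynomial.X i)
  ∑ i, (∏ j ∈ Finset.univ.erase i,
      (algebraMap K (FractionRing (MvPolynomial (Fin n) K)) t * x i - x j) / (x i - x j)) *
    algebraMap (MvPolynomial (Fin n) K) _
      (MvPolynomial.aeval
        (Function.update MvPolynomial.X i (MvPolynomial.C q * MvPolynomial.X i)) f)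

/-- `E` is the modified Macdonald operator `Ẽ^1` on symmetric functions: in `n` variables it is
`Ẽ_n^1 = t^{-n} D_n^1 + e_1(t^{-n-1}, t^{-n-2}, …)`, where
`e_1(t^{-n-1}, t^{-n-2}, …) = ∑_{i > n} t^{-i} = t^{-n-1} / (1 - t^{-1})`
is a rational function of `t`. -/
def IsModifiedMacdonaldOp (q t : K) (E : Module.End K (Sym K)) : Prop :=
  ∀ (n : ℕ) (f : Sym K),
    algebraMap (MvPolynomial (Fin n) K) (FractionRing (MvPolynomial (Fin n) K))
        (restrict n (E f)) =
      algebraMap K _ (t⁻¹ ^ n) * macdonaldD q t n (restrict n f) +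
      algebraMap K _ (t⁻¹ ^ (n + 1) / (1 - t⁻¹)) *
        algebraMap (MvPolynomial (Fin n) K) _ (restrict n f)

/-- `e_1(q^{μ_1} t^{-1}, q^{μ_2} t^{-2}, …)` as a rational function of `q` and `t`: the finitely many
nonzero parts `μ_i` contribute `q^{μ_i} t^{-i}`, and the remaining terms add up to a
geometric series. -/
noncomputable def e1Value (q t : K) (μ : Parts) : K :=
  (∑ i ∈ Finset.range μ.1, q ^ (young μ.2).rowLen i * t⁻¹ ^ (i + 1)) +
    t⁻¹ ^ (μ.1 + 1) / (1 - t⁻¹)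

/-- The weight of the partition `μ` in the `(u, v)`-bracket, without the power of `Q`. -/
noncomputable def weight (q t u v : K) {n : ℕ} (μ : n.Partition) : K :=
  (-u) ^ n * ∏ s ∈ (young μ).cells,
    ((q ^ coarm s - v * t ^ coleg s) /
        (1 - t ^ leg (young μ) s * q ^ (arm (young μ) s + 1)) *
      ((t⁻¹ ^ coleg s - u⁻¹ * q⁻¹ ^ coarm s) /
        (1 - q⁻¹ ^ arm (young μ) s * t⁻¹ ^ (leg (young μ) s + 1))))

/-- The `(u, v)`-bracket `⟨A⟩_{u,v}`, a formal power series in `Q`, of an operator `A` that has the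
`P_μ` as eigenvectors: the eigenvalue of `A` on `P_μ` is the diagonal entry of `A` at `μ` in the
basis `P`. -/
noncomputable def bracket (q t u v : K) (P : Module.Basis Parts K (Sym K))
    (A : Module.End K (Sym K)) : PowerSeries K :=
  PowerSeries.mk fun n => ∑ μ : n.Partition, weight q t u v μ * P.repr (A (P ⟨n, μ⟩)) ⟨n, μ⟩

/-- The normalized bracket `⟨A⟩'_{u,v} = ⟨A⟩_{u,v} / ⟨1⟩_{u,v}`; the series `⟨1⟩_{u,v}` has constant
term `1`, hence is invertible. -/
noncomputable def normBracket (q t u v : K) (P : Module.Basis Parts K (Sym K))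
    (A : Module.End K (Sym K)) : PowerSeries K :=
  bracket q t u v P A * (bracket q t u v P 1)⁻¹

end Defs

end MacFock

/-! Write p_k for the k-th power sum of the box contents. Up to the scalar t⁻¹/(1 - t⁻¹), the
eigenvalue of Ẽ¹ on P_μ is 1 - (1 - q)(1 - t⁻¹)p₁, so all four brackets are combinations of those of
1, p₁, p₁² and p₂. These are found not by summing series but from linear relations produced by
adding one box.

Number rows from 0 and put x_i = q^{μ_i} t^{-i}, the content of a box added in row i. There are
coefficients for adding a box (`addCoeff`) and for removing one (`removeCoeff`), zero in rows where
this is impossible, such that weight(Y')·remove = weight(Y)·add·(1 - v/x)(1 - ux) whenever Y' is Y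
with a box of content x added (`removeCoeff_div_hookProd`, `diagramWeight_step`). Summing over all
such pairs against a test function relates degree n + 1 to degree n (`sum_diagrams_succ`). By
partial fractions, the sums of these coefficients times powers of x are given by complete symmetric
functions of the corner alphabet ∑_{i ≤ L} x_i - t⁻¹ ∑_{i < L} x_i, or of -t times it; the power
sums of the corner alphabet are 1 - (1 - q^k)(1 - t^{-k})p_k (`addCoeff_sums`, `removeCoeff_sums`,
`cornerPow_eq`). The test functions 1, p₁ and x give three linear equations for the normalized
brackets of p₁, p₁², p₂, solved in `linear_system_solution`.

For the operator, the same partial fractions turn Ẽ¹_n into a formula in power sums that does not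
involve n: substitute p_k ↦ p_k + (q^k - 1)z^k, then replace z^m by g_m (`macOp`). Multiplication by
g_m is adjoint to t^{-m} times extraction of the coefficient of z^m, so `macOp` is self-adjoint
(`macForm_macOp`). Clearing denominators with the Vandermonde product shows that it is triangular
for the lexicographic order, with the expected diagonal. Triangular and self-adjoint in an
orthogonal basis forces diagonal (`IsMacdonaldBasis.macOp_apply_eq`). -/

namespace MacFock

/-! ### Newton's recursion, divided differences and partial fractions -/

section RationalSums

variable {F : Type*} [Field F]

/-- The power series `∏ (1 - y w) / ∏ (1 - x w)`. -/
noncomputable def ratioSeries (s : Finset F) (Y : Multiset F) : PowerSeries F :=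
  (Y.map fun y => 1 - PowerSeries.C y * PowerSeries.X).prod *
    ∏ x ∈ s, (1 - PowerSeries.C x * PowerSeries.X)⁻¹

theorem coeff_succ_one_sub_mul (a : F) (f : PowerSeries F) (k : ℕ) :
    PowerSeries.coeff (k + 1) ((1 - PowerSeries.C a * PowerSeries.X) * f) =
      PowerSeries.coeff (k + 1) f - a * PowerSeries.coeff k f := by
  rw [sub_mul, one_mul, map_sub, mul_assoc, PowerSeries.coeff_C_mul, PowerSeries.coeff_succ_X_mul]

theorem one_sub_mul_inv (a : F) :
    (1 - PowerSeries.C a * PowerSeries.X) * (1 - PowerSeries.C a * PowerSeries.X)⁻¹ = 1 :=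
  PowerSeries.mul_inv_cancel _ (by simp)

open PowerSeries in
theorem derivative_one_sub (a : F) :
    derivative F (1 - C a * X) = (1 - C a * X) * mk fun m => -a ^ (m + 1) := by
  ext k
  rcases k with _ | k
  · simp
  · rw [coeff_succ_one_sub_mul, coeff_derivative]
    simp [coeff_one]
    ring

-- Logarithmic derivatives add. The form f' = f·a avoids division by f.
open PowerSeries in
theorem derivative_mul_of_eq {f g : PowerSeries F} {a b : ℕ → F}
    (hf : derivative F f = f * mk a) (hg : derivative F g = g * mk b) :
    derivative F (f * g) = f * g * mk (a + b) := by
  have : (mk (a + b) : PowerSeries F) = mk a + mk b := by ext; simp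
  rw [Derivation.leibniz, hf, hg, this, smul_eq_mul, smul_eq_mul]
  ring

open PowerSeries in
theorem derivative_inv_of_eq {f : PowerSeries F} {a : ℕ → F}
    (hf : derivative F f = f * mk a) (h0 : constantCoeff f ≠ 0) :
    derivative F f⁻¹ = f⁻¹ * mk (-a) := by
  have e : (mk (-a) : PowerSeries F) = -mk a := by ext; simp
  have h1 := PowerSeries.mul_inv_cancel f h0
  have h2 := congrArg (derivative F) h1
  rw [Derivation.leibniz, hf, Derivation.map_one_eq_zero, smul_eq_mul, smul_eq_mul] at h2
  rw [e]
  linear_combination f⁻¹ * h2 - (derivative F f⁻¹ + f⁻¹ * mk a) * h1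

open PowerSeries in
theorem derivative_ratioSeries (s : Finset F) (Y : Multiset F) :
    derivative F (ratioSeries s Y) = ratioSeries s Y *
      mk fun m => ∑ x ∈ s, x ^ (m + 1) - (Y.map (· ^ (m + 1))).sum := by
  have h1 : derivative F (Y.map fun y => 1 - C y * X).prod = (Y.map fun y => 1 - C y * X).prod *
      mk fun m => -(Y.map (· ^ (m + 1))).sum := by
    induction Y using Multiset.induction_on with
    | empty => ext; simp
    | cons a Y ih =>
      simp only [Multiset.map_cons, Multiset.prod_cons, Multiset.sum_cons]
      rw [derivative_mul_of_eq (derivative_one_sub a) ih]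
      congr 2
      ext
      simp
      ring
  have h2 : derivative F (∏ x ∈ s, (1 - C x * X)⁻¹) = (∏ x ∈ s, (1 - C x * X)⁻¹) *
      mk fun m => ∑ x ∈ s, x ^ (m + 1) := by
    induction s using Finset.cons_induction with
    | empty => ext; simp
    | cons a s ha ih =>
      simp only [Finset.prod_cons, Finset.sum_cons]
      rw [derivative_mul_of_eq (derivative_inv_of_eq (derivative_one_sub a) (by simp)) ih]
      congr 2
      ext
      simp
  rw [ratioSeries, derivative_mul_of_eq h1 h2]
  congr 2
  ext
  simp
  ring

/-- Newton's recursion for the coefficients of `ratioSeries`. -/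
theorem ratioSeries_newton (s : Finset F) (Y : Multiset F) (k : ℕ) :
    ((k : F) + 1) * PowerSeries.coeff (k + 1) (ratioSeries s Y) =
      ∑ m ∈ Finset.range (k + 1), (∑ x ∈ s, x ^ (m + 1) - (Y.map (· ^ (m + 1))).sum) *
        PowerSeries.coeff (k - m) (ratioSeries s Y) := by
  have h := congrArg (PowerSeries.coeff k) (derivative_ratioSeries s Y)
  rw [PowerSeries.coeff_derivative, mul_comm (ratioSeries s Y), PowerSeries.coeff_mul,
    Finset.Nat.sum_antidiagonal_eq_sum_range_succ_mk] at h
  simpa [mul_comm] using h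

theorem coeff_zero_ratioSeries (s : Finset F) (Y : Multiset F) :
    PowerSeries.coeff 0 (ratioSeries s Y) = 1 := by
  simp only [ratioSeries, PowerSeries.coeff_zero_eq_constantCoeff, map_mul, map_prod,
    map_multiset_prod, Multiset.map_map]
  simp

variable [DecidableEq F]

/-- Divided difference of `x ^ k ∏ (x - y)` at the points of `s`. -/
noncomputable def divDiff (s : Finset F) (Y : Multiset F) (k : ℕ) : F :=
  ∑ x ∈ s, x ^ k * (Y.map fun y => x - y).prod / ∏ x' ∈ s.erase x, (x - x')

theorem divDiff_cons (s : Finset F) (Y : Multiset F) (a : F) (k : ℕ) :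
    divDiff s (a ::ₘ Y) k = divDiff s Y (k + 1) - a * divDiff s Y k := by
  simp only [divDiff, Finset.mul_sum, ← Finset.sum_sub_distrib, Multiset.map_cons,
    Multiset.prod_cons]
  refine Finset.sum_congr rfl fun x _ => ?_
  ring

/-- The numerator factor x - a kills the term of the node a and cancels the factor of a in every
other denominator. -/
theorem divDiff_cons_insert (s : Finset F) (a : F) (ha : a ∉ s) (Y : Multiset F) (k : ℕ) :
    divDiff (insert a s) (a ::ₘ Y) k = divDiff s Y k := by
  rw [divDiff, Finset.sum_insert ha]
  simp only [Multiset.map_cons, Multiset.prod_cons, sub_self, zero_mul, mul_zero, zero_div,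
    zero_add, divDiff]
  refine Finset.sum_congr rfl fun x hx => ?_
  have hxa : a ≠ x := fun h => ha (h ▸ hx)
  rw [Finset.erase_insert_of_ne hxa, Finset.prod_insert (by simp [ha])]
  have : x - a ≠ 0 := sub_ne_zero.2 hxa.symm
  rw [mul_left_comm, mul_div_mul_left _ _ this]

/-- For two nodes a, b, subtracting the relations obtained by inserting the factors x - a and x - b
shows that (b - a) times the sum is the difference of the sums over s \ {a} and s \ {b}. Those are
both 0 by induction, or both 1 if s = {a, b}. -/
theorem divDiff_zero_eq_zero (s : Finset F) (hs : 2 ≤ s.card) : divDiff s 0 0 = 0 := by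
  induction h : s.card using Nat.strong_induction_on generalizing s with
  | _ n ih =>
  obtain ⟨a, ha⟩ : s.Nonempty := Finset.card_pos.1 (by omega)
  obtain ⟨b, hb⟩ : (s.erase a).Nonempty :=
    Finset.card_pos.1 (by rw [Finset.card_erase_of_mem ha]; omega)
  obtain ⟨hba, hbs⟩ := Finset.mem_erase.1 hb
  have h1 : divDiff s {a} 0 = divDiff (s.erase a) 0 0 := by
    conv_lhs => rw [← Finset.insert_erase ha]
    exact divDiff_cons_insert _ a (by simp) 0 0
  have h2 : divDiff s {b} 0 = divDiff (s.erase b) 0 0 := by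
    conv_lhs => rw [← Finset.insert_erase hbs]
    exact divDiff_cons_insert _ b (by simp) 0 0
  have h3 : (b - a) * divDiff s 0 0 = 0 := by
    have e1 := divDiff_cons s 0 a 0
    have e2 := divDiff_cons s 0 b 0
    have : divDiff (s.erase a) 0 0 = divDiff (s.erase b) 0 0 := by
      rcases eq_or_lt_of_le hs with h' | h'
      · have hs2 : s = {a, b} := by
          symm
          apply Finset.eq_of_subset_of_card_le
          · intro x hx
            simp only [Finset.mem_insert, Finset.mem_singleton] at hx
            rcases hx with rfl | rfl <;> assumption
          · rw [Finset.card_pair hba.symm]; omega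
        have ea : s.erase a = {b} := by
          rw [hs2]; ext x; simp only [Finset.mem_erase, Finset.mem_insert, Finset.mem_singleton]
          grind
        have eb : s.erase b = {a} := by
          rw [hs2]; ext x; simp only [Finset.mem_erase, Finset.mem_insert, Finset.mem_singleton]
          grind
        rw [ea, eb]; simp [divDiff]
      · have ca := Finset.card_erase_of_mem ha
        have cb := Finset.card_erase_of_mem hbs
        rw [ih _ (by omega) (s.erase a) (by omega) rfl, ih _ (by omega) (s.erase b) (by omega) rfl]
    have e1' : divDiff s {a} 0 = _ := e1
    have e2' : divDiff s {b} 0 = _ := e2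
    rw [h1] at e1'
    rw [h2] at e2'
    linear_combination this - e1' + e2'
  exact (mul_eq_zero.1 h3).resolve_left (sub_ne_zero.2 hba)

/-- Multiplying the generating series by 1 - aw removes the node a and shifts the index by one; the
lowest coefficient is 0 by `divDiff_zero_eq_zero`. -/
theorem mk_divDiff (s : Finset F) (hs : s.Nonempty) :
    PowerSeries.mk (divDiff s 0) =
      PowerSeries.X ^ (s.card - 1) * ∏ x ∈ s, (1 - PowerSeries.C x * PowerSeries.X)⁻¹ := by
  induction hs using Finset.Nonempty.cons_induction with
  | singleton a =>
    have : (1 - PowerSeries.C a * PowerSeries.X) * PowerSeries.mk (divDiff {a} 0) = 1 := by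
      ext k
      rcases k with _ | k
      · simp [divDiff]
      · rw [coeff_succ_one_sub_mul]
        simp [divDiff, PowerSeries.coeff_one]
        ring
    simp only [Finset.card_singleton, tsub_self, pow_zero, one_mul, Finset.prod_singleton]
    rw [PowerSeries.eq_inv_iff_mul_eq_one (by simp), mul_comm]
    exact this
  | cons a s ha hs ih =>
    have hc : 1 ≤ s.card := hs.card_pos
    have : (1 - PowerSeries.C a * PowerSeries.X) * PowerSeries.mk (divDiff (insert a s) 0) =
        PowerSeries.X * PowerSeries.mk (divDiff s 0) := by
      ext k
      rcases k with _ | k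
      · have := divDiff_zero_eq_zero (insert a s) (by rw [Finset.card_insert_of_notMem ha]; omega)
        simp [this]
      · rw [coeff_succ_one_sub_mul, PowerSeries.coeff_succ_X_mul]
        simp only [PowerSeries.coeff_mk]
        rw [← divDiff_cons, divDiff_cons_insert _ _ ha]
    rw [Finset.cons_eq_insert, Finset.prod_insert ha, Finset.card_insert_of_notMem ha]
    rw [ih] at this
    have e : s.card + 1 - 1 = (s.card - 1) + 1 := by omega
    rw [e, pow_succ']
    calc _ = (1 - PowerSeries.C a * PowerSeries.X)⁻¹ * ((1 - PowerSeries.C a * PowerSeries.X) *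
          PowerSeries.mk (divDiff (insert a s) 0)) := by
          rw [← mul_assoc, mul_comm _ (1 - _), one_sub_mul_inv, one_mul]
      _ = _ := by rw [this]; ring

/-- Each numerator factor x - y corresponds to a factor 1 - yw of the series, at the cost of raising
the index by one. -/
theorem divDiff_eq_coeff (s : Finset F) (hs : s.Nonempty) (Y : Multiset F) (k : ℕ) :
    divDiff s Y k =
      PowerSeries.coeff (k + Multiset.card Y) (PowerSeries.X ^ (s.card - 1) * ratioSeries s Y) := by
  induction Y using Multiset.induction_on generalizing k with
  | empty =>
    have := congrArg (PowerSeries.coeff k) (mk_divDiff s hs)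
    simpa [ratioSeries] using this
  | cons a Y ih =>
    rw [divDiff_cons, ih, ih]
    have : PowerSeries.X ^ (s.card - 1) * ratioSeries s (a ::ₘ Y) =
        (1 - PowerSeries.C a * PowerSeries.X) * (PowerSeries.X ^ (s.card - 1) * ratioSeries s Y) := by
      simp only [ratioSeries, Multiset.map_cons, Multiset.prod_cons]; ring
    rw [this, Multiset.card_cons, ← add_assoc, coeff_succ_one_sub_mul]
    ring_nf

/-- Partial fractions with the additional node `0`. -/
theorem sum_partialFractions (s : Finset F) (hs : (0 : F) ∉ s) (Y : Multiset F) (k : ℕ) :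
    ∑ x ∈ s, x ^ k * (Y.map fun y => x - y).prod / (x * ∏ x' ∈ s.erase x, (x - x')) +
        0 ^ k * (Y.map fun y => -y).prod / ∏ x' ∈ s, (-x') =
      PowerSeries.coeff (k + Multiset.card Y) (PowerSeries.X ^ s.card * ratioSeries s Y) := by
  have h := divDiff_eq_coeff (insert 0 s) (by simp) Y k
  have e : ratioSeries (insert 0 s) Y = ratioSeries s Y := by
    simp [ratioSeries, Finset.prod_insert hs]
  rw [e, Finset.card_insert_of_notMem hs, Nat.add_sub_cancel] at h
  rw [← h, divDiff, Finset.sum_insert hs, add_comm, Finset.erase_insert hs]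
  congr 1
  · simp
  · refine Finset.sum_congr rfl fun x hx => ?_
    have hx0 : (0 : F) ≠ x := fun h => hs (h ▸ hx)
    rw [Finset.erase_insert_of_ne hx0, Finset.prod_insert (by simp [hs]), sub_zero]

end RationalSums

/-! ### Adding a box to a Young diagram -/

section Diagrams

/-- Trades a product over the boxes of a row of length c for one over the rows below it, of lengths
ν d. The legs are capped at M and M is raised by induction: only the columns j < ν M notice the step
from M to M + 1, and the product over them telescopes in j. -/
theorem prod_leg_telescope {K : Type*} [Field K] (G : ℕ → ℕ → K)
    (hG : ∀ a l, 1 ≤ a → G a l ≠ 0) (c : ℕ) (ν leg : ℕ → ℕ) (hν : ∀ d, ν d ≤ c)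
    (hleg : ∀ d j, d < leg j ↔ j < ν d) (M : ℕ) :
    (∏ j ∈ Finset.range c, G (c - j) (min M (leg j)) / G (c - j + 1) (min M (leg j))) / G 1 0 =
      (∏ d ∈ Finset.range M, G (c - ν d + 1) (d + 1) / G (c - ν d + 1) d) / G (c + 1) M := by
  have tele : ∀ (l n : ℕ), n ≤ c → ∏ j ∈ Finset.range n, G (c - j) l / G (c - j + 1) l =
      G (c - n + 1) l / G (c + 1) l := by
    intro l n hn
    induction n with
    | zero => simp [div_self (hG (c + 1) l (by omega))]
    | succ n ih =>
      rw [Finset.prod_range_succ, ih (by omega), show c - (n + 1) + 1 = c - n by omega]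
      have := hG (c - n + 1) l (by omega)
      have := hG (c + 1) l (by omega)
      field_simp
  induction M with
  | zero =>
    simp only [Nat.zero_min, Finset.range_zero, Finset.prod_empty]
    rw [tele 0 c le_rfl]
    have := hG 1 0 le_rfl
    have := hG (c + 1) 0 (by omega)
    simp only [tsub_self, zero_add]
    field_simp
  | succ M ih =>
    have key : ∏ j ∈ Finset.range c,
          G (c - j) (min (M + 1) (leg j)) / G (c - j + 1) (min (M + 1) (leg j)) =
        (∏ j ∈ Finset.range c, G (c - j) (min M (leg j)) / G (c - j + 1) (min M (leg j))) *
        ((∏ j ∈ Finset.range (ν M), G (c - j) (M + 1) / G (c - j + 1) (M + 1)) /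
          ∏ j ∈ Finset.range (ν M), G (c - j) M / G (c - j + 1) M) := by
      have hsub : Finset.range (ν M) ⊆ Finset.range c := Finset.range_mono (hν M)
      rw [← Finset.prod_sdiff hsub, ← Finset.prod_sdiff hsub]
      have h1 : ∀ j ∈ Finset.range (ν M), min (M + 1) (leg j) = M + 1 := fun j hj => by
        have := (hleg M j).2 (Finset.mem_range.1 hj); omega
      have h2 : ∀ j ∈ Finset.range (ν M), min M (leg j) = M := fun j hj => by
        have := (hleg M j).2 (Finset.mem_range.1 hj); omega
      have h3 : ∀ j ∈ Finset.range c \ Finset.range (ν M),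
          min (M + 1) (leg j) = min M (leg j) := fun j hj => by
        have : ¬ M < leg j := by
          rw [hleg]; simp at hj; omega
        omega
      have e1 : ∏ j ∈ Finset.range (ν M), G (c - j) (min (M + 1) (leg j)) /
          G (c - j + 1) (min (M + 1) (leg j)) =
          ∏ j ∈ Finset.range (ν M), G (c - j) (M + 1) / G (c - j + 1) (M + 1) :=
        Finset.prod_congr rfl fun j hj => by rw [h1 j hj]
      have e2 : ∏ j ∈ Finset.range (ν M), G (c - j) (min M (leg j)) /
          G (c - j + 1) (min M (leg j)) =
          ∏ j ∈ Finset.range (ν M), G (c - j) M / G (c - j + 1) M :=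
        Finset.prod_congr rfl fun j hj => by rw [h2 j hj]
      have e3 : ∏ j ∈ Finset.range c \ Finset.range (ν M), G (c - j) (min (M + 1) (leg j)) /
          G (c - j + 1) (min (M + 1) (leg j)) =
          ∏ j ∈ Finset.range c \ Finset.range (ν M), G (c - j) (min M (leg j)) /
          G (c - j + 1) (min M (leg j)) :=
        Finset.prod_congr rfl fun j hj => by rw [h3 j hj]
      rw [e1, e2, e3, mul_assoc, mul_div_cancel₀]
      refine Finset.prod_ne_zero_iff.2 fun j hj => div_ne_zero (hG _ _ ?_) (hG _ _ (by omega))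
      have := hν M
      simp at hj
      omega
    rw [key, tele _ _ (hν M), tele _ _ (hν M), Finset.prod_range_succ, mul_div_right_comm, ih]
    have := hG (c - ν M + 1) M (by omega)
    have := hG (c - ν M + 1) (M + 1) (by omega)
    have := hG (c + 1) M (by omega)
    have := hG (c + 1) (M + 1) (by omega)
    field_simp

/-- `Y'` is `Y` with one box added at the end of row `r`. -/
def AddsBox (Y : YoungDiagram) (r : ℕ) (Y' : YoungDiagram) : Prop :=
  Y'.cells = insert (r, Y.rowLen r) Y.cells

namespace AddsBox

variable {Y Y' : YoungDiagram} {r : ℕ}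

theorem mem_iff (h : AddsBox Y r Y') (s : ℕ × ℕ) : s ∈ Y' ↔ s = (r, Y.rowLen r) ∨ s ∈ Y := by
  rw [← YoungDiagram.mem_cells, h, Finset.mem_insert, YoungDiagram.mem_cells]

theorem rowLen_self (h : AddsBox Y r Y') : Y'.rowLen r = Y.rowLen r + 1 := by
  refine eq_of_forall_lt_iff fun j => ?_
  rw [← YoungDiagram.mem_iff_lt_rowLen, h.mem_iff, YoungDiagram.mem_iff_lt_rowLen, Prod.mk_inj]
  omega

theorem rowLen_of_ne (h : AddsBox Y r Y') {i : ℕ} (hi : i ≠ r) : Y'.rowLen i = Y.rowLen i := by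
  refine eq_of_forall_lt_iff fun j => ?_
  rw [← YoungDiagram.mem_iff_lt_rowLen, h.mem_iff, YoungDiagram.mem_iff_lt_rowLen, Prod.mk_inj]
  omega

theorem rowLen_lt (h : AddsBox Y r Y') {i : ℕ} (hi : i < r) : Y.rowLen r < Y.rowLen i := by
  have := Y'.rowLen_anti i r hi.le
  rw [h.rowLen_self, h.rowLen_of_ne hi.ne] at this
  omega

theorem colLen_old (h : AddsBox Y r Y') : Y.colLen (Y.rowLen r) = r := by
  refine eq_of_forall_lt_iff fun i => ?_
  rw [← YoungDiagram.mem_iff_lt_colLen, YoungDiagram.mem_iff_lt_rowLen]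
  refine ⟨fun hi => ?_, fun hi => h.rowLen_lt hi⟩
  by_contra hc
  have := Y.rowLen_anti r i (by omega)
  omega

theorem colLen_self (h : AddsBox Y r Y') : Y'.colLen (Y.rowLen r) = r + 1 := by
  refine eq_of_forall_lt_iff fun i => ?_
  rw [← YoungDiagram.mem_iff_lt_colLen, h.mem_iff, YoungDiagram.mem_iff_lt_colLen, h.colLen_old,
    Prod.mk_inj]
  omega

theorem colLen_of_ne (h : AddsBox Y r Y') {j : ℕ} (hj : j ≠ Y.rowLen r) :
    Y'.colLen j = Y.colLen j := by
  refine eq_of_forall_lt_iff fun i => ?_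
  rw [← YoungDiagram.mem_iff_lt_colLen, h.mem_iff, YoungDiagram.mem_iff_lt_colLen, Prod.mk_inj]
  omega

theorem notMem (Y : YoungDiagram) (r : ℕ) : (r, Y.rowLen r) ∉ Y.cells := by
  rw [YoungDiagram.mem_cells, YoungDiagram.mem_iff_lt_rowLen]
  exact lt_irrefl _

theorem card_eq (h : AddsBox Y r Y') : Y'.card = Y.card + 1 := by
  rw [YoungDiagram.card, h, Finset.card_insert_of_notMem (notMem Y r)]

theorem right_unique {Y'' : YoungDiagram} (h : AddsBox Y r Y') (h' : AddsBox Y r Y'') :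
    Y' = Y'' := YoungDiagram.ext (h.trans h'.symm)

theorem left_unique {Y₁ Y₂ : YoungDiagram} (h₁ : AddsBox Y₁ r Y') (h₂ : AddsBox Y₂ r Y') :
    Y₁ = Y₂ := by
  have e : Y₁.rowLen r = Y₂.rowLen r := by
    have := h₁.rowLen_self; have := h₂.rowLen_self; omega
  apply YoungDiagram.ext
  have := (Finset.erase_insert (notMem Y₁ r)).symm
  rw [this, ← h₁, e, h₂, Finset.erase_insert (notMem Y₂ r)]

theorem exists_right (Y : YoungDiagram) (r : ℕ) (h : ∀ i < r, Y.rowLen r < Y.rowLen i) :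
    ∃ Y', AddsBox Y r Y' := by
  refine ⟨⟨insert (r, Y.rowLen r) Y.cells, ?_⟩, rfl⟩
  rintro ⟨i, j⟩ ⟨i', j'⟩ hle hm
  obtain ⟨h1, h2⟩ := Prod.mk_le_mk.1 hle
  simp only [Finset.coe_insert, Set.mem_insert_iff, Prod.mk_inj, Finset.mem_coe,
    YoungDiagram.mem_cells, YoungDiagram.mem_iff_lt_rowLen] at hm ⊢
  rcases hm with ⟨rfl, rfl⟩ | hm
  · rcases eq_or_lt_of_le h1 with rfl | h1
    · omega
    · have := h _ h1; omega
  · have := Y.rowLen_anti i' i h1; omega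

theorem exists_left (Y' : YoungDiagram) (r : ℕ) (h : Y'.rowLen (r + 1) < Y'.rowLen r) :
    ∃ Y, AddsBox Y r Y' := by
  have hl : IsLowerSet (↑(Y'.cells.erase (r, Y'.rowLen r - 1)) : Set (ℕ × ℕ)) := by
    rintro ⟨i, j⟩ ⟨i', j'⟩ hle hm
    obtain ⟨h1, h2⟩ := Prod.mk_le_mk.1 hle
    simp only [Finset.coe_erase, Set.mem_sdiff, Set.mem_singleton_iff, Prod.mk_inj, Finset.mem_coe,
      YoungDiagram.mem_cells, YoungDiagram.mem_iff_lt_rowLen] at hm ⊢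
    obtain ⟨hm1, hm2⟩ := hm
    have := Y'.rowLen_anti i' i h1
    refine ⟨by omega, ?_⟩
    rintro ⟨rfl, rfl⟩
    rcases eq_or_lt_of_le h1 with rfl | h1
    · omega
    · have := Y'.rowLen_anti _ _ (Nat.succ_le_of_lt h1)
      simp only [Nat.succ_eq_add_one] at this
      omega
  have hr : (⟨_, hl⟩ : YoungDiagram).rowLen r = Y'.rowLen r - 1 := by
    refine eq_of_forall_lt_iff fun j => ?_
    rw [← YoungDiagram.mem_iff_lt_rowLen, YoungDiagram.mem_mk, Finset.mem_erase, ne_eq,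
      Prod.mk_inj, YoungDiagram.mem_cells, YoungDiagram.mem_iff_lt_rowLen]
    omega
  refine ⟨⟨_, hl⟩, ?_⟩
  rw [AddsBox, hr, Finset.insert_erase]
  rw [YoungDiagram.mem_cells, YoungDiagram.mem_iff_lt_rowLen]
  omega

end AddsBox

theorem rowLen_card_eq_zero (Y : YoungDiagram) {i : ℕ} (hi : Y.card ≤ i) : Y.rowLen i = 0 := by
  by_contra h
  have h0 : 0 < Y.rowLen i := Nat.pos_of_ne_zero h
  have : (Finset.range (i + 1)).image (fun k => (k, 0)) ⊆ Y.cells := by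
    intro s hs
    simp only [Finset.mem_image, Finset.mem_range] at hs
    obtain ⟨k, hk, rfl⟩ := hs
    rw [YoungDiagram.mem_cells, YoungDiagram.mem_iff_lt_rowLen]
    exact h0.trans_le (Y.rowLen_anti k i (by omega))
  have := Finset.card_le_card this
  rw [Finset.card_image_of_injective _ (fun a b h => (Prod.mk_inj.1 h).1), Finset.card_range] at this
  have e : Y.card = Y.cells.card := rfl
  omega

end Diagrams

/-! ### Hook products and the effect of one box -/

section Hooks

variable {K : Type*} [Field K]

/-- The hook factor of a box with arm length `a - 1` and leg length `l`. -/
noncomputable def hookFactor (q t : K) (a l : ℕ) : K :=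
  (1 - t ^ l * q ^ a) * (1 - q⁻¹ ^ (a - 1) * t⁻¹ ^ (l + 1))

variable {q t : K}

theorem hookFactor_ne_zero
    (hqt : ∀ a b : ℕ, (a, b) ≠ (0, 0) → q ^ a * t ^ b ≠ 1) (a l : ℕ) (ha : 1 ≤ a) :
    hookFactor q t a l ≠ 0 := by
  refine mul_ne_zero (sub_ne_zero.2 fun h => ?_) (sub_ne_zero.2 fun h => ?_)
  · exact hqt a l (by simp; omega) (by rw [h, mul_comm])
  · rw [inv_pow, inv_pow, ← mul_inv, eq_comm, inv_eq_one] at h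
    exact hqt (a - 1) (l + 1) (by simp) h

/-- The product of the hook factors of all boxes. -/
noncomputable def hookProd (q t : K) (Y : YoungDiagram) : K :=
  ∏ s ∈ Y.cells, hookFactor q t (arm Y s + 1) (leg Y s)

theorem hookProd_ne_zero (hqt : ∀ a b : ℕ, (a, b) ≠ (0, 0) → q ^ a * t ^ b ≠ 1)
    (Y : YoungDiagram) : hookProd q t Y ≠ 0 :=
  Finset.prod_ne_zero_iff.2 fun _ _ => hookFactor_ne_zero hqt _ _ (by omega)

/-- A new box changes arms only in its row and legs only in its column, so a ratio of hook products
is a product over this row and this column. -/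
theorem prod_cells_eq_row_mul_col {Y Y' : YoungDiagram} {r : ℕ} (h : AddsBox Y r Y')
    (f : ℕ × ℕ → K) (hf : ∀ s ∈ Y.cells, s.1 ≠ r → s.2 ≠ Y.rowLen r → f s = 1) :
    ∏ s ∈ Y.cells, f s =
      (∏ j ∈ Finset.range (Y.rowLen r), f (r, j)) * ∏ i ∈ Finset.range r, f (i, Y.rowLen r) := by
  classical
  rw [← Finset.prod_image (f := f) (g := fun j => (r, j)) (by intro a _ b _ h; simpa using h),
    ← Finset.prod_image (f := f) (g := fun i => (i, Y.rowLen r)) (by intro a _ b _ h; simpa using h),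
    ← Finset.prod_union]
  · symm
    refine Finset.prod_subset ?_ ?_
    · intro s hs
      simp only [Finset.mem_union, Finset.mem_image, Finset.mem_range] at hs
      rw [YoungDiagram.mem_cells]
      rcases hs with ⟨j, hj, rfl⟩ | ⟨i, hi, rfl⟩
      · exact YoungDiagram.mem_iff_lt_rowLen.2 hj
      · exact YoungDiagram.mem_iff_lt_rowLen.2 (h.rowLen_lt hi)
    · rintro ⟨i, j⟩ hs hn
      simp only [Finset.mem_union, Finset.mem_image, Finset.mem_range, not_or, not_exists,
        not_and, Prod.mk_inj] at hn
      have hs' := hs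
      rw [YoungDiagram.mem_cells] at hs
      refine hf _ hs' (fun e => ?_) (fun e => ?_)
      · dsimp only at e
        subst e
        exact hn.1 j (YoungDiagram.mem_iff_lt_rowLen.1 hs) rfl rfl
      · dsimp only at e
        subst e
        have := YoungDiagram.mem_iff_lt_colLen.1 hs
        rw [h.colLen_old] at this
        exact hn.2 i this rfl rfl
  · rw [Finset.disjoint_left]
    intro s hs hs'
    simp only [Finset.mem_image, Finset.mem_range] at hs hs'
    obtain ⟨j, hj, rfl⟩ := hs
    obtain ⟨i, hi, he⟩ := hs'
    simp only [Prod.mk_inj] at he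
    omega

/-- The column of the new box already gives a product over the rows above; `prod_leg_telescope`
turns its row into a product over the rows below. Everything is then indexed by rows. -/
theorem hookProd_div_hookProd (hqt : ∀ a b : ℕ, (a, b) ≠ (0, 0) → q ^ a * t ^ b ≠ 1)
    {Y Y' : YoungDiagram} {r : ℕ} (h : AddsBox Y r Y') (M : ℕ) (hM : Y.card ≤ r + 1 + M) :
    hookProd q t Y / hookProd q t Y' =
      (∏ d ∈ Finset.range M, hookFactor q t (Y.rowLen r - Y.rowLen (r + 1 + d) + 1) (d + 1) /
          hookFactor q t (Y.rowLen r - Y.rowLen (r + 1 + d) + 1) d) /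
        hookFactor q t (Y.rowLen r + 1) M *
      ∏ i ∈ Finset.range r, hookFactor q t (Y.rowLen i - Y.rowLen r) (r - i - 1) /
        hookFactor q t (Y.rowLen i - Y.rowLen r) (r - i) := by
  set G := hookFactor q t with hG
  have hne : ∀ a l, 1 ≤ a → G a l ≠ 0 := hookFactor_ne_zero hqt
  have e1 : hookProd q t Y' = G 1 0 * ∏ s ∈ Y.cells, G (arm Y' s + 1) (leg Y' s) := by
    rw [hookProd, h, Finset.prod_insert (AddsBox.notMem Y r)]
    simp [arm, leg, h.rowLen_self, h.colLen_self, hG]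
  have hleg : ∀ d j, d < Y.colLen j - r - 1 ↔ j < Y.rowLen (r + 1 + d) := fun d j => by
    rw [← YoungDiagram.mem_iff_lt_rowLen, YoungDiagram.mem_iff_lt_colLen]; omega
  -- Row r + 1 + M is empty, so the cap M never takes effect.
  have hmin : ∀ j, min M (Y.colLen j - r - 1) = Y.colLen j - r - 1 := fun j => by
    have := (hleg M j).not.2 (by rw [rowLen_card_eq_zero Y hM]; omega)
    omega
  have key := prod_leg_telescope G hne (Y.rowLen r) (fun d => Y.rowLen (r + 1 + d))
    (fun j => Y.colLen j - r - 1) (fun d => Y.rowLen_anti _ _ (by omega)) hleg M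
  rw [← key, e1, mul_comm (G 1 0), ← div_div, hookProd, ← Finset.prod_div_distrib,
    prod_cells_eq_row_mul_col h, mul_div_right_comm]
  · congr 1
    · congr 1
      refine Finset.prod_congr rfl fun j hj => ?_
      have hj := Finset.mem_range.1 hj
      dsimp only [arm, leg]
      rw [hmin, h.rowLen_self, h.colLen_of_ne hj.ne]
      congr 2 <;> omega
    · refine Finset.prod_congr rfl fun i hi => ?_
      have hi := Finset.mem_range.1 hi
      have := h.rowLen_lt hi
      dsimp only [arm, leg]
      rw [h.rowLen_of_ne hi.ne, h.colLen_self, h.colLen_old]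
      congr 2 <;> omega
  · rintro ⟨i, j⟩ hs h1 h2
    dsimp only [arm, leg] at *
    rw [h.rowLen_of_ne h1, h.colLen_of_ne h2]
    exact div_self (hne _ _ (by omega))

/-- The variables `q ^ μ_i t ^ {-i}`. -/
noncomputable def rowVar (q t : K) (Y : YoungDiagram) (i : ℕ) : K := q ^ Y.rowLen i * t⁻¹ ^ i

/-- The Pieri-type coefficient for adding a box in row `r`. -/
noncomputable def addCoeff (q t : K) (L : ℕ) (Y : YoungDiagram) (r : ℕ) : K :=
  (∏ j ∈ Finset.range L, (rowVar q t Y r - t⁻¹ * rowVar q t Y j)) /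
    ∏ j ∈ (Finset.range (L + 1)).erase r, (rowVar q t Y r - rowVar q t Y j)

/-- The Pieri-type coefficient for removing a box in row `r`. -/
noncomputable def removeCoeff (q t : K) (L : ℕ) (Y : YoungDiagram) (r : ℕ) : K :=
  t⁻¹ * ((∏ j ∈ Finset.range (L + 1), (rowVar q t Y r - t * rowVar q t Y j)) /
    (rowVar q t Y r * ∏ j ∈ (Finset.range L).erase r, (rowVar q t Y r - rowVar q t Y j)))

theorem rowVar_ne_zero (hq : q ≠ 0) (ht : t ≠ 0) (Y : YoungDiagram) (i : ℕ) :
    rowVar q t Y i ≠ 0 := mul_ne_zero (pow_ne_zero _ hq) (pow_ne_zero _ (inv_ne_zero ht))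

theorem rowVar_injective (hq : q ≠ 0) (ht : t ≠ 0)
    (hqt : ∀ a b : ℕ, (a, b) ≠ (0, 0) → q ^ a * t ^ b ≠ 1) (Y : YoungDiagram) :
    Function.Injective (rowVar q t Y) := by
  have key : ∀ i j, i < j → rowVar q t Y i ≠ rowVar q t Y j := by
    intro i j hij he
    apply hqt (Y.rowLen i - Y.rowLen j) (j - i) (by simp; omega)
    rw [rowVar, rowVar] at he
    have h1 := Y.rowLen_anti i j hij.le
    rw [pow_sub₀ _ hq h1, pow_sub₀ _ ht hij.le]
    rw [inv_pow, inv_pow] at he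
    have := pow_ne_zero i ht
    have := pow_ne_zero j ht
    have := pow_ne_zero (Y.rowLen j) hq
    field_simp at he ⊢
    linear_combination he
  intro i j he
  rcases lt_trichotomy i j with h | h | h
  · exact absurd he (key _ _ h)
  · exact h
  · exact absurd he.symm (key _ _ h)

/-- With equal rows r and r + 1 one has x_r = t x_{r+1}, a zero of the numerator. Because of this
and the analogous fact for `addCoeff`, sums over corners may run over all rows. -/
theorem removeCoeff_eq_zero (L : ℕ) (Y : YoungDiagram) (r : ℕ) (hr : r < L) (ht : t ≠ 0)
    (h : Y.rowLen (r + 1) = Y.rowLen r) : removeCoeff q t L Y r = 0 := by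
  rw [removeCoeff, Finset.prod_eq_zero (i := r + 1) (by simp; omega), zero_div, mul_zero]
  rw [rowVar, rowVar, h, pow_succ]
  field_simp
  ring

theorem addCoeff_eq_zero (L : ℕ) (Y : YoungDiagram) (r : ℕ) (hr : r < L)
    (h : Y.rowLen (r + 1) = Y.rowLen r) : addCoeff q t L Y (r + 1) = 0 := by
  rw [addCoeff, Finset.prod_eq_zero (i := r) (by simp; omega), zero_div]
  rw [rowVar, rowVar, h, pow_succ]
  ring

end Hooks

/-! ### Duality between adding and removing a box -/

section Weights

variable {K : Type*} [Field K] {q t : K}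

/-- In terms of the ratio z = x_j / x_r, rows below and rows above (`hookFactor_eq_above`) produce
the same pair of expressions, so their contributions merge into one product. -/
theorem hookFactor_eq_below (hq : q ≠ 0) (ht : t ≠ 0) (ρ d : ℕ) (z : K)
    (hz : z = (q ^ ρ * t ^ (d + 1))⁻¹) :
    hookFactor q t (ρ + 1) (d + 1) = (1 - q * z⁻¹) * (1 - t⁻¹ * z) ∧
      hookFactor q t (ρ + 1) d = (1 - q * t⁻¹ * z⁻¹) * (1 - z) := by
  subst hz
  simp only [hookFactor, inv_inv, Nat.add_sub_cancel, inv_pow]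
  constructor <;> congr 2 <;> field_simp <;> ring

theorem hookFactor_eq_above (hq : q ≠ 0) (ht : t ≠ 0) (ρ d : ℕ) (z : K)
    (hz : z = q ^ (ρ + 1) * t ^ (d + 1)) :
    hookFactor q t (ρ + 1) d = (1 - q * z⁻¹) * (1 - t⁻¹ * z) ∧
      hookFactor q t (ρ + 1) (d + 1) = (1 - q * t⁻¹ * z⁻¹) * (1 - z) := by
  subst hz
  simp only [hookFactor, Nat.add_sub_cancel, inv_pow]
  constructor <;> rw [mul_comm] <;> congr 2 <;> field_simp <;> ring

theorem AddsBox.lt_of_card_lt {Y Y' : YoungDiagram} {r L : ℕ} (h : AddsBox Y r Y')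
    (hL : Y.card < L) : r < L := by
  by_contra hc
  have h1 := h.rowLen_lt (i := L - 1) (by omega)
  rw [rowLen_card_eq_zero Y (i := L - 1) (by omega)] at h1
  omega

theorem hookProd_div_hookProd' (hq : q ≠ 0) (ht : t ≠ 0)
    (hqt : ∀ a b : ℕ, (a, b) ≠ (0, 0) → q ^ a * t ^ b ≠ 1)
    {Y Y' : YoungDiagram} {r : ℕ} (h : AddsBox Y r Y') (L : ℕ) (hL : Y.card < L) (χ : K)
    (hχ : χ = rowVar q t Y r) :
    hookProd q t Y / hookProd q t Y' =
      (∏ j ∈ (Finset.range L).erase r,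
        (1 - q * (rowVar q t Y j / χ)⁻¹) * (1 - t⁻¹ * (rowVar q t Y j / χ)) /
          ((1 - q * t⁻¹ * (rowVar q t Y j / χ)⁻¹) * (1 - rowVar q t Y j / χ))) /
        ((1 - q * t⁻¹ * (rowVar q t Y L / χ)⁻¹) * (1 - rowVar q t Y L / χ)) := by
  have hrL := h.lt_of_card_lt hL
  obtain ⟨M, rfl⟩ : ∃ M, L = r + 1 + M := ⟨L - (r + 1), by omega⟩
  rw [hookProd_div_hookProd hqt h M hL.le]
  have hzb : ∀ d, rowVar q t Y (r + 1 + d) / χ =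
      (q ^ (Y.rowLen r - Y.rowLen (r + 1 + d)) * t ^ (d + 1))⁻¹ := fun d => by
    have h1 := Y.rowLen_anti r (r + 1 + d) (by omega)
    rw [hχ, rowVar, rowVar, pow_sub₀ _ hq h1, inv_pow, inv_pow]
    field_simp
    ring
  have hE : (Finset.range (r + 1 + M)).erase r =
      Finset.range r ∪ (Finset.range M).image (fun d => r + 1 + d) := by
    ext j
    simp only [Finset.mem_erase, Finset.mem_range, Finset.mem_union, Finset.mem_image]
    constructor
    · rintro ⟨h1, h2⟩
      rcases lt_or_gt_of_ne h1 with h3 | h3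
      · exact Or.inl h3
      · exact Or.inr ⟨j - (r + 1), by omega, by omega⟩
    · rintro (h1 | ⟨d, hd, rfl⟩) <;> omega
  have hdisj : Disjoint (Finset.range r) ((Finset.range M).image (fun d => r + 1 + d)) := by
    rw [Finset.disjoint_left]
    intro j hj hj'
    simp only [Finset.mem_range, Finset.mem_image] at hj hj'
    omega
  rw [hE, Finset.prod_union hdisj, Finset.prod_image (by intro a _ b _ e; simpa using e),
    mul_comm (∏ x ∈ Finset.range r, _), mul_div_right_comm]
  congr 1
  · congr 1
    · refine Finset.prod_congr rfl fun d _ => ?_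
      obtain ⟨h1, h2⟩ := hookFactor_eq_below hq ht _ d _ (hzb d)
      rw [h1, h2]
    · have h3 := hzb M
      have h0 : Y.rowLen (r + 1 + M) = 0 := rowLen_card_eq_zero Y hL.le
      rw [h0, Nat.sub_zero] at h3
      exact (hookFactor_eq_below hq ht _ M _ h3).2
  · refine Finset.prod_congr rfl fun i hi => ?_
    have hi := Finset.mem_range.1 hi
    have hlt := h.rowLen_lt hi
    obtain ⟨ρ, hρ⟩ : ∃ ρ, Y.rowLen i = Y.rowLen r + (ρ + 1) :=
      ⟨Y.rowLen i - Y.rowLen r - 1, by omega⟩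
    obtain ⟨d, hd⟩ : ∃ d, r = i + (d + 1) := ⟨r - i - 1, by omega⟩
    have hz : rowVar q t Y i / χ = q ^ (ρ + 1) * t ^ (d + 1) := by
      rw [hχ, rowVar, rowVar, hρ, inv_pow, inv_pow]
      have e : t ^ r = t ^ i * t ^ (d + 1) := by rw [hd, pow_add]
      rw [pow_add, e]
      have := pow_ne_zero (Y.rowLen r) hq
      field_simp
    obtain ⟨h1, h2⟩ := hookFactor_eq_above hq ht ρ d _ hz
    rw [← h1, ← h2]
    congr 2 <;> omega

/-- Passing from Y to Y' replaces x_r by q x_r and fixes the other variables. Row by row, the factor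
of the hook ratio times that of `removeCoeff` at Y' is t times that of `addCoeff` at Y; the
remaining row L is empty, and x_L = t^{-L} absorbs the accumulated powers of t. -/
theorem removeCoeff_div_hookProd (hq : q ≠ 0) (ht : t ≠ 0)
    (hqt : ∀ a b : ℕ, (a, b) ≠ (0, 0) → q ^ a * t ^ b ≠ 1)
    {Y Y' : YoungDiagram} {r : ℕ} (h : AddsBox Y r Y') (L : ℕ) (hL : Y.card < L) :
    removeCoeff q t L Y' r / hookProd q t Y' = addCoeff q t L Y r / hookProd q t Y := by
  have hrL := h.lt_of_card_lt hL
  have hH := hookProd_ne_zero hqt Y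
  have hH' := hookProd_ne_zero hqt Y'
  set χ := rowVar q t Y r with hχ
  have hχ0 : χ ≠ 0 := rowVar_ne_zero hq ht Y r
  have hinj := rowVar_injective hq ht hqt Y
  have key := hookProd_div_hookProd' hq ht hqt h L hL χ hχ
  have hself : rowVar q t Y' r = q * χ := by
    rw [hχ, rowVar, rowVar, h.rowLen_self, pow_succ]; ring
  have hother : ∀ j, j ≠ r → rowVar q t Y' j = rowVar q t Y j := fun j hj => by
    rw [rowVar, rowVar, h.rowLen_of_ne hj]
  have hxL : rowVar q t Y L = (t ^ L)⁻¹ := by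
    rw [rowVar, rowLen_card_eq_zero Y hL.le, pow_zero, one_mul, inv_pow]
  have hrem : removeCoeff q t L Y' r = t⁻¹ * (1 - t) * (q * χ - t * rowVar q t Y L) *
      ∏ j ∈ (Finset.range L).erase r,
        (q * χ - t * rowVar q t Y j) / (q * χ - rowVar q t Y j) := by
    have p1 : ∏ j ∈ (Finset.range L).erase r, (rowVar q t Y' r - t * rowVar q t Y' j) =
        ∏ j ∈ (Finset.range L).erase r, (q * χ - t * rowVar q t Y j) :=
      Finset.prod_congr rfl fun j hj => by rw [hother j (Finset.ne_of_mem_erase hj), hself]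
    have p2 : ∏ j ∈ (Finset.range L).erase r, (rowVar q t Y' r - rowVar q t Y' j) =
        ∏ j ∈ (Finset.range L).erase r, (q * χ - rowVar q t Y j) :=
      Finset.prod_congr rfl fun j hj => by rw [hother j (Finset.ne_of_mem_erase hj), hself]
    rw [removeCoeff, Finset.prod_range_succ, ← Finset.mul_prod_erase _ _ (Finset.mem_range.2 hrL),
      p1, p2, hself, hother L hrL.ne', Finset.prod_div_distrib]
    have : q * χ ≠ 0 := mul_ne_zero hq hχ0
    rw [show q * χ - t * (q * χ) = (q * χ) * (1 - t) by ring]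
    field_simp
  have hadd : addCoeff q t L Y r = χ * (1 - t⁻¹) / (χ - rowVar q t Y L) *
      ∏ j ∈ (Finset.range L).erase r,
        (χ - t⁻¹ * rowVar q t Y j) / (χ - rowVar q t Y j) := by
    rw [addCoeff, Finset.range_add_one, Finset.erase_insert_of_ne hrL.ne',
      Finset.prod_insert (by simp), ← Finset.mul_prod_erase _ _ (Finset.mem_range.2 hrL), ← hχ,
      Finset.prod_div_distrib, div_mul_div_comm]
    ring
  have hzne : ∀ j, j ≠ r → (1 - rowVar q t Y j / χ) ≠ 0 := fun j hj => by
    rw [sub_ne_zero, ne_comm, ne_eq, div_eq_one_iff_eq hχ0]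
    exact fun e => hj (hinj e)
  -- A vanishing denominator would make the quotient of hook products 0, by the convention a / 0 =
  -- 0, whereas both hook products are nonzero.
  have hzne2 : ∀ j ∈ insert L ((Finset.range L).erase r),
      (1 - q * t⁻¹ * (rowVar q t Y j / χ)⁻¹) ≠ 0 := by
    intro j hj h0
    have : hookProd q t Y / hookProd q t Y' = 0 := by
      rw [key]
      rcases Finset.mem_insert.1 hj with rfl | hj
      · rw [h0, zero_mul, div_zero]
      · rw [Finset.prod_eq_zero hj (by rw [h0, zero_mul, div_zero]), zero_div]
    exact div_ne_zero hH hH' this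
  have hnum : ∀ j ∈ (Finset.range L).erase r, (1 - q * (rowVar q t Y j / χ)⁻¹) ≠ 0 := by
    intro j hj h0
    have : hookProd q t Y / hookProd q t Y' = 0 := by
      rw [key, Finset.prod_eq_zero hj (by rw [h0, zero_mul, zero_div]), zero_div]
    exact div_ne_zero hH hH' this
  have hterm : ∀ j ∈ (Finset.range L).erase r,
      (1 - q * (rowVar q t Y j / χ)⁻¹) * (1 - t⁻¹ * (rowVar q t Y j / χ)) /
          ((1 - q * t⁻¹ * (rowVar q t Y j / χ)⁻¹) * (1 - rowVar q t Y j / χ)) *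
        ((q * χ - t * rowVar q t Y j) / (q * χ - rowVar q t Y j)) =
      t * ((χ - t⁻¹ * rowVar q t Y j) / (χ - rowVar q t Y j)) := by
    intro j hj
    have hx := rowVar_ne_zero hq ht Y j
    have h1 := hzne j (Finset.ne_of_mem_erase hj)
    have h2 := hzne2 j (Finset.mem_insert_of_mem hj)
    have h3 := hnum j hj
    obtain ⟨z, hz⟩ : ∃ z, z = rowVar q t Y j / χ := ⟨_, rfl⟩
    have hzχ : rowVar q t Y j = χ * z := by rw [hz]; field_simp
    rw [← hz] at h1 h2 h3 ⊢
    have hz0 : z ≠ 0 := by rw [hz]; exact div_ne_zero hx hχ0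
    rw [hzχ, show q * χ - χ * z = -χ * z * (1 - q * z⁻¹) by field_simp; ring,
      show q * χ - t * (χ * z) = -(t * χ * z) * (1 - q * t⁻¹ * z⁻¹) by field_simp; ring,
      show χ - χ * z = χ * (1 - z) by ring, show χ - t⁻¹ * (χ * z) = χ * (1 - t⁻¹ * z) by ring]
    generalize 1 - q * z⁻¹ = a at *
    generalize 1 - q * t⁻¹ * z⁻¹ = b at *
    generalize 1 - z = c at *
    generalize 1 - t⁻¹ * z = e at *
    field_simp
  have hcard : ((Finset.range L).erase r).card = L - 1 := by
    rw [Finset.card_erase_of_mem (Finset.mem_range.2 hrL), Finset.card_range]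
  have hratio : removeCoeff q t L Y' r * (hookProd q t Y / hookProd q t Y') =
      addCoeff q t L Y r := by
    rw [hrem, hadd, key]
    have hp := Finset.prod_congr rfl hterm
    rw [Finset.prod_mul_distrib, Finset.prod_mul_distrib, Finset.prod_const, hcard] at hp
    have h1 := hzne L hrL.ne'
    have h2 := hzne2 L (Finset.mem_insert_self _ _)
    set A := ∏ j ∈ (Finset.range L).erase r, (χ - t⁻¹ * rowVar q t Y j) / (χ - rowVar q t Y j)
    set B := ∏ j ∈ (Finset.range L).erase r,
      (1 - q * (rowVar q t Y j / χ)⁻¹) * (1 - t⁻¹ * (rowVar q t Y j / χ)) /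
          ((1 - q * t⁻¹ * (rowVar q t Y j / χ)⁻¹) * (1 - rowVar q t Y j / χ))
    set D := ∏ j ∈ (Finset.range L).erase r,
      (q * χ - t * rowVar q t Y j) / (q * χ - rowVar q t Y j)
    have hx0 := rowVar_ne_zero hq ht Y L
    have e1 : (1 - q * t⁻¹ * (rowVar q t Y L / χ)⁻¹) =
        -(q * χ - t * rowVar q t Y L) / (t * rowVar q t Y L) := by
      field_simp
      ring
    have e2 : (1 - rowVar q t Y L / χ) = (χ - rowVar q t Y L) / χ := by
      field_simp
    -- The L - 1 rows other than r each contributed one factor t.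
    have e3 : t ^ (L - 1) * rowVar q t Y L * t = 1 := by
      rw [hxL]
      obtain ⟨L', rfl⟩ : ∃ L', L = L' + 1 := ⟨L - 1, by omega⟩
      rw [Nat.add_sub_cancel, pow_succ]
      field_simp
    rw [e1] at h2 ⊢
    rw [e2] at h1 ⊢
    have h3 : q * χ - t * rowVar q t Y L ≠ 0 := fun h0 => h2 (by rw [h0]; simp)
    have h4 : χ - rowVar q t Y L ≠ 0 := fun h0 => h1 (by rw [h0]; simp)
    have hL : t⁻¹ * (1 - t) * (q * χ - t * rowVar q t Y L) * D *
        (B / (-(q * χ - t * rowVar q t Y L) / (t * rowVar q t Y L) *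
          ((χ - rowVar q t Y L) / χ))) =
        (t - 1) * (B * D) * rowVar q t Y L * χ / (χ - rowVar q t Y L) := by
      field_simp
      ring
    rw [hL, hp]
    have e4 : (t - 1) * (t ^ (L - 1) * A) * rowVar q t Y L * χ =
      χ * (1 - t⁻¹) * A * (t ^ (L - 1) * rowVar q t Y L * t) := by
      field_simp
    rw [e4, e3]
    ring
  rw [← hratio]
  field_simp

end Weights

/-! ### The corner alphabet and sums over rows -/

section DiagramSums

variable {K : Type*} [Field K] {q t : K}

/-- The power sums of the box contents `q ^ {a'} t ^ {-l'}`. -/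
noncomputable def contentPow (q t : K) (k : ℕ) (Y : YoungDiagram) : K :=
  ∑ s ∈ Y.cells, (t⁻¹ ^ coleg s * q ^ coarm s) ^ k

theorem AddsBox.contentPow_eq {Y Y' : YoungDiagram} {r : ℕ} (h : AddsBox Y r Y') (k : ℕ) :
    contentPow q t k Y' = contentPow q t k Y + rowVar q t Y r ^ k := by
  rw [contentPow, h, Finset.sum_insert (AddsBox.notMem Y r), add_comm, contentPow, rowVar,
    mul_comm (q ^ _)]
  rfl

theorem sum_cells_eq (Y : YoungDiagram) (L : ℕ) (hL : Y.card ≤ L) (f : ℕ × ℕ → K) :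
    ∑ s ∈ Y.cells, f s = ∑ i ∈ Finset.range L, ∑ j ∈ Finset.range (Y.rowLen i), f (i, j) := by
  rw [← Finset.sum_finset_product' (r := Y.cells) (f := fun i j => f (i, j))]
  rintro ⟨i, j⟩
  rw [YoungDiagram.mem_cells, YoungDiagram.mem_iff_lt_rowLen, Finset.mem_range, Finset.mem_range]
  refine ⟨fun h => ⟨?_, h⟩, fun h => h.2⟩
  by_contra hc
  rw [rowLen_card_eq_zero Y (by omega : Y.card ≤ i)] at h
  omega

/-- The power sums of the virtual alphabet `∑_{i ≤ L} x_i - t⁻¹ ∑_{i < L} x_i`. -/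
noncomputable def cornerPow (q t : K) (L k : ℕ) (Y : YoungDiagram) : K :=
  ∑ i ∈ Finset.range (L + 1), rowVar q t Y i ^ k -
    ∑ i ∈ Finset.range L, (t⁻¹ * rowVar q t Y i) ^ k

/-- Geometric sums along each row, then one down the first column. In particular the value does not
depend on L. -/
theorem cornerPow_eq (L k : ℕ) (Y : YoungDiagram) (hL : Y.card ≤ L) :
    cornerPow q t L k Y = 1 - (1 - q ^ k) * (1 - t⁻¹ ^ k) * contentPow q t k Y := by
  have h1 : ∀ i, (1 - q ^ k) * ∑ j ∈ Finset.range (Y.rowLen i), (t⁻¹ ^ i * q ^ j) ^ k =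
      (t⁻¹ ^ k) ^ i - rowVar q t Y i ^ k := by
    intro i
    have := mul_neg_geom_sum (q ^ k) (Y.rowLen i)
    have e : ∑ j ∈ Finset.range (Y.rowLen i), (t⁻¹ ^ i * q ^ j) ^ k =
        (t⁻¹ ^ k) ^ i * ∑ j ∈ Finset.range (Y.rowLen i), (q ^ k) ^ j := by
      rw [Finset.mul_sum]
      refine Finset.sum_congr rfl fun j _ => ?_
      rw [mul_pow, pow_right_comm, pow_right_comm q]
    rw [e, mul_left_comm, this, rowVar, mul_pow, pow_right_comm q, pow_right_comm t⁻¹]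
    ring
  have h2 : (1 - q ^ k) * contentPow q t k Y =
      ∑ i ∈ Finset.range L, ((t⁻¹ ^ k) ^ i - rowVar q t Y i ^ k) := by
    rw [contentPow, sum_cells_eq Y L hL, Finset.mul_sum]
    exact Finset.sum_congr rfl fun i _ => h1 i
  have h3 := mul_neg_geom_sum (t⁻¹ ^ k) L
  have h4 : rowVar q t Y L ^ k = (t⁻¹ ^ k) ^ L := by
    rw [rowVar, rowLen_card_eq_zero Y hL, pow_zero, one_mul, pow_right_comm]
  rw [mul_right_comm, h2, cornerPow, Finset.sum_range_succ, h4, Finset.sum_sub_distrib]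
  simp only [mul_pow, ← Finset.mul_sum]
  linear_combination h3

theorem sum_partialFractions_image {ι κ : Type*} [DecidableEq ι] {s : Finset ι} {x : ι → K}
    (hx : Function.Injective x) [DecidableEq K] (hx0 : ∀ i, x i ≠ 0) (T : Finset κ) (y : κ → K)
    (k : ℕ) :
    ∑ i ∈ s, x i ^ k * (∏ j ∈ T, (x i - y j)) / (x i * ∏ j ∈ s.erase i, (x i - x j)) +
        0 ^ k * (∏ j ∈ T, -y j) / ∏ i ∈ s, (-x i) =
      PowerSeries.coeff (k + T.card) (PowerSeries.X ^ s.card *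
        ratioSeries (s.image x) (T.val.map y)) := by
  have h := sum_partialFractions (s.image x)
    (by simpa using fun i _ => hx0 i) (T.val.map y) k
  rw [Finset.sum_image hx.injOn, Finset.prod_image hx.injOn, Finset.card_image_of_injective _ hx,
    Multiset.card_map, Finset.card_val] at h
  rw [← h]
  simp only [Multiset.map_map, Function.comp_def]
  refine congrArg₂ _ (Finset.sum_congr rfl fun i _ => ?_) rfl
  rw [← Finset.image_erase hx, Finset.prod_image hx.injOn]
  rfl

theorem ratioSeries_coeff_one (s : Finset K) (Y : Multiset K) :
    PowerSeries.coeff 1 (ratioSeries s Y) = ∑ x ∈ s, x - Y.sum := by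
  have h := ratioSeries_newton s Y 0
  simpa [coeff_zero_ratioSeries, -PowerSeries.coeff_zero_eq_constantCoeff] using h

theorem ratioSeries_coeff_two (s : Finset K) (Y : Multiset K) :
    2 * PowerSeries.coeff 2 (ratioSeries s Y) =
      (∑ x ∈ s, x - Y.sum) ^ 2 + (∑ x ∈ s, x ^ 2 - (Y.map (· ^ 2)).sum) := by
  have h := ratioSeries_newton s Y 1
  rw [Finset.sum_range_succ, Finset.sum_range_one, Nat.cast_one, one_add_one_eq_two] at h
  simp only [zero_add, tsub_zero, tsub_self, coeff_zero_ratioSeries, ratioSeries_coeff_one,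
    pow_one, Multiset.map_id'] at h
  rw [h]
  ring

theorem rowVar_eq_of_card_le {L : ℕ} {Y : YoungDiagram} (hL : Y.card ≤ L) :
    rowVar q t Y L = (t ^ L)⁻¹ := by
  rw [rowVar, rowLen_card_eq_zero Y hL, pow_zero, one_mul, inv_pow]

/-- The sum against x^k is the partial fraction sum of exponent k + 1 with nodes x_0, …, x_L and 0,
hence h_k of the corner alphabet; Newton's recursion gives h_1 and h_2. For k = -1 the total
vanishes by degree, and the node 0 alone accounts for the value 1. -/
theorem addCoeff_sums (hq : q ≠ 0) (ht : t ≠ 0)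
    (hqt : ∀ a b : ℕ, (a, b) ≠ (0, 0) → q ^ a * t ^ b ≠ 1) (h2 : (2 : K) ≠ 0)
    (L : ℕ) (Y : YoungDiagram) (hL : Y.card ≤ L) :
    ∑ i ∈ Finset.range (L + 1), addCoeff q t L Y i * (rowVar q t Y i)⁻¹ = 1 ∧
    ∑ i ∈ Finset.range (L + 1), addCoeff q t L Y i = 1 ∧
    ∑ i ∈ Finset.range (L + 1), addCoeff q t L Y i * rowVar q t Y i = cornerPow q t L 1 Y ∧
    ∑ i ∈ Finset.range (L + 1), addCoeff q t L Y i * rowVar q t Y i ^ 2 =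
      (cornerPow q t L 1 Y ^ 2 + cornerPow q t L 2 Y) / 2 := by
  classical
  have hinj := rowVar_injective hq ht hqt Y
  have hx0 := rowVar_ne_zero hq ht Y
  have key := sum_partialFractions_image (s := Finset.range (L + 1)) hinj hx0 (Finset.range L)
    (fun j => t⁻¹ * rowVar q t Y j)
  set G := ratioSeries ((Finset.range (L + 1)).image (rowVar q t Y))
    ((Finset.range L).val.map fun j => t⁻¹ * rowVar q t Y j) with hG
  have e1 : ∑ x ∈ (Finset.range (L + 1)).image (rowVar q t Y), x -
      ((Finset.range L).val.map fun j => t⁻¹ * rowVar q t Y j).sum = cornerPow q t L 1 Y := by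
    rw [Finset.sum_image hinj.injOn, cornerPow]
    simp only [pow_one]
    rfl
  have e2 : ∑ x ∈ (Finset.range (L + 1)).image (rowVar q t Y), x ^ 2 -
      (((Finset.range L).val.map fun j => t⁻¹ * rowVar q t Y j).map (· ^ 2)).sum =
        cornerPow q t L 2 Y := by
    rw [Finset.sum_image hinj.injOn, cornerPow, Multiset.map_map]
    rfl
  have hsucc : ∀ k, ∑ i ∈ Finset.range (L + 1), addCoeff q t L Y i * rowVar q t Y i ^ k =
      PowerSeries.coeff k G := by
    intro k
    have := key (k + 1)
    rw [zero_pow (Nat.succ_ne_zero k), zero_mul, zero_div, add_zero, Finset.card_range, Finset.card_range,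
      show k + 1 + L = k + (L + 1) by ring, PowerSeries.coeff_X_pow_mul] at this
    rw [← this]
    refine Finset.sum_congr rfl fun i _ => ?_
    rw [addCoeff, pow_succ, mul_right_comm, mul_comm (rowVar q t Y i), mul_div_mul_right _ _ (hx0 i)]
    ring
  refine ⟨?_, ?_, ?_, ?_⟩
  · have := key 0
    rw [zero_add, Finset.card_range, Finset.card_range, PowerSeries.coeff_X_pow_mul', if_neg (by omega)] at this
    -- Common factors cancel and leave t^{-L} / (-x_L), with x_L = t^{-L} because row L is empty.
    have hc : (0 : K) ^ 0 * (∏ j ∈ Finset.range L, -(t⁻¹ * rowVar q t Y j)) /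
        ∏ i ∈ Finset.range (L + 1), (-rowVar q t Y i) = -1 := by
      rw [Finset.prod_range_succ, pow_zero, one_mul]
      simp only [neg_mul_eq_mul_neg, Finset.prod_mul_distrib, Finset.prod_const, Finset.card_range]
      rw [rowVar_eq_of_card_le hL]
      have : ∏ i ∈ Finset.range L, (-rowVar q t Y i) ≠ 0 :=
        Finset.prod_ne_zero_iff.2 fun i _ => neg_ne_zero.2 (hx0 i)
      rw [inv_pow]
      field_simp
    rw [hc, add_neg_eq_zero] at this
    rw [← this]
    refine Finset.sum_congr rfl fun i _ => ?_
    rw [addCoeff, pow_zero, one_mul]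
    ring
  · simpa [coeff_zero_ratioSeries, hG, -PowerSeries.coeff_zero_eq_constantCoeff] using hsucc 0
  · have := hsucc 1
    rw [hG, ratioSeries_coeff_one, e1] at this
    simpa using this
  · rw [hsucc 2, eq_div_iff h2, mul_comm, hG, ratioSeries_coeff_two, e1, e2]

/-- Nodes and zeros change roles: the alphabet is now ∑_{i < L} x_i - t ∑_{i ≤ L} x_i, with power
sums -t^k times those of the corners. There is one zero more than there are nonzero nodes, so x^k
leads to h_{k+1}; for k = 0 the node 0 adds the term 1. -/
theorem removeCoeff_sums (hq : q ≠ 0) (ht : t ≠ 0)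
    (hqt : ∀ a b : ℕ, (a, b) ≠ (0, 0) → q ^ a * t ^ b ≠ 1) (h2 : (2 : K) ≠ 0)
    (L : ℕ) (Y : YoungDiagram) (hL : Y.card ≤ L) :
    ∑ i ∈ Finset.range L, removeCoeff q t L Y i = 1 - cornerPow q t L 1 Y ∧
    ∑ i ∈ Finset.range L, removeCoeff q t L Y i * rowVar q t Y i =
      t * (cornerPow q t L 1 Y ^ 2 - cornerPow q t L 2 Y) / 2 := by
  classical
  have hinj := rowVar_injective hq ht hqt Y
  have hx0 := rowVar_ne_zero hq ht Y
  have key := sum_partialFractions_image (s := Finset.range L) hinj hx0 (Finset.range (L + 1))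
    (fun j => t * rowVar q t Y j)
  set G := ratioSeries ((Finset.range L).image (rowVar q t Y))
    ((Finset.range (L + 1)).val.map fun j => t * rowVar q t Y j) with hG
  have e1 : ∑ x ∈ (Finset.range L).image (rowVar q t Y), x -
      ((Finset.range (L + 1)).val.map fun j => t * rowVar q t Y j).sum =
        -t * cornerPow q t L 1 Y := by
    have : ((Finset.range (L + 1)).val.map fun j => t * rowVar q t Y j).sum =
      ∑ j ∈ Finset.range (L + 1), t * rowVar q t Y j := rfl
    rw [this, Finset.sum_image hinj.injOn, cornerPow]
    simp only [pow_one, ← Finset.mul_sum]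
    field_simp
    ring
  have e2 : ∑ x ∈ (Finset.range L).image (rowVar q t Y), x ^ 2 -
      (((Finset.range (L + 1)).val.map fun j => t * rowVar q t Y j).map (· ^ 2)).sum =
        -t ^ 2 * cornerPow q t L 2 Y := by
    rw [Multiset.map_map]
    have : ((Finset.range (L + 1)).val.map ((fun x => x ^ 2) ∘ fun j => t * rowVar q t Y j)).sum =
      ∑ j ∈ Finset.range (L + 1), (t * rowVar q t Y j) ^ 2 := rfl
    rw [this, Finset.sum_image hinj.injOn, cornerPow]
    simp only [mul_pow, ← Finset.mul_sum]
    field_simp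
    ring
  have hall : ∀ k, ∑ i ∈ Finset.range L, removeCoeff q t L Y i * rowVar q t Y i ^ k - 0 ^ k =
      t⁻¹ * PowerSeries.coeff (k + 1) G := by
    intro k
    have := key k
    rw [Finset.card_range, Finset.card_range, ← add_assoc, add_right_comm, PowerSeries.coeff_X_pow_mul] at this
    have hc : (0 : K) ^ k * (∏ j ∈ Finset.range (L + 1), -(t * rowVar q t Y j)) /
        ∏ i ∈ Finset.range L, (-rowVar q t Y i) = -t * 0 ^ k := by
      rw [Finset.prod_range_succ]
      simp only [neg_mul_eq_mul_neg, Finset.prod_mul_distrib, Finset.prod_const, Finset.card_range]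
      rw [rowVar_eq_of_card_le hL]
      have : ∏ i ∈ Finset.range L, (-rowVar q t Y i) ≠ 0 :=
        Finset.prod_ne_zero_iff.2 fun i _ => neg_ne_zero.2 (hx0 i)
      field_simp
    rw [hc] at this
    rw [← this, mul_add, Finset.mul_sum]
    have e3 : t⁻¹ * (-t * (0 : K) ^ k) = -0 ^ k := by field_simp
    rw [e3, sub_eq_add_neg]
    refine congrArg₂ _ (Finset.sum_congr rfl fun i _ => ?_) rfl
    rw [removeCoeff]
    ring
  constructor
  · have := hall 0
    rw [zero_add, hG, ratioSeries_coeff_one, e1] at this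
    simp only [pow_zero, mul_one] at this
    rw [sub_eq_iff_eq_add.1 this]
    field_simp
    ring
  · have := hall 1
    rw [zero_pow one_ne_zero, sub_zero] at this
    simp only [pow_one] at this
    have h3 := ratioSeries_coeff_two ((Finset.range L).image (rowVar q t Y))
      ((Finset.range (L + 1)).val.map fun j => t * rowVar q t Y j)
    rw [e1, e2, ← hG] at h3
    rw [this, eq_div_iff h2, mul_assoc, mul_comm _ (2 : K), h3]
    field_simp
    ring

end DiagramSums

/-! ### Partitions of n and Young diagrams with n boxes -/

section Partitions

theorem sum_range_getD (w : List ℕ) (L : ℕ) (hL : w.length ≤ L) :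
    ∑ i ∈ Finset.range L, w.getD i 0 = w.sum := by
  induction w generalizing L with
  | nil => simp
  | cons a w ih =>
    obtain ⟨L, rfl⟩ : ∃ L', L = L' + 1 := ⟨L - 1, by simp at hL; omega⟩
    rw [Finset.sum_range_succ']
    simp only [List.getD_cons_succ, List.getD_cons_zero, List.sum_cons]
    rw [ih L (by simpa using hL), add_comm]

theorem rowLen_ofRowLens_eq_getD (w : List ℕ) (hw : w.SortedGE) (i : ℕ) :
    (YoungDiagram.ofRowLens w hw).rowLen i = w.getD i 0 := by
  refine eq_of_forall_lt_iff fun j => ?_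
  rw [← YoungDiagram.mem_iff_lt_rowLen, YoungDiagram.mem_ofRowLens, List.getD_eq_getElem?_getD]
  rcases lt_or_ge i w.length with h | h
  · simp [h]
  · simp [h]

theorem card_ofRowLens (w : List ℕ) (hw : w.SortedGE) :
    (YoungDiagram.ofRowLens w hw).card = w.sum := by
  set Y := YoungDiagram.ofRowLens w hw
  -- Boxes are counted by rows in ℚ, since `sum_cells_eq` takes values in a field; the maximum
  -- covers both all rows of Y and the whole list w.
  have h := sum_cells_eq Y (max Y.card w.length) (le_max_left _ _) (fun _ => (1 : ℚ))
  have h' : (Y.card : ℚ) = (w.sum : ℕ) := by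
    rw [← sum_range_getD w _ (le_max_right Y.card w.length)]
    have e : Y.card = Y.cells.card := rfl
    simp only [Finset.sum_const, nsmul_eq_mul, mul_one, Finset.card_range] at h
    rw [e, h]
    push_cast
    refine Finset.sum_congr rfl fun i _ => ?_
    rw [rowLen_ofRowLens_eq_getD]
  exact_mod_cast h'

theorem card_young {n : ℕ} (μ : n.Partition) : (young μ).card = n := by
  rw [young, card_ofRowLens, ← Multiset.sum_coe, Multiset.sort_eq, μ.parts_sum]

theorem rowLens_young {n : ℕ} (μ : n.Partition) :
    (young μ).rowLens = μ.parts.sort (· ≥ ·) :=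
  YoungDiagram.rowLens_ofRowLens_eq_self fun _ hx =>
    μ.parts_pos ((Multiset.mem_sort _).1 hx)

theorem young_injective (n : ℕ) : Function.Injective (young : n.Partition → YoungDiagram) := by
  intro μ ν h
  have h1 := congrArg YoungDiagram.rowLens h
  rw [rowLens_young, rowLens_young] at h1
  have h2 := congrArg (fun l : List ℕ => (l : Multiset ℕ)) h1
  simp only [Multiset.sort_eq] at h2
  exact Nat.Partition.ext h2

theorem exists_young_eq (Y : YoungDiagram) : ∃ μ : Y.card.Partition, young μ = Y := by
  have hs : Y.rowLens.sum = Y.card := by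
    rw [← card_ofRowLens _ Y.rowLens_sorted, YoungDiagram.ofRowLens_to_rowLens_eq_self]
  refine ⟨⟨(Y.rowLens : Multiset ℕ), fun {i} hi => Y.pos_of_mem_rowLens i (by simpa using hi), ?_⟩,
    ?_⟩
  · rw [Multiset.sum_coe, hs]
  · have e : (Y.rowLens : Multiset ℕ).sort (· ≥ ·) = Y.rowLens := by
      rw [Multiset.coe_sort]
      exact List.mergeSort_of_pairwise (by simpa using Y.rowLens_sorted.pairwise)
    conv_rhs => rw [← YoungDiagram.ofRowLens_to_rowLens_eq_self (μ := Y)]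
    simp only [young, e]

/-- The Young diagrams with `n` boxes. -/
noncomputable def diagrams (n : ℕ) : Finset YoungDiagram :=
  (Finset.univ : Finset n.Partition).map ⟨young, young_injective n⟩

theorem mem_diagrams {n : ℕ} {Y : YoungDiagram} : Y ∈ diagrams n ↔ Y.card = n := by
  simp only [diagrams, Finset.mem_map, Finset.mem_univ, Function.Embedding.coeFn_mk, true_and]
  constructor
  · rintro ⟨μ, rfl⟩
    exact card_young μ
  · rintro rfl
    exact exists_young_eq Y

theorem sum_partition_eq {M : Type*} [AddCommMonoid M] (n : ℕ) (f : YoungDiagram → M) :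
    ∑ μ : n.Partition, f (young μ) = ∑ Y ∈ diagrams n, f Y := by
  rw [diagrams, Finset.sum_map]
  rfl

end Partitions

/-! ### Weights of diagrams and double counting -/

section Brackets

variable {K : Type*} [Field K] {q t u v : K}

/-- The weight of a Young diagram. -/
noncomputable def diagramWeight (q t u v : K) (Y : YoungDiagram) : K :=
  (∏ s ∈ Y.cells, (1 - v * (q ^ coarm s * t⁻¹ ^ coleg s)⁻¹) *
    (1 - u * (q ^ coarm s * t⁻¹ ^ coleg s))) / hookProd q t Y

/-- One factor -u goes to each box. With c = q^{a'} t^{-l'}, the product -u (q^{a'} - v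
t^{l'})(t^{-l'} - u⁻¹ q^{-a'}) equals (1 - v/c)(1 - uc). -/
theorem weight_eq (hq : q ≠ 0) (ht : t ≠ 0) (hu : u ≠ 0) {n : ℕ} (μ : n.Partition) :
    weight q t u v μ = diagramWeight q t u v (young μ) := by
  rw [weight, diagramWeight, hookProd, ← Finset.prod_div_distrib]
  have hc : (-u) ^ n = ∏ s ∈ (young μ).cells, (-u) := by
    rw [Finset.prod_const]
    exact congrArg _ (card_young μ).symm
  rw [hc, ← Finset.prod_mul_distrib]
  refine Finset.prod_congr rfl fun s _ => ?_
  rw [hookFactor, Nat.add_sub_cancel, div_mul_div_comm, mul_div_assoc']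
  congr 1
  simp only [inv_pow]
  field_simp
  ring

theorem diagramWeight_step (hq : q ≠ 0) (ht : t ≠ 0)
    (hqt : ∀ a b : ℕ, (a, b) ≠ (0, 0) → q ^ a * t ^ b ≠ 1)
    {Y Y' : YoungDiagram} {r : ℕ} (h : AddsBox Y r Y') (L : ℕ) (hL : Y.card < L) :
    diagramWeight q t u v Y' * removeCoeff q t L Y' r = diagramWeight q t u v Y *
      (addCoeff q t L Y r * ((1 - v * (rowVar q t Y r)⁻¹) * (1 - u * rowVar q t Y r))) := by
  have key := removeCoeff_div_hookProd hq ht hqt h L hL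
  rw [diagramWeight, diagramWeight, h, Finset.prod_insert (AddsBox.notMem Y r), div_mul_eq_mul_div,
    mul_div_assoc, key, rowVar]
  simp only [coarm, coleg]
  ring

/-- Double counting of the pairs Y ⊂ Y' differing by one box in row i. Both sides become the same
triple sum: the coefficients vanish where a box cannot be removed or added, and otherwise Y and Y'
determine each other once the row is fixed. -/
theorem sum_diagrams_succ (hq : q ≠ 0) (ht : t ≠ 0)
    (hqt : ∀ a b : ℕ, (a, b) ≠ (0, 0) → q ^ a * t ^ b ≠ 1) (n : ℕ)
    (φ ψ : YoungDiagram → ℕ → K) (hφ : ∀ Y r Y', AddsBox Y r Y' → φ Y' r = ψ Y r) :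
    ∑ Y' ∈ diagrams (n + 1), diagramWeight q t u v Y' *
        ∑ i ∈ Finset.range (n + 1), removeCoeff q t (n + 1) Y' i * φ Y' i =
      ∑ Y ∈ diagrams n, diagramWeight q t u v Y *
        ∑ i ∈ Finset.range (n + 1 + 1), addCoeff q t (n + 1) Y i *
          ((1 - v * (rowVar q t Y i)⁻¹) * (1 - u * rowVar q t Y i)) * ψ Y i := by
  classical
  have hl : ∀ Y' ∈ diagrams (n + 1), diagramWeight q t u v Y' *
      ∑ i ∈ Finset.range (n + 1), removeCoeff q t (n + 1) Y' i * φ Y' i =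
      ∑ i ∈ Finset.range (n + 1), ∑ Y ∈ diagrams n, if AddsBox Y i Y' then
        diagramWeight q t u v Y' * removeCoeff q t (n + 1) Y' i * φ Y' i else 0 := by
    intro Y' hY'
    rw [Finset.mul_sum]
    refine Finset.sum_congr rfl fun i hi => ?_
    have hi := Finset.mem_range.1 hi
    by_cases hr : Y'.rowLen (i + 1) = Y'.rowLen i
    · rw [removeCoeff_eq_zero _ _ _ hi ht hr]
      simp
    · obtain ⟨Y, hY⟩ := AddsBox.exists_left Y' i
        (lt_of_le_of_ne (Y'.rowLen_anti _ _ (Nat.le_succ i)) hr)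
      rw [Finset.sum_eq_single Y, if_pos hY, mul_assoc]
      · intro Y₂ _ hne
        rw [if_neg fun h2 => hne (h2.left_unique hY)]
      · intro hn
        refine absurd (mem_diagrams.2 ?_) hn
        have := hY.card_eq
        have := mem_diagrams.1 hY'
        omega
  have hr : ∀ Y ∈ diagrams n, diagramWeight q t u v Y *
      ∑ i ∈ Finset.range (n + 1 + 1), addCoeff q t (n + 1) Y i *
          ((1 - v * (rowVar q t Y i)⁻¹) * (1 - u * rowVar q t Y i)) * ψ Y i =
      ∑ i ∈ Finset.range (n + 1), ∑ Y' ∈ diagrams (n + 1), if AddsBox Y i Y' then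
        diagramWeight q t u v Y' * removeCoeff q t (n + 1) Y' i * φ Y' i else 0 := by
    intro Y hY
    have hcard := mem_diagrams.1 hY
    -- Row n of Y is empty, so the last row n + 1 cannot receive a box and its term drops out.
    have hz : Y.rowLen (n + 1) = Y.rowLen n := by
      rw [rowLen_card_eq_zero Y hcard.le, rowLen_card_eq_zero Y (by omega)]
    rw [Finset.sum_range_succ, addCoeff_eq_zero _ _ _ (Nat.lt_succ_self n) hz, zero_mul, zero_mul,
      add_zero, Finset.mul_sum]
    refine Finset.sum_congr rfl fun i hi => ?_
    have hi := Finset.mem_range.1 hi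
    by_cases ha : ∀ k < i, Y.rowLen i < Y.rowLen k
    · obtain ⟨Y', hY'⟩ := AddsBox.exists_right Y i ha
      rw [Finset.sum_eq_single Y', if_pos hY',
        diagramWeight_step hq ht hqt hY' _ (by omega), hφ _ _ _ hY']
      · ring
      · intro Y₂ _ hne
        rw [if_neg fun h2 => hne (h2.right_unique hY')]
      · intro hn
        refine absurd (mem_diagrams.2 ?_) hn
        rw [hY'.card_eq, hcard]
    · rw [Finset.sum_eq_zero fun Y' _ => if_neg fun h2 => ha fun k hk => h2.rowLen_lt hk]
      push Not at ha
      obtain ⟨k, hk, hle⟩ := ha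
      obtain ⟨m, rfl⟩ : ∃ m, i = m + 1 := ⟨i - 1, by omega⟩
      rw [addCoeff_eq_zero _ _ _ (by omega)]
      · simp
      · have h1 := Y.rowLen_anti k m (by omega)
        have h2 := Y.rowLen_anti m (m + 1) (by omega)
        omega
  rw [Finset.sum_congr rfl hl, Finset.sum_congr rfl hr, Finset.sum_comm]
  conv_rhs => rw [Finset.sum_comm]
  exact Finset.sum_congr rfl fun i _ => Finset.sum_comm

/-- The bracket of a function on Young diagrams. -/
noncomputable def diagramBracket (q t u v : K) (f : YoungDiagram → K) : PowerSeries K :=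
  PowerSeries.mk fun n => ∑ Y ∈ diagrams n, diagramWeight q t u v Y * f Y

theorem diagramBracket_add (f g : YoungDiagram → K) :
    diagramBracket q t u v (fun Y => f Y + g Y) =
      diagramBracket q t u v f + diagramBracket q t u v g := by
  ext n
  simp [diagramBracket, mul_add, Finset.sum_add_distrib]

theorem diagramBracket_smul (c : K) (f : YoungDiagram → K) :
    diagramBracket q t u v (fun Y => c * f Y) = PowerSeries.C c * diagramBracket q t u v f := by
  ext n
  simp only [diagramBracket, PowerSeries.coeff_mk, PowerSeries.coeff_C_mul, Finset.mul_sum]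
  exact Finset.sum_congr rfl fun Y _ => by ring

theorem diagramBracket_eq_X_mul {f g : YoungDiagram → K}
    (h0 : ∀ Y : YoungDiagram, Y.card = 0 → f Y = 0)
    (h : ∀ n, ∑ Y ∈ diagrams (n + 1), diagramWeight q t u v Y * f Y =
      ∑ Y ∈ diagrams n, diagramWeight q t u v Y * g Y) :
    diagramBracket q t u v f = PowerSeries.X * diagramBracket q t u v g := by
  ext n
  rcases n with _ | n
  · rw [PowerSeries.coeff_zero_X_mul, diagramBracket, PowerSeries.coeff_mk]
    exact Finset.sum_eq_zero fun Y hY => by rw [h0 Y (mem_diagrams.1 hY), mul_zero]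
  · rw [PowerSeries.coeff_succ_X_mul, diagramBracket, diagramBracket, PowerSeries.coeff_mk,
      PowerSeries.coeff_mk, h n]

end Brackets

/-! ### Linear relations between the brackets -/

section BracketValues

variable {K : Type*} [Field K] {q t u v : K}

theorem addCoeff_weighted_sums (hq : q ≠ 0) (ht : t ≠ 0)
    (hqt : ∀ a b : ℕ, (a, b) ≠ (0, 0) → q ^ a * t ^ b ≠ 1) (h2 : (2 : K) ≠ 0)
    (L : ℕ) (Y : YoungDiagram) (hL : Y.card ≤ L) :
    ∑ i ∈ Finset.range (L + 1), addCoeff q t L Y i *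
        ((1 - v * (rowVar q t Y i)⁻¹) * (1 - u * rowVar q t Y i)) =
      (1 + u * v) - v - u * cornerPow q t L 1 Y ∧
    ∑ i ∈ Finset.range (L + 1), addCoeff q t L Y i *
        ((1 - v * (rowVar q t Y i)⁻¹) * (1 - u * rowVar q t Y i)) * rowVar q t Y i =
      (1 + u * v) * cornerPow q t L 1 Y - v -
        u * ((cornerPow q t L 1 Y ^ 2 + cornerPow q t L 2 Y) / 2) := by
  obtain ⟨s1, s2, s3, s4⟩ := addCoeff_sums hq ht hqt h2 L Y hL
  have hx := rowVar_ne_zero hq ht Y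
  constructor
  · have e : ∑ i ∈ Finset.range (L + 1), addCoeff q t L Y i *
        ((1 - v * (rowVar q t Y i)⁻¹) * (1 - u * rowVar q t Y i)) =
        (1 + u * v) * ∑ i ∈ Finset.range (L + 1), addCoeff q t L Y i -
        v * ∑ i ∈ Finset.range (L + 1), addCoeff q t L Y i * (rowVar q t Y i)⁻¹ -
        u * ∑ i ∈ Finset.range (L + 1), addCoeff q t L Y i * rowVar q t Y i := by
      simp only [Finset.mul_sum, ← Finset.sum_sub_distrib]
      refine Finset.sum_congr rfl fun i _ => ?_
      have := hx i
      field_simp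
      ring
    rw [e, s1, s2, s3, mul_one, mul_one]
  · have e : ∑ i ∈ Finset.range (L + 1), addCoeff q t L Y i *
        ((1 - v * (rowVar q t Y i)⁻¹) * (1 - u * rowVar q t Y i)) * rowVar q t Y i =
        (1 + u * v) * ∑ i ∈ Finset.range (L + 1), addCoeff q t L Y i * rowVar q t Y i -
        v * ∑ i ∈ Finset.range (L + 1), addCoeff q t L Y i -
        u * ∑ i ∈ Finset.range (L + 1), addCoeff q t L Y i * rowVar q t Y i ^ 2 := by
      simp only [Finset.mul_sum, ← Finset.sum_sub_distrib]
      refine Finset.sum_congr rfl fun i _ => ?_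
      have := hx i
      field_simp
      ring
    rw [e, s2, s3, s4, mul_one]

/-- The first power sum of the virtual alphabet of corners. -/
noncomputable def cornerOne (q t : K) (Y : YoungDiagram) : K :=
  1 - (1 - q) * (1 - t⁻¹) * contentPow q t 1 Y

/-- The second power sum of the virtual alphabet of corners. -/
noncomputable def cornerTwo (q t : K) (Y : YoungDiagram) : K :=
  1 - (1 - q ^ 2) * (1 - t⁻¹ ^ 2) * contentPow q t 2 Y

theorem contentPow_of_card_eq_zero (k : ℕ) (Y : YoungDiagram) (h : Y.card = 0) :
    contentPow q t k Y = 0 := by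
  rw [contentPow, Finset.card_eq_zero.1 h, Finset.sum_empty]

/-- The three test functions are 1, the first content sum p₁(Y') = p₁(Y) + x, and the content x of
the new box. They are chosen so that only moments of order -1 to 2 occur, which involve nothing
beyond p₁, p₁² and p₂. -/
theorem diagramBracket_recursions (hq : q ≠ 0) (ht : t ≠ 0)
    (hqt : ∀ a b : ℕ, (a, b) ≠ (0, 0) → q ^ a * t ^ b ≠ 1) (h2 : (2 : K) ≠ 0) :
    diagramBracket q t u v (fun Y => 1 - cornerOne q t Y) =
      PowerSeries.X * diagramBracket q t u v
        (fun Y => (1 + u * v) - v - u * cornerOne q t Y) ∧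
    diagramBracket q t u v (fun Y => (1 - cornerOne q t Y) * contentPow q t 1 Y) =
      PowerSeries.X * diagramBracket q t u v (fun Y =>
        ((1 + u * v) - v - u * cornerOne q t Y) * contentPow q t 1 Y +
        ((1 + u * v) * cornerOne q t Y - v -
          u * ((cornerOne q t Y ^ 2 + cornerTwo q t Y) / 2))) ∧
    diagramBracket q t u v
        (fun Y => t * (cornerOne q t Y ^ 2 - cornerTwo q t Y) / 2 * q⁻¹) =
      PowerSeries.X * diagramBracket q t u v (fun Y =>
        ((1 + u * v) * cornerOne q t Y - v -
          u * ((cornerOne q t Y ^ 2 + cornerTwo q t Y) / 2))) := by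
  have hc1 : ∀ L (Y : YoungDiagram), Y.card ≤ L → cornerPow q t L 1 Y = cornerOne q t Y :=
    fun L Y hL => by rw [cornerPow_eq L 1 Y hL, cornerOne, pow_one, pow_one]
  have hc2 : ∀ L (Y : YoungDiagram), Y.card ≤ L → cornerPow q t L 2 Y = cornerTwo q t Y :=
    fun L Y hL => by rw [cornerPow_eq L 2 Y hL, cornerTwo]
  have hrem : ∀ n, ∀ Y ∈ diagrams (n + 1),
      ∑ i ∈ Finset.range (n + 1), removeCoeff q t (n + 1) Y i = 1 - cornerOne q t Y ∧
      ∑ i ∈ Finset.range (n + 1), removeCoeff q t (n + 1) Y i * rowVar q t Y i =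
        t * (cornerOne q t Y ^ 2 - cornerTwo q t Y) / 2 := fun n Y hY => by
    have hL := (mem_diagrams.1 hY).le
    rw [← hc1 _ _ hL, ← hc2 _ _ hL]
    exact removeCoeff_sums hq ht hqt h2 _ Y hL
  have hadd : ∀ n, ∀ Y ∈ diagrams n,
      ∑ i ∈ Finset.range (n + 1 + 1), addCoeff q t (n + 1) Y i *
        ((1 - v * (rowVar q t Y i)⁻¹) * (1 - u * rowVar q t Y i)) =
      (1 + u * v) - v - u * cornerOne q t Y ∧
    ∑ i ∈ Finset.range (n + 1 + 1), addCoeff q t (n + 1) Y i *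
        ((1 - v * (rowVar q t Y i)⁻¹) * (1 - u * rowVar q t Y i)) * rowVar q t Y i =
      (1 + u * v) * cornerOne q t Y - v -
        u * ((cornerOne q t Y ^ 2 + cornerTwo q t Y) / 2) := fun n Y hY => by
    have hL : Y.card ≤ n + 1 := (mem_diagrams.1 hY).le.trans (Nat.le_succ n)
    rw [← hc1 _ _ hL, ← hc2 _ _ hL]
    exact addCoeff_weighted_sums hq ht hqt h2 _ Y hL
  refine ⟨?_, ?_, ?_⟩
  · refine diagramBracket_eq_X_mul (fun Y hY => ?_) fun n => ?_
    · rw [cornerOne, contentPow_of_card_eq_zero _ _ hY]; ring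
    · have h := sum_diagrams_succ (u := u) (v := v) hq ht hqt n (fun _ _ => 1) (fun _ _ => 1)
        (fun _ _ _ _ => rfl)
      simp only [mul_one] at h
      rw [Finset.sum_congr rfl fun Y hY => by rw [← (hrem n Y hY).1], h]
      exact Finset.sum_congr rfl fun Y hY => by rw [(hadd n Y hY).1]
  · refine diagramBracket_eq_X_mul (fun Y hY => ?_) fun n => ?_
    · rw [contentPow_of_card_eq_zero _ _ hY, mul_zero]
    · have h := sum_diagrams_succ (u := u) (v := v) hq ht hqt n
        (fun Y _ => contentPow q t 1 Y) (fun Y i => contentPow q t 1 Y + rowVar q t Y i)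
        (fun Y r Y' hY => by rw [hY.contentPow_eq, pow_one])
      simp only [mul_add, Finset.sum_add_distrib, ← Finset.sum_mul] at h
      rw [Finset.sum_congr rfl fun Y hY => by rw [← (hrem n Y hY).1], h,
        ← Finset.sum_add_distrib]
      exact Finset.sum_congr rfl fun Y hY => by rw [(hadd n Y hY).1, (hadd n Y hY).2, mul_add]
  · refine diagramBracket_eq_X_mul (fun Y hY => ?_) fun n => ?_
    · rw [cornerOne, cornerTwo, contentPow_of_card_eq_zero _ _ hY,
        contentPow_of_card_eq_zero _ _ hY]
      ring
    · have h := sum_diagrams_succ (u := u) (v := v) hq ht hqt n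
        (fun Y i => rowVar q t Y i * q⁻¹) (fun Y i => rowVar q t Y i)
        (fun Y r Y' hY => by
          rw [rowVar, rowVar, hY.rowLen_self, pow_succ]
          field_simp)
      simp only [← mul_assoc, ← Finset.sum_mul] at h
      simp only [← mul_assoc] at hadd
      rw [Finset.sum_congr rfl fun Y hY => by rw [← (hrem n Y hY).2, ← mul_assoc],
        ← Finset.sum_mul, h]
      exact Finset.sum_congr rfl fun Y hY => by rw [(hadd n Y hY).2]

/-- The brackets of the power sums of contents in terms of `⟨1⟩`, in denominator-free form. -/
theorem diagramBracket_linear (hq : q ≠ 0) (ht : t ≠ 0)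
    (hqt : ∀ a b : ℕ, (a, b) ≠ (0, 0) → q ^ a * t ^ b ≠ 1) (h2 : (2 : K) ≠ 0)
    (B0 B1 B11 B2 : PowerSeries K) (h0 : B0 = diagramBracket q t u v fun _ => 1)
    (h1 : B1 = diagramBracket q t u v (contentPow q t 1))
    (h11 : B11 = diagramBracket q t u v fun Y => contentPow q t 1 Y ^ 2)
    (h22 : B2 = diagramBracket q t u v (contentPow q t 2)) :
    let C : K → PowerSeries K := fun c => PowerSeries.C c
    let Q : PowerSeries K := PowerSeries.X
    let M := C ((1 - q) * (1 - t⁻¹))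
    let M2 := C ((1 - q ^ 2) * (1 - t⁻¹ ^ 2))
    M * B1 = Q * (C ((1 - u) * (1 - v)) * B0 + C u * M * B1) ∧
    2 * M * B11 = Q * (2 * C ((1 - u) * (1 - v)) * B1 + 2 * C u * M * B11 +
      (2 * C (1 + u * v) * (B0 - M * B1) - 2 * C v * B0 -
        C u * (2 * B0 - 2 * M * B1 + M ^ 2 * B11 - M2 * B2))) ∧
    C t * (-2 * M * B1 + M ^ 2 * B11 + M2 * B2) =
      C q * Q * (2 * C (1 + u * v) * (B0 - M * B1) - 2 * C v * B0 -
        C u * (2 * B0 - 2 * M * B1 + M ^ 2 * B11 - M2 * B2)) := by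
  intro C Q M M2
  obtain ⟨r1, r2, r3⟩ := diagramBracket_recursions (u := u) (v := v) hq ht hqt h2
  have lin : ∀ (a b c d : K) (f : YoungDiagram → K),
      (∀ Y, f Y = a * 1 + (b * contentPow q t 1 Y + (c * contentPow q t 1 Y ^ 2 +
        d * contentPow q t 2 Y))) →
      diagramBracket q t u v f = C a * B0 + (C b * B1 + (C c * B11 + C d * B2)) := by
    intro a b c d f hf
    rw [funext hf, diagramBracket_add, diagramBracket_add, diagramBracket_add,
      diagramBracket_smul, diagramBracket_smul, diagramBracket_smul, diagramBracket_smul,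
      h0, h1, h11, h22]
  set m := (1 - q) * (1 - t⁻¹) with hm
  set m2 := (1 - q ^ 2) * (1 - t⁻¹ ^ 2) with hm2
  have e1 : ∀ Y, cornerOne q t Y = 1 - m * contentPow q t 1 Y := fun Y => rfl
  have e2 : ∀ Y, cornerTwo q t Y = 1 - m2 * contentPow q t 2 Y := fun Y => rfl
  have hC : ∀ c, C c = PowerSeries.C c := fun _ => rfl
  have scale : ∀ (c : K) (f g : YoungDiagram → K),
      diagramBracket q t u v f = PowerSeries.X * diagramBracket q t u v g →
      diagramBracket q t u v (fun Y => c * f Y) =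
        PowerSeries.X * diagramBracket q t u v (fun Y => c * g Y) := by
    intro c f g h
    rw [diagramBracket_smul, diagramBracket_smul, h]
    ring
  -- The factors 2 and 2q clear the halves and the q⁻¹ of the recursions.
  have r2' := scale 2 _ _ r2
  have r3' := scale (2 * q) _ _ r3
  rw [lin 0 m 0 0 _ (fun Y => by rw [e1]; ring),
    lin ((1 - u) * (1 - v)) (u * m) 0 0 _ (fun Y => by rw [e1]; ring)] at r1
  rw [lin 0 0 (2 * m) 0 _ (fun Y => by rw [e1]; ring),
    lin (2 * (1 + u * v) - 2 * v - 2 * u) (2 * ((1 - u) * (1 - v)) - 2 * (1 + u * v) * m + 2 * u * m)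
      (2 * u * m - u * m ^ 2) (u * m2) _ (fun Y => by rw [e1, e2]; field_simp; ring)] at r2'
  rw [lin 0 (-2 * t * m) (t * m ^ 2) (t * m2) _
      (fun Y => by rw [e1, e2]; field_simp; ring),
    lin (q * (2 * (1 + u * v) - 2 * v - 2 * u)) (q * (- 2 * (1 + u * v) * m + 2 * u * m))
      (q * (- u * m ^ 2)) (q * (u * m2)) _ (fun Y => by rw [e1, e2]; field_simp; ring)] at r3'
  have hM : M = PowerSeries.C m := rfl
  have hM2 : M2 = PowerSeries.C m2 := rfl
  clear_value M M2 m m2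
  simp only [hC, hM, hM2, map_add, map_sub, map_mul, map_neg, map_pow, map_one, map_zero,
    map_ofNat] at r1 r2' r3' ⊢
  refine ⟨?_, ?_, ?_⟩
  · linear_combination r1
  · linear_combination r2'
  · linear_combination r3'

end BracketValues

/-! ### Solving the linear system -/

section Solve

/-- Here p stands for t⁻¹, and n1, n11, n2 for the normalized brackets of p₁, p₁², p₂. The first
equation gives n1; the third eliminates n2 from r, after which the second determines n11; finally n2
follows. -/
theorem linear_system_solution {R : Type*} [CommRing R] [IsDomain R]
    {u v q p Q m m2 n1 n11 n2 k r : R} (hm : m = (1 - q) * (1 - p)) (hm0 : m ≠ 0)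
    (h2 : (2 : R) ≠ 0)
    (hk : k = (1 - u) * (1 - v))
    (hr : r = 2 * (1 + u * v) * (1 - m * n1) - 2 * v -
      u * (2 - 2 * m * n1 + m ^ 2 * n11 - m2 * n2))
    (e1 : m * n1 = Q * (k + u * m * n1))
    (e2 : 2 * m * n11 = Q * (2 * k * n1 + 2 * u * m * n11 + r))
    (e3 : -2 * m * n1 + m ^ 2 * n11 + m2 * n2 = q * p * Q * r) :
    m ^ 2 * n11 * ((1 - u * Q) ^ 2 * (1 - u * q * Q) * (1 - u * p * Q)) =
        k ^ 2 * Q ^ 2 * ((1 - u * q * Q) * (1 - u * p * Q)) +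
          m * k * Q * (1 - Q) * (1 - u * v * Q) ∧
    m2 * n2 * ((1 - u * Q) ^ 2 * (1 - u * q * Q) * (1 - u * p * Q)) =
        ((1 - u * Q) ^ 2 - (1 - u * Q - k * Q) ^ 2) * ((1 - u * q * Q) * (1 - u * p * Q)) +
          (-1 + q + p + q * p - 2 * u * q * p * Q) * k * Q * (1 - Q) * (1 - u * v * Q) := by
  have f1 : m * n1 * (1 - u * Q) = k * Q := by linear_combination e1
  have f2 : r * (1 - u * (q * p) * Q) =
      2 * (1 + u * v) * (1 - m * n1) - 2 * v - 2 * u + 4 * u * m * n1 - 2 * u * m ^ 2 * n11 := by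
    linear_combination hr + u * e3
  have f3 : 2 * m * n11 * ((1 - u * q * Q) * (1 - u * p * Q)) =
      Q * (2 * k * n1 * (1 - u * (q * p) * Q) + 2 * (1 + u * v) * (1 - m * n1) - 2 * v - 2 * u +
        4 * u * m * n1) := by
    -- The right side is the coefficient of 2·m·n11 after the elimination. Its factorization is the
    -- source of the two extra poles of W.
    have : (1 - u * q * Q) * (1 - u * p * Q) =
        (1 - u * Q) * (1 - u * (q * p) * Q) + u * m * Q := by rw [hm]; ring
    rw [this]
    linear_combination (1 - u * (q * p) * Q) * e2 + Q * f2
  have g1 : m ^ 2 * n11 * ((1 - u * Q) ^ 2 * (1 - u * q * Q) * (1 - u * p * Q)) =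
        k ^ 2 * Q ^ 2 * ((1 - u * q * Q) * (1 - u * p * Q)) +
          m * k * Q * (1 - Q) * (1 - u * v * Q) := by
    apply mul_left_cancel₀ h2
    have h : 2 * (m ^ 2 * n11 * ((1 - u * Q) ^ 2 * (1 - u * q * Q) * (1 - u * p * Q))) =
        2 * k * Q * (k * Q) * (1 - u * Q) * (1 - u * (q * p) * Q) +
        m * Q * (1 - u * Q) * ((2 * (1 + u * v) - 2 * v - 2 * u) * (1 - u * Q) +
          k * Q * (4 * u - 2 * (1 + u * v))) := by
      linear_combination m * (1 - u * Q) ^ 2 * f3 +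
        (2 * k * Q * (1 - u * Q) * (1 - u * (q * p) * Q) +
        m * Q * (1 - u * Q) * (4 * u - 2 * (1 + u * v))) * f1
    rw [h, hk, hm]
    ring
  refine ⟨g1, ?_⟩
  -- The second equation expresses Q·r through n1 and n11, which removes r, and the n2 inside it,
  -- from the third.
  have h4 : m2 * n2 = 2 * m * n1 - m ^ 2 * n11 +
      q * p * (2 * m * n11 * (1 - u * Q) - 2 * k * Q * n1) := by
    linear_combination e3 - q * p * e2
  apply mul_left_cancel₀ hm0
  rw [h4]
  have h5 : m * ((2 * m * n1 - m ^ 2 * n11 +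
      q * p * (2 * m * n11 * (1 - u * Q) - 2 * k * Q * n1)) *
      ((1 - u * Q) ^ 2 * (1 - u * q * Q) * (1 - u * p * Q))) =
      (2 * m - 2 * q * p * k * Q) * (k * Q) * (1 - u * Q) * ((1 - u * q * Q) * (1 - u * p * Q)) +
      (2 * q * p * (1 - u * Q) - m) * (k ^ 2 * Q ^ 2 * ((1 - u * q * Q) * (1 - u * p * Q)) +
          m * k * Q * (1 - Q) * (1 - u * v * Q)) := by
    linear_combination (2 * m - 2 * q * p * k * Q) * (1 - u * Q) *
      ((1 - u * q * Q) * (1 - u * p * Q)) * f1 + (2 * q * p * (1 - u * Q) - m) * g1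
  rw [h5, hk, hm]
  ring

end Solve

/-! ### Normalized brackets of the content sums -/

section Normalized

variable {K : Type*} [Field K] {q t u v : K}

/-- The normalized bracket of a function on Young diagrams. -/
noncomputable def normDiagramBracket (q t u v : K) (f : YoungDiagram → K) : PowerSeries K :=
  diagramBracket q t u v f * (diagramBracket q t u v fun _ => 1)⁻¹

theorem constantCoeff_diagramBracket_one :
    PowerSeries.constantCoeff (diagramBracket q t u v fun _ => 1) = 1 := by
  rw [← PowerSeries.coeff_zero_eq_constantCoeff_apply, diagramBracket, PowerSeries.coeff_mk,
    ← sum_partition_eq, Fintype.sum_unique]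
  have : (young (default : (0 : ℕ).Partition)).cells = ∅ := Finset.card_eq_zero.1 (card_young _)
  rw [diagramWeight, hookProd, this]
  simp

open PowerSeries in
theorem normDiagramBracket_values [CharZero K] (hq : q ≠ 0) (ht : t ≠ 0)
    (hqt : ∀ a b : ℕ, (a, b) ≠ (0, 0) → q ^ a * t ^ b ≠ 1) :
    normDiagramBracket q t u v (fun _ => 1) = 1 ∧
    normDiagramBracket q t u v (contentPow q t 1) =
      X * C ((1 - u) * (1 - v) / ((1 - q) * (1 - t⁻¹))) * (1 - C u * X)⁻¹ ∧
    normDiagramBracket q t u v (fun Y => contentPow q t 1 Y ^ 2) =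
      (X * C ((1 - u) * (1 - v) / ((1 - q) * (1 - t⁻¹))) * (1 - C u * X)⁻¹) ^ 2 +
      C ((1 - u) * (1 - v) / ((1 - q) * (1 - t⁻¹))) * X * (1 - X) * (1 - C (u * v) * X) *
        ((1 - C u * X) ^ 2 * (1 - C (u * q) * X) * (1 - C (u * t⁻¹) * X))⁻¹ ∧
    normDiagramBracket q t u v (contentPow q t 2) =
      C (1 / ((1 - q ^ 2) * (1 - t⁻¹ ^ 2))) -
      C (1 / ((1 - q ^ 2) * (1 - t⁻¹ ^ 2))) *
        (1 - X * C ((1 - u) * (1 - v)) * (1 - C u * X)⁻¹) ^ 2 +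
      C (1 / ((1 - q ^ 2) * (1 - t⁻¹ ^ 2))) *
        (C (-1 + q + t⁻¹ + q * t⁻¹) - C (2 * u * q * t⁻¹) * X) *
        (X * (1 - X) * C ((1 - u) * (1 - v)) * (1 - C (u * v) * X)) *
        ((1 - C u * X) ^ 2 * (1 - C (u * q) * X) * (1 - C (u * t⁻¹) * X))⁻¹ := by
  obtain ⟨r1, r2, r3⟩ := diagramBracket_linear (u := u) (v := v) hq ht hqt two_ne_zero
    _ _ _ _ rfl rfl rfl rfl
  dsimp only at r1 r2 r3
  have hinv := PowerSeries.mul_inv_cancel (diagramBracket q t u v fun _ => 1)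
    (by rw [constantCoeff_diagramBracket_one]; exact one_ne_zero)
  simp only [normDiagramBracket]
  set B0 := diagramBracket q t u v fun _ => 1
  set J := B0⁻¹
  set B1 := diagramBracket q t u v (contentPow q t 1)
  set B11 := diagramBracket q t u v fun Y => contentPow q t 1 Y ^ 2
  set B2 := diagramBracket q t u v (contentPow q t 2)
  refine ⟨hinv, ?_⟩
  have h2 : (2 : PowerSeries K) ≠ 0 := fun h =>
    two_ne_zero (α := K) (by simpa only [map_ofNat, map_zero] using congrArg constantCoeff h)
  have hmK : (1 - q) * (1 - t⁻¹) ≠ 0 := by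
    refine mul_ne_zero (sub_ne_zero.2 fun h => hqt 1 0 (by simp) (by simp [← h]))
      (sub_ne_zero.2 fun h => hqt 0 1 (by simp) ?_)
    rw [eq_comm, inv_eq_one] at h
    simp [h]
  have hm2K : (1 - q ^ 2) * (1 - t⁻¹ ^ 2) ≠ 0 := by
    refine mul_ne_zero (sub_ne_zero.2 fun h => hqt 2 0 (by simp) (by simp [← h]))
      (sub_ne_zero.2 fun h => hqt 0 2 (by simp) ?_)
    rw [inv_pow, eq_comm, inv_eq_one] at h
    simp [h]
  have ha : C ((1 - q) * (1 - t⁻¹)) * C ((1 - q) * (1 - t⁻¹))⁻¹ = 1 := by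
    rw [← map_mul, mul_inv_cancel₀ hmK, map_one]
  have ha2 : C ((1 - q ^ 2) * (1 - t⁻¹ ^ 2)) * C ((1 - q ^ 2) * (1 - t⁻¹ ^ 2))⁻¹ = 1 := by
    rw [← map_mul, mul_inv_cancel₀ hm2K, map_one]
  have htt : C t * C t⁻¹ = 1 := by rw [← map_mul, mul_inv_cancel₀ ht, map_one]
  have hm : C ((1 - q) * (1 - t⁻¹)) = (1 - C q) * (1 - C t⁻¹) := by simp
  have hk : C ((1 - u) * (1 - v)) = (1 - C u) * (1 - C v) := by simp
  have hD1 : (1 - C u * X) * (1 - C u * X)⁻¹ = 1 := PowerSeries.mul_inv_cancel _ (by simp)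
  have hD : ((1 - C u * X) ^ 2 * (1 - C (u * q) * X) * (1 - C (u * t⁻¹) * X)) *
      ((1 - C u * X) ^ 2 * (1 - C (u * q) * X) * (1 - C (u * t⁻¹) * X))⁻¹ = 1 :=
    PowerSeries.mul_inv_cancel _ (by simp)
  have hne : ((1 - C u * X) ^ 2 * (1 - C (u * q) * X) * (1 - C (u * t⁻¹) * X)) ≠ 0 :=
    left_ne_zero_of_mul_eq_one hD
  have hM0 := left_ne_zero_of_mul_eq_one ha
  have hM20 := left_ne_zero_of_mul_eq_one ha2
  have e1 : C ((1 - q) * (1 - t⁻¹)) * (B1 * J) =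
      X * (C ((1 - u) * (1 - v)) + C u * C ((1 - q) * (1 - t⁻¹)) * (B1 * J)) := by
    linear_combination J * r1 + X * C ((1 - u) * (1 - v)) * hinv
  obtain ⟨s11, s2⟩ := linear_system_solution (u := C u) (v := C v) (q := C q) (p := C t⁻¹)
    (Q := X) (m := C ((1 - q) * (1 - t⁻¹))) (m2 := C ((1 - q ^ 2) * (1 - t⁻¹ ^ 2)))
    (n1 := B1 * J) (n11 := B11 * J) (n2 := B2 * J) (k := C ((1 - u) * (1 - v)))
    hm hM0 h2 hk rfl e1
    (by
      have : C (1 + u * v) = 1 + C u * C v := by simp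
      rw [this] at r2
      linear_combination J * r2 + X * (2 * (1 + C u * C v) - 2 * C v - 2 * C u) * hinv)
    (by
      have : C (1 + u * v) = 1 + C u * C v := by simp
      rw [this] at r3
      linear_combination J * C t⁻¹ * r3 +
        C q * C t⁻¹ * X * (2 * (1 + C u * C v) - 2 * C v - 2 * C u) * hinv -
        J * (-2 * C ((1 - q) * (1 - t⁻¹)) * B1 + C ((1 - q) * (1 - t⁻¹)) ^ 2 * B11 +
          C ((1 - q ^ 2) * (1 - t⁻¹ ^ 2)) * B2) * htt)
  rw [one_div, div_eq_mul_inv, map_mul C ((1 - u) * (1 - v))]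
  have c1 : C (u * q) = C u * C q := map_mul _ _ _
  have c2 : C (u * t⁻¹) = C u * C t⁻¹ := map_mul _ _ _
  have c3 : C (u * v) = C u * C v := map_mul _ _ _
  have c4 : C (-1 + q + t⁻¹ + q * t⁻¹) = -1 + C q + C t⁻¹ + C q * C t⁻¹ := by simp
  have c5 : C (2 * u * q * t⁻¹) = 2 * C u * C q * C t⁻¹ := by simp only [map_mul, map_ofNat]
  rw [c1, c2] at hD hne ⊢
  rw [c3, c4, c5]
  -- From here on the constants and inverses are indeterminates subject only to their defining
  -- relations, so the goals are polynomial identities.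
  clear r1 r2 r3 hm hk c1 c2 c3 c4 c5 htt
  generalize C ((1 - u) * (1 - v)) = k at *
  generalize C ((1 - q) * (1 - t⁻¹)) = m at *
  generalize C ((1 - q) * (1 - t⁻¹))⁻¹ = a at *
  generalize C ((1 - q ^ 2) * (1 - t⁻¹ ^ 2)) = m2 at *
  generalize C ((1 - q ^ 2) * (1 - t⁻¹ ^ 2))⁻¹ = a2 at *
  generalize (1 - C u * X)⁻¹ = I at *
  generalize ((1 - C u * X) ^ 2 * (1 - C u * C q * X) * (1 - C u * C t⁻¹ * X))⁻¹ = D at *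
  generalize B1 * J = n1 at *
  generalize B11 * J = n11 at *
  generalize B2 * J = n2 at *
  refine ⟨?_, ?_, ?_⟩
  · apply mul_left_cancel₀ hM0
    have f1 : m * n1 * (1 - C u * X) = k * X := by linear_combination e1
    linear_combination I * f1 - m * n1 * hD1 - X * k * I * ha
  · apply mul_left_cancel₀ (mul_ne_zero (pow_ne_zero 2 hM0) hne)
    have h1 : m ^ 2 * ((1 - C u * X) ^ 2 * (1 - C u * C q * X) * (1 - C u * C t⁻¹ * X)) *
        ((X * (k * a) * I) ^ 2 + k * a * X * (1 - X) * (1 - C u * C v * X) * D) =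
        (m * a) ^ 2 * ((1 - C u * X) * I) ^ 2 * (X ^ 2 * k ^ 2) *
          ((1 - C u * C q * X) * (1 - C u * C t⁻¹ * X)) +
        (m * a) * (((1 - C u * X) ^ 2 * (1 - C u * C q * X) * (1 - C u * C t⁻¹ * X)) * D) *
          (m * k * X * (1 - X) * (1 - C u * C v * X)) := by ring
    rw [h1, ha, hD1, hD]
    linear_combination s11
  · apply mul_left_cancel₀ (mul_ne_zero hM20 hne)
    have h1 : m2 * ((1 - C u * X) ^ 2 * (1 - C u * C q * X) * (1 - C u * C t⁻¹ * X)) *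
        (a2 - a2 * (1 - X * k * I) ^ 2 +
          a2 * (-1 + C q + C t⁻¹ + C q * C t⁻¹ - 2 * C u * C q * C t⁻¹ * X) *
          (X * (1 - X) * k * (1 - C u * C v * X)) * D) =
        (m2 * a2) * (((1 - C u * X) ^ 2 - ((1 - C u * X) - k * X * ((1 - C u * X) * I)) ^ 2) *
          ((1 - C u * C q * X) * (1 - C u * C t⁻¹ * X)) +
        (((1 - C u * X) ^ 2 * (1 - C u * C q * X) * (1 - C u * C t⁻¹ * X)) * D) *
          ((-1 + C q + C t⁻¹ + C q * C t⁻¹ - 2 * C u * C q * C t⁻¹ * X) * k * X * (1 - X) *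
            (1 - C u * C v * X))) := by ring
    rw [h1, ha2, hD1, hD]
    linear_combination s2

end Normalized

/-! ### The modified Macdonald operator in terms of power sums -/

section Operator

variable {K : Type*} [Field K]

/-- The symmetric functions `g_m` with `∑ g_m w ^ m = exp (∑ (1 - t ^ {-k}) p_k w ^ k / k)`. -/
noncomputable def gSymm (t : K) : ℕ → Sym K
  | 0 => 1
  | n + 1 => MvPolynomial.C ((n : K) + 1)⁻¹ * ∑ m : Fin (n + 1),
      MvPolynomial.C (1 - t⁻¹ ^ ((m : ℕ) + 1)) * MvPolynomial.X (Nat.succPNat m) * gSymm t (n - m)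

theorem gSymm_succ [CharZero K] (t : K) (n : ℕ) :
    ((n : K) + 1) • gSymm t (n + 1) = ∑ m ∈ Finset.range (n + 1),
      (1 - t⁻¹ ^ (m + 1)) • (MvPolynomial.X (Nat.succPNat m) * gSymm t (n - m)) := by
  have hn : (n : K) + 1 ≠ 0 := Nat.cast_add_one_ne_zero n
  rw [gSymm, MvPolynomial.C_mul', smul_smul, mul_inv_cancel₀ hn, one_smul,
    Finset.sum_range fun m => (1 - t⁻¹ ^ (m + 1)) •
      ((MvPolynomial.X (Nat.succPNat m) : Sym K) * gSymm t (n - m))]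
  refine Finset.sum_congr rfl fun m _ => ?_
  rw [mul_assoc, MvPolynomial.C_mul']

/-- The substitution `p_k ↦ p_k + (q ^ k - 1) z ^ k`. -/
noncomputable def shift (q : K) : Sym K →ₐ[K] Polynomial (Sym K) :=
  MvPolynomial.aeval fun k : ℕ+ => Polynomial.C (MvPolynomial.X k) +
    Polynomial.C (MvPolynomial.C (q ^ (k : ℕ) - 1)) * Polynomial.X ^ (k : ℕ)

/-- The modified Macdonald operator on symmetric functions, in terms of power sums. -/
noncomputable def macOp (q t : K) : Module.End K (Sym K) :=
  (t - 1)⁻¹ • (Polynomial.lsum fun m => LinearMap.mulRight K (gSymm t m)) ∘ₗ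
    (shift q).toLinearMap

theorem macOp_apply (q t : K) (f : Sym K) :
    macOp q t f = (t - 1)⁻¹ • (shift q f).sum fun m c => c * gSymm t m := rfl

variable {q t : K} {n : ℕ}

/-- The field of rational functions in `n` variables. -/
abbrev RatFun (K : Type*) [Field K] (n : ℕ) : Type _ := FractionRing (MvPolynomial (Fin n) K)

/-- The variables in the field of rational functions. -/
noncomputable def fracVar (K : Type*) [Field K] (n : ℕ) (i : Fin n) :
    RatFun K n :=
  algebraMap (MvPolynomial (Fin n) K) _ (MvPolynomial.X i)

theorem fracVar_injective : Function.Injective (fracVar K n) :=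
  (IsFractionRing.injective (MvPolynomial (Fin n) K) (RatFun K n)).comp MvPolynomial.X_injective

theorem fracVar_ne_zero (i : Fin n) : fracVar K n i ≠ 0 := fun h =>
  MvPolynomial.X_ne_zero i
    (IsFractionRing.injective (MvPolynomial (Fin n) K) (RatFun K n) (by rw [map_zero]; exact h))

/-- Restriction to `n` variables, with values in rational functions. -/
noncomputable def restrictFrac (K : Type*) [Field K] (n : ℕ) :
    Sym K →ₐ[K] RatFun K n :=
  (IsScalarTower.toAlgHom K (MvPolynomial (Fin n) K)
    (RatFun K n)).comp (restrict n)

theorem restrictFrac_X (k : ℕ+) :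
    restrictFrac K n (MvPolynomial.X k) = ∑ i, fracVar K n i ^ (k : ℕ) := by
  simp [restrictFrac, restrict, MvPolynomial.psum, fracVar]

theorem aeval_update_psum (i : Fin n) (k : ℕ) :
    MvPolynomial.aeval (Function.update MvPolynomial.X i (MvPolynomial.C q * MvPolynomial.X i))
      (MvPolynomial.psum (Fin n) K k) =
    MvPolynomial.psum (Fin n) K k + MvPolynomial.C (q ^ k - 1) * MvPolynomial.X i ^ k := by
  simp only [MvPolynomial.psum, map_sum, map_pow, MvPolynomial.aeval_X]
  rw [← Finset.add_sum_erase _ _ (Finset.mem_univ i), ← Finset.add_sum_erase Finset.univ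
      (fun x => (MvPolynomial.X x : MvPolynomial (Fin n) K) ^ k) (Finset.mem_univ i),
    Function.update_self,
    Finset.sum_congr rfl fun j hj => by rw [Function.update_of_ne (Finset.ne_of_mem_erase hj)]]
  simp only [map_sub, map_pow, map_one]
  ring

/-- Replacing x_i by q x_i changes p_k by (q^k - 1) x_i^k, which is `shift` evaluated at z = x_i.
Two algebra maps are compared on the generators. -/
theorem restrict_subst (f : Sym K) (i : Fin n) :
    algebraMap (MvPolynomial (Fin n) K) (RatFun K n) (MvPolynomial.aeval
        (Function.update MvPolynomial.X i (MvPolynomial.C q * MvPolynomial.X i)) (restrict n f)) =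
      (shift q f).sum fun m c => restrictFrac K n c * fracVar K n i ^ m := by
  have hev : ∀ P : Polynomial (Sym K), Polynomial.eval₂AlgHom (restrictFrac K n) (fracVar K n i)
      (fun _ => Commute.all _ _) P = P.eval₂ (restrictFrac K n).toRingHom (fracVar K n i) :=
    fun _ => rfl
  have h : (((IsScalarTower.toAlgHom K (MvPolynomial (Fin n) K) (RatFun K n)).comp (MvPolynomial.aeval
        (Function.update MvPolynomial.X i (MvPolynomial.C q * MvPolynomial.X i)))).comp
          (restrict n) : Sym K →ₐ[K] (RatFun K n)) =
      ((Polynomial.eval₂AlgHom (restrictFrac K n) (fracVar K n i)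
        (fun _ => Commute.all _ _)).comp (shift q)) := by
    ext k
    have h1 : ∀ c, restrictFrac K n (MvPolynomial.C c) =
      algebraMap (MvPolynomial (Fin n) K) (RatFun K n) (MvPolynomial.C c) := fun c => by
        simp [restrictFrac, restrict, IsScalarTower.algebraMap_apply K (MvPolynomial (Fin n) K) (RatFun K n)]
    have h2 : restrictFrac K n (MvPolynomial.X k) =
      algebraMap (MvPolynomial (Fin n) K) (RatFun K n) (MvPolynomial.psum (Fin n) K k) := by
        simp [restrictFrac, restrict]
    simp only [AlgHom.comp_apply, restrict, MvPolynomial.aeval_X, aeval_update_psum, shift,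
      IsScalarTower.coe_toAlgHom', map_add, map_mul, map_pow, hev, Polynomial.eval₂_add,
      Polynomial.eval₂_mul, Polynomial.eval₂_pow, Polynomial.eval₂_C,
      Polynomial.eval₂_X, AlgHom.toRingHom_eq_coe, RingHom.coe_coe, h1, h2]
    rfl
  have h3 := congrArg (fun φ => φ f) h
  dsimp only [AlgHom.comp_apply] at h3
  rw [hev, Polynomial.eval₂_eq_sum] at h3
  exact h3

theorem coeff_zero_shift (f : Sym K) : ((shift q f).sum fun m c => c * 0 ^ m) = f := by
  have h : (Polynomial.evalRingHom 0).comp (shift q).toRingHom = RingHom.id (Sym K) := by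
    ext k
    · simp [shift]
    · simp [shift]
  have h1 := congrArg (fun φ => φ f) h
  simpa [Polynomial.eval_eq_sum] using h1

/-- Both sides satisfy Newton's recursion with power sums (1 - t^{-k}) p_k and start at 1. -/
theorem coeff_ratioSeries_fracVar [CharZero K] [DecidableEq (RatFun K n)] (m : ℕ) :
    PowerSeries.coeff m (ratioSeries (Finset.univ.image (fracVar K n))
      ((Finset.univ : Finset (Fin n)).val.map fun j => algebraMap K (RatFun K n) t⁻¹ * fracVar K n j)) =
      restrictFrac K n (gSymm t m) := by
  induction m using Nat.strong_induction_on with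
  | _ m ih =>
  rcases m with _ | m
  · rw [coeff_zero_ratioSeries, gSymm, map_one]
  · have hm : algebraMap K (RatFun K n) ((m : K) + 1) ≠ 0 := by
      rw [map_ne_zero]
      exact Nat.cast_add_one_ne_zero m
    apply mul_left_cancel₀ hm
    rw [map_add, map_one, map_natCast, ratioSeries_newton]
    have h := congrArg (restrictFrac K n) (gSymm_succ t m)
    rw [map_smul, Algebra.smul_def, map_add, map_one, map_natCast] at h
    rw [h, map_sum]
    refine Finset.sum_congr rfl fun k hk => ?_
    rw [ih (m - k) (by omega), map_smul, map_mul, restrictFrac_X, Algebra.smul_def, ← mul_assoc]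
    congr 1
    rw [Finset.sum_image fracVar_injective.injOn, Multiset.map_map]
    have : (Multiset.map ((fun x => x ^ (k + 1)) ∘ fun j => algebraMap K (RatFun K n) t⁻¹ * fracVar K n j)
      (Finset.univ : Finset (Fin n)).val).sum =
        ∑ j, (algebraMap K (RatFun K n) t⁻¹ * fracVar K n j) ^ (k + 1) := rfl
    rw [this]
    simp only [mul_pow, ← Finset.mul_sum, map_sub, map_one, map_pow, Nat.succPNat_coe,
      Nat.succ_eq_add_one]
    ring

/-- Partial fractions with nodes x_1, …, x_n and 0. The node 0 contributes only for m = 0, and after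
division by t - 1 its contribution is exactly the summand t^{-n-1}/(1 - t⁻¹) of Ẽ¹_n. This
correction is what makes the result the restriction of one symmetric function for every n. -/
theorem sum_macdonald_coeff [CharZero K] (ht : t ≠ 0) (m : ℕ) :
    algebraMap K (RatFun K n) ((t - 1) * t⁻¹ ^ n) * ∑ i, (∏ j ∈ Finset.univ.erase i,
        (algebraMap K (RatFun K n) t * fracVar K n i - fracVar K n j) / (fracVar K n i - fracVar K n j)) *
          fracVar K n i ^ m + 0 ^ m * algebraMap K (RatFun K n) (t⁻¹ ^ n) =
      restrictFrac K n (gSymm t m) := by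
  classical
  have h := sum_partialFractions_image (s := Finset.univ) (fracVar_injective (K := K) (n := n))
    fracVar_ne_zero Finset.univ (fun j => algebraMap K (RatFun K n) t⁻¹ * fracVar K n j) m
  rw [PowerSeries.coeff_X_pow_mul, coeff_ratioSeries_fracVar] at h
  rw [← h, Finset.mul_sum]
  have htF : algebraMap K (RatFun K n) t ≠ 0 := by rwa [map_ne_zero]
  congr 1
  · refine Finset.sum_congr rfl fun i _ => ?_
    have e1 : ∏ j, (fracVar K n i - algebraMap K (RatFun K n) t⁻¹ * fracVar K n j) =
        algebraMap K (RatFun K n) (t⁻¹ ^ n) * ((algebraMap K (RatFun K n) (t - 1) * fracVar K n i) *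
        ∏ j ∈ Finset.univ.erase i, (algebraMap K (RatFun K n) t * fracVar K n i - fracVar K n j)) := by
      have e2 : (algebraMap K (RatFun K n) (t - 1) * fracVar K n i) =
          algebraMap K (RatFun K n) t * fracVar K n i - fracVar K n i := by
        rw [map_sub, map_one]; ring
      rw [e2, Finset.mul_prod_erase Finset.univ
        (fun j => algebraMap K (RatFun K n) t * fracVar K n i - fracVar K n j) (Finset.mem_univ i), map_pow]
      have e3 : algebraMap K (RatFun K n) t⁻¹ ^ n = ∏ _j : Fin n, algebraMap K (RatFun K n) t⁻¹ := by
        rw [Finset.prod_const, Finset.card_univ, Fintype.card_fin]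
      rw [e3, ← Finset.prod_mul_distrib]
      refine Finset.prod_congr rfl fun j _ => ?_
      rw [map_inv₀]
      field_simp
    have := fracVar_ne_zero (K := K) i
    rw [e1, Finset.prod_div_distrib, map_mul]
    field_simp
  · simp only [neg_mul_eq_mul_neg, Finset.prod_mul_distrib, Finset.prod_const, Finset.card_univ,
      Fintype.card_fin, map_pow]
    have : ∏ j, (-fracVar K n j) ≠ 0 :=
      Finset.prod_ne_zero_iff.2 fun i _ => neg_ne_zero.2 (fracVar_ne_zero i)
    rw [← mul_assoc, mul_div_cancel_right₀ _ this]

theorem macOp_isModified [CharZero K] (ht : t ≠ 0) (ht1 : t ≠ 1) :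
    IsModifiedMacdonaldOp q t (macOp q t) := by
  intro n f
  have hLHS : algebraMap (MvPolynomial (Fin n) K) (RatFun K n) (restrict n (macOp q t f)) =
      algebraMap K (RatFun K n) (t - 1)⁻¹ * (shift q f).sum fun m c =>
        restrictFrac K n c * restrictFrac K n (gSymm t m) := by
    change restrictFrac K n (macOp q t f) = _
    rw [macOp_apply, map_smul, Algebra.smul_def, Polynomial.sum_def, map_sum, Polynomial.sum_def]
    simp only [map_mul]
  have hD : macdonaldD q t n (restrict n f) = (shift q f).sum fun m c => restrictFrac K n c *
      ∑ i, (∏ j ∈ Finset.univ.erase i, (algebraMap K (RatFun K n) t * fracVar K n i - fracVar K n j) /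
        (fracVar K n i - fracVar K n j)) * fracVar K n i ^ m := by
    rw [macdonaldD, Polynomial.sum_def]
    simp only [restrict_subst, Polynomial.sum_def, Finset.mul_sum]
    rw [Finset.sum_comm]
    refine Finset.sum_congr rfl fun m _ => Finset.sum_congr rfl fun i _ => ?_
    rw [mul_left_comm]
    rfl
  have h0 : restrictFrac K n f = (shift q f).sum fun m c => restrictFrac K n c * 0 ^ m := by
    conv_lhs => rw [← coeff_zero_shift (q := q) f]
    rw [Polynomial.sum_def, map_sum, Polynomial.sum_def]
    refine Finset.sum_congr rfl fun m _ => ?_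
    rw [map_mul, map_pow, map_zero]
  change _ = _ + _ * restrictFrac K n f
  rw [hLHS, hD, h0]
  simp only [Polynomial.sum_def, Finset.mul_sum (s := (shift q f).support)]
  rw [← Finset.sum_add_distrib]
  refine Finset.sum_congr rfl fun m _ => ?_
  rw [← sum_macdonald_coeff ht m]
  have h1 : t - 1 ≠ 0 := sub_ne_zero.2 ht1
  have e1 : t⁻¹ ^ (n + 1) / (1 - t⁻¹) = (t - 1)⁻¹ * t⁻¹ ^ n := by
    rw [pow_succ]
    have : 1 - t⁻¹ = (t - 1) * t⁻¹ := by field_simp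
    rw [this]
    field_simp
  have e2 : algebraMap K (RatFun K n) (t - 1)⁻¹ * algebraMap K (RatFun K n) (t - 1) = 1 := by
    rw [← map_mul, inv_mul_cancel₀ h1, map_one]
  rw [e1, map_mul, map_mul]
  linear_combination (restrictFrac K n ((shift q f).coeff m) * algebraMap K (RatFun K n) (t⁻¹ ^ n) *
    ∑ i, (∏ j ∈ Finset.univ.erase i, (algebraMap K (RatFun K n) t * fracVar K n i - fracVar K n j) /
        (fracVar K n i - fracVar K n j)) * fracVar K n i ^ m) * e2

end Operator

/-! ### Self-adjointness for Macdonald's scalar product -/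

section ScalarProduct

variable {K : Type*} [Field K] {q t : K}

theorem scalarProd_eq_sum (A B : Sym K) (S : Finset (ℕ+ →₀ ℕ)) (hS : A.support ⊆ S) :
    scalarProd q t A B = ∑ f ∈ S, A.coeff f * B.coeff f * psumNorm q t f := by
  refine Finset.sum_subset hS fun f _ hf => ?_
  rw [MvPolynomial.notMem_support_iff.1 hf, zero_mul, zero_mul]

theorem scalarProd_comm (A B : Sym K) : scalarProd q t A B = scalarProd q t B A := by
  classical
  rw [scalarProd_eq_sum A B (A.support ∪ B.support) Finset.subset_union_left,
    scalarProd_eq_sum B A (A.support ∪ B.support) Finset.subset_union_right]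
  exact Finset.sum_congr rfl fun f _ => by ring

/-- Macdonald's scalar product as a bilinear map. -/
noncomputable def macForm (q t : K) : Sym K →ₗ[K] Sym K →ₗ[K] K :=
  LinearMap.mk₂ K (scalarProd q t)
    (fun A A' B => by
      classical
      rw [scalarProd_eq_sum A B (A.support ∪ A'.support) Finset.subset_union_left,
        scalarProd_eq_sum A' B (A.support ∪ A'.support) Finset.subset_union_right,
        scalarProd_eq_sum (A + A') B (A.support ∪ A'.support) MvPolynomial.support_add,
        ← Finset.sum_add_distrib]
      exact Finset.sum_congr rfl fun f _ => by rw [MvPolynomial.coeff_add]; ring)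
    (fun c A B => by
      rw [scalarProd_eq_sum (c • A) B A.support MvPolynomial.support_smul, scalarProd,
        smul_eq_mul, Finset.mul_sum]
      exact Finset.sum_congr rfl fun f _ => by rw [MvPolynomial.coeff_smul, smul_eq_mul]; ring)
    (fun A B B' => by
      rw [scalarProd, scalarProd, scalarProd, ← Finset.sum_add_distrib]
      exact Finset.sum_congr rfl fun f _ => by rw [MvPolynomial.coeff_add]; ring)
    (fun c A B => by
      rw [scalarProd, scalarProd, smul_eq_mul, Finset.mul_sum]
      exact Finset.sum_congr rfl fun f _ => by rw [MvPolynomial.coeff_smul, smul_eq_mul]; ring)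

theorem macForm_apply (A B : Sym K) : macForm q t A B = scalarProd q t A B := rfl

theorem macForm_comm (A B : Sym K) : macForm q t A B = macForm q t B A := scalarProd_comm A B

theorem macForm_monomial (f : ℕ+ →₀ ℕ) (a : K) (B : Sym K) :
    macForm q t (MvPolynomial.monomial f a) B = a * B.coeff f * psumNorm q t f := by
  rw [macForm_apply, scalarProd_eq_sum _ _ {f} MvPolynomial.support_monomial_subset]
  simp

theorem psumNorm_add_single (f : ℕ+ →₀ ℕ) (k : ℕ+) :
    psumNorm q t (f + Finsupp.single k 1) = psumNorm q t f *
      (((k : ℕ) : K) * ((1 - q ^ (k : ℕ)) / (1 - t ^ (k : ℕ))) * ((f k : K) + 1)) := by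
  classical
  set S := insert k f.support
  have hS : f.support ⊆ S := Finset.subset_insert _ _
  have hS' : (f + Finsupp.single k 1).support ⊆ S := by
    intro j hj
    have := Finsupp.support_add hj
    simp only [S, Finset.mem_union, Finset.mem_insert] at this ⊢
    rcases this with h | h
    · exact Or.inr h
    · exact Or.inl (by simpa using Finsupp.support_single_subset h)
  rw [psumNorm, psumNorm, Finsupp.prod_of_support_subset _ hS' _ (by simp),
    Finsupp.prod_of_support_subset _ hS _ (by simp),
    ← Finset.mul_prod_erase S _ (Finset.mem_insert_self k _),
    ← Finset.mul_prod_erase S _ (Finset.mem_insert_self k _)]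
  have : ∀ j ∈ S.erase k, (f + Finsupp.single k 1 : ℕ+ →₀ ℕ) j = f j := fun j hj => by
    rw [Finsupp.add_apply, Finsupp.single_eq_of_ne (Finset.ne_of_mem_erase hj), add_zero]
  rw [Finset.prod_congr rfl fun j hj => by rw [this j hj]]
  simp only [Finsupp.add_apply, Finsupp.single_eq_same, pow_succ, Nat.factorial_succ,
    Nat.cast_mul, Nat.cast_add, Nat.cast_one]
  ring

/-- Multiplication by p_k is adjoint to a multiple of ∂/∂p_k: one more part k multiplies the norm by
this constant times the new multiplicity, and the latter is what differentiation produces. -/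
theorem macForm_X_mul (k : ℕ+) (A B : Sym K) :
    macForm q t (MvPolynomial.X k * A) B =
      ((k : ℕ) : K) * ((1 - q ^ (k : ℕ)) / (1 - t ^ (k : ℕ))) *
        macForm q t A (MvPolynomial.pderiv k B) := by
  induction A using MvPolynomial.induction_on' with
  | add A A' h h' => rw [mul_add, map_add, LinearMap.add_apply, h, h', map_add, LinearMap.add_apply,
      mul_add]
  | monomial f a =>
    have hc : (MvPolynomial.pderiv k B).coeff f =
        B.coeff (f + Finsupp.single k 1) * ((f k : K) + 1) := by
      rw [MvPolynomial.coeff_pderiv]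
    rw [mul_comm, MvPolynomial.X, MvPolynomial.monomial_mul, mul_one, macForm_monomial,
      macForm_monomial, psumNorm_add_single, hc]
    ring

theorem shift_X (k : ℕ+) : shift q (MvPolynomial.X k) = Polynomial.C (MvPolynomial.X k) +
    Polynomial.C (MvPolynomial.C (q ^ (k : ℕ) - 1)) * Polynomial.X ^ (k : ℕ) := by
  rw [shift, MvPolynomial.aeval_X]

theorem derivative_shift_X (k : ℕ+) : Polynomial.derivative (shift q (MvPolynomial.X k)) =
    Polynomial.C (MvPolynomial.C ((k : ℕ) * (q ^ (k : ℕ) - 1))) *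
      Polynomial.X ^ ((k : ℕ) - 1) := by
  rw [shift_X, Polynomial.derivative_add, Polynomial.derivative_C, zero_add,
    Polynomial.derivative_C_mul_X_pow, mul_comm ((k : ℕ) : K), map_mul MvPolynomial.C,
    map_natCast]

theorem shift_pderiv_mul_X (B : Sym K) (k : ℕ+) (j : ℕ) :
    shift q (MvPolynomial.pderiv (Nat.succPNat j) (B * MvPolynomial.X k)) =
      shift q (MvPolynomial.pderiv (Nat.succPNat j) B) * shift q (MvPolynomial.X k) +
      if j = (k : ℕ) - 1 then shift q B else 0 := by
  rw [MvPolynomial.pderiv_mul, map_add, map_mul, map_mul, MvPolynomial.pderiv_X]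
  have hjk : k = Nat.succPNat j ↔ j = (k : ℕ) - 1 := by
    rw [← PNat.coe_inj, Nat.succPNat_coe]
    have := k.pos
    omega
  by_cases hj : j = (k : ℕ) - 1
  · rw [if_pos hj, ← hjk.2 hj, Pi.single_eq_same, map_one, mul_one]
  · rw [if_neg hj, Pi.single_eq_of_ne (fun h => hj (hjk.1 h)), map_zero, mul_zero]

/-- The chain rule in z. Only finitely many p_k occur in B; holding for all large N lets the
induction combine two bounds. -/
theorem derivative_shift (B : Sym K) : ∃ N₀, ∀ N ≥ N₀, Polynomial.derivative (shift q B) =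
    ∑ j ∈ Finset.range N, Polynomial.C (MvPolynomial.C (((j : K) + 1) * (q ^ (j + 1) - 1))) *
      Polynomial.X ^ j * shift q (MvPolynomial.pderiv (Nat.succPNat j) B) := by
  induction B using MvPolynomial.induction_on with
  | C a =>
    refine ⟨0, fun N _ => ?_⟩
    simp [MvPolynomial.algHom_C]
  | add A B hA hB =>
    obtain ⟨N₁, h₁⟩ := hA
    obtain ⟨N₂, h₂⟩ := hB
    refine ⟨max N₁ N₂, fun N hN => ?_⟩
    rw [map_add, Polynomial.derivative_add, h₁ N (le_trans (le_max_left _ _) hN),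
      h₂ N (le_trans (le_max_right _ _) hN), ← Finset.sum_add_distrib]
    refine Finset.sum_congr rfl fun j _ => ?_
    rw [map_add, map_add, mul_add]
  | mul_X B k hB =>
    obtain ⟨N₁, h₁⟩ := hB
    refine ⟨max N₁ k, fun N hN => ?_⟩
    have hmem : (k : ℕ) - 1 ∈ Finset.range N := by
      have := k.pos
      have := le_trans (le_max_right N₁ (k : ℕ)) hN
      rw [Finset.mem_range]; omega
    have hk1 : (k : ℕ) - 1 + 1 = k := Nat.sub_add_cancel k.pos
    have hk2 : (((k : ℕ) - 1 : ℕ) : K) + 1 = (k : ℕ) := by exact_mod_cast congrArg Nat.cast hk1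
    rw [map_mul, Polynomial.derivative_mul, h₁ N (le_trans (le_max_left _ _) hN),
      derivative_shift_X, Finset.sum_mul]
    simp only [shift_pderiv_mul_X, mul_add, Finset.sum_add_distrib, mul_ite, mul_zero]
    rw [Finset.sum_ite_eq', if_pos hmem, hk1, hk2, mul_comm (shift q B)]
    simp only [mul_assoc]

theorem shift_coeff_succ (B : Sym K) (m : ℕ) :
    ((m : K) + 1) • (shift q B).coeff (m + 1) = ∑ j ∈ Finset.range (m + 1),
      (((j : K) + 1) * (q ^ (j + 1) - 1)) •
        (shift q (MvPolynomial.pderiv (Nat.succPNat j) B)).coeff (m - j) := by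
  obtain ⟨N₀, h⟩ := derivative_shift (q := q) B
  have h1 := congrArg (fun P => Polynomial.coeff P m) (h (max N₀ (m + 1)) (le_max_left _ _))
  rw [Polynomial.coeff_derivative, Polynomial.finsetSum_coeff] at h1
  rw [← MvPolynomial.C_mul', map_add, map_natCast, map_one, mul_comm, h1]
  refine (Finset.sum_subset (Finset.range_mono (le_max_right N₀ (m + 1))) fun j _ hj => ?_).symm.trans
    (Finset.sum_congr rfl fun j hj => ?_)
  · rw [mul_assoc, Polynomial.coeff_C_mul, Polynomial.coeff_X_pow_mul', if_neg, mul_zero]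
    simpa using hj
  · rw [mul_assoc, Polynomial.coeff_C_mul, Polynomial.coeff_X_pow_mul', if_pos, MvPolynomial.C_mul']
    simpa [Nat.lt_succ_iff] using hj

/-- Newton's recursion for g_m on the left matches the recursion for the z-coefficients of `shift`
on the right, by adjointness of p_k and ∂/∂p_k. The powers of t come from 1 - t^{-k} = -(1 - t^k)
t^{-k}. -/
theorem macForm_gSymm_mul [CharZero K] (ht : t ≠ 0) (htk : ∀ k : ℕ, t ^ (k + 1) ≠ 1) (m : ℕ)
    (A B : Sym K) :
    macForm q t (gSymm t m * A) B = t⁻¹ ^ m * macForm q t A ((shift q B).coeff m) := by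
  induction m using Nat.strong_induction_on generalizing A B with
  | _ m ih =>
  rcases m with _ | m
  · have h : (shift q B).coeff 0 = B := by
      have := coeff_zero_shift (q := q) B
      rw [← Polynomial.eval_eq_sum, ← Polynomial.coeff_zero_eq_eval_zero] at this
      exact this
    rw [gSymm, one_mul, pow_zero, one_mul, h]
  · have hm : (m : K) + 1 ≠ 0 := Nat.cast_add_one_ne_zero m
    apply mul_left_cancel₀ hm
    rw [← smul_eq_mul, ← LinearMap.smul_apply, ← map_smul, ← smul_mul_assoc, gSymm_succ,
      mul_left_comm, ← smul_eq_mul ((m : K) + 1), ← map_smul, shift_coeff_succ, Finset.sum_mul,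
      map_sum, LinearMap.sum_apply, map_sum, Finset.mul_sum]
    refine Finset.sum_congr rfl fun j hj => ?_
    have hj' : j < m + 1 := Finset.mem_range.1 hj
    rw [smul_mul_assoc, map_smul, LinearMap.smul_apply, mul_assoc, macForm_X_mul,
      ih (m - j) (by omega), map_smul, smul_eq_mul, smul_eq_mul, Nat.succPNat_coe,
      Nat.succ_eq_add_one]
    have h1 : 1 - t ^ (j + 1) ≠ 0 := sub_ne_zero.2 (htk j).symm
    have h2 : t⁻¹ ^ (m + 1) = t⁻¹ ^ (j + 1) * t⁻¹ ^ (m - j) := by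
      rw [← pow_add]; congr 1; omega
    rw [h2]
    have h3 : (1 - t⁻¹ ^ (j + 1)) = - (1 - t ^ (j + 1)) * t⁻¹ ^ (j + 1) := by
      rw [inv_pow]; field_simp; ring
    rw [h3]
    push_cast
    field_simp
    ring

/-- Both sides equal (t - 1)⁻¹ ∑_m t^{-m} (A_m, B_m), with A_m and B_m the z-coefficients of the
shifted functions; this is visibly symmetric. -/
theorem macForm_macOp [CharZero K] (ht : t ≠ 0) (htk : ∀ k : ℕ, t ^ (k + 1) ≠ 1) (A B : Sym K) :
    macForm q t (macOp q t A) B = macForm q t A (macOp q t B) := by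
  set N := max (shift q A).natDegree (shift q B).natDegree + 1
  have key : ∀ A B : Sym K, (shift q A).natDegree < N → macForm q t (macOp q t A) B =
      (t - 1)⁻¹ * ∑ m ∈ Finset.range N,
        t⁻¹ ^ m * macForm q t ((shift q A).coeff m) ((shift q B).coeff m) := by
    intro A B hN
    rw [macOp_apply, map_smul, LinearMap.smul_apply, smul_eq_mul,
      Polynomial.sum_over_range' (shift q A) (f := fun m c => c * gSymm t m) (fun m => zero_mul _) N hN, map_sum, LinearMap.sum_apply]
    congr 1
    refine Finset.sum_congr rfl fun m _ => ?_
    rw [mul_comm, macForm_gSymm_mul ht htk]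
  rw [key A B (by omega), macForm_comm A, key B A (by omega)]
  congr 1
  exact Finset.sum_congr rfl fun m _ => by rw [macForm_comm]

theorem eq_zero_of_macForm_eq_zero [CharZero K] (hqk : ∀ k : ℕ, q ^ (k + 1) ≠ 1)
    (htk : ∀ k : ℕ, t ^ (k + 1) ≠ 1) {A : Sym K} (h : ∀ B, macForm q t A B = 0) : A = 0 := by
  ext f
  have h1 := h (MvPolynomial.monomial f 1)
  rw [macForm_comm, macForm_monomial, one_mul, mul_eq_zero] at h1
  refine (h1.resolve_right ?_).trans (MvPolynomial.coeff_zero f).symm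
  refine Finset.prod_ne_zero_iff.2 fun k _ => ?_
  obtain ⟨j, rfl⟩ : ∃ j, k = Nat.succPNat j := ⟨k.natPred, (PNat.succPNat_natPred k).symm⟩
  refine mul_ne_zero (mul_ne_zero (pow_ne_zero _ (by simp [Nat.cast_add_one_ne_zero]))
    (Nat.cast_ne_zero.2 (Nat.factorial_ne_zero _))) (pow_ne_zero _ (div_ne_zero ?_ ?_))
  · exact sub_ne_zero.2 (hqk j).symm
  · exact sub_ne_zero.2 (htk j).symm

end ScalarProduct

/-! ### Leading terms for a monomial order -/

section LeadingTerms

variable {K σ : Type*} [Field K] (m : MonomialOrder σ)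

/-- The coefficient of `f` at `α` is `c`, and all monomials of `f` are at most `α`. -/
def LeadsTo (f : MvPolynomial σ K) (α : σ →₀ ℕ) (c : K) : Prop :=
  m.toSyn (m.degree f) ≤ m.toSyn α ∧ f.coeff α = c

variable {m} {f g : MvPolynomial σ K} {α β : σ →₀ ℕ} {c d : K}

theorem LeadsTo.add (hf : LeadsTo m f α c) (hg : LeadsTo m g α d) :
    LeadsTo m (f + g) α (c + d) :=
  ⟨m.degree_add_le.trans (sup_le hf.1 hg.1), by rw [MvPolynomial.coeff_add, hf.2, hg.2]⟩

theorem LeadsTo.mul (hf : LeadsTo m f α c) (hg : LeadsTo m g β d) :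
    LeadsTo m (f * g) (α + β) (c * d) := by
  refine ⟨m.degree_mul_le.trans ?_, ?_⟩
  · rw [map_add, map_add]
    exact add_le_add hf.1 hg.1
  · rw [m.coeff_mul_of_add_of_degree_le hf.1 hg.1, hf.2, hg.2]

theorem leadsTo_zero (α : σ →₀ ℕ) : LeadsTo m (0 : MvPolynomial σ K) α 0 :=
  ⟨by rw [m.degree_zero, map_zero]; exact m.zero_le _, MvPolynomial.coeff_zero α⟩

theorem leadsTo_C (c : K) : LeadsTo m (MvPolynomial.C c : MvPolynomial σ K) 0 c :=
  ⟨by rw [m.degree_C], MvPolynomial.coeff_zero_C c⟩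

theorem LeadsTo.C_mul (a : K) (hf : LeadsTo m f α c) :
    LeadsTo m (MvPolynomial.C a * f) α (a * c) := by
  have := (leadsTo_C (m := m) a).mul hf
  rwa [zero_add] at this

theorem leadsTo_sum {ι : Type*} (s : Finset ι) (f : ι → MvPolynomial σ K) (c : ι → K)
    (h : ∀ i ∈ s, LeadsTo m (f i) α (c i)) : LeadsTo m (∑ i ∈ s, f i) α (∑ i ∈ s, c i) := by
  classical
  induction s using Finset.induction_on with
  | empty => exact leadsTo_zero α
  | insert i s hi ih =>
    rw [Finset.sum_insert hi, Finset.sum_insert hi]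
    exact (h i (Finset.mem_insert_self i s)).add
      (ih fun j hj => h j (Finset.mem_insert_of_mem hj))

theorem leadsTo_prod {ι : Type*} (s : Finset ι) (f : ι → MvPolynomial σ K) (α : ι → σ →₀ ℕ)
    (h : ∀ i ∈ s, LeadsTo m (f i) (α i) 1) : LeadsTo m (∏ i ∈ s, f i) (∑ i ∈ s, α i) 1 := by
  classical
  induction s using Finset.induction_on with
  | empty => rw [Finset.prod_empty, Finset.sum_empty, ← MvPolynomial.C_1]; exact leadsTo_C 1
  | insert i s hi ih =>
    rw [Finset.prod_insert hi, Finset.sum_insert hi]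
    have := (h i (Finset.mem_insert_self i s)).mul
      (ih fun j hj => h j (Finset.mem_insert_of_mem hj))
    rwa [mul_one] at this

theorem LeadsTo.of_lt (hf : LeadsTo m f α c) (h : m.toSyn α < m.toSyn β) : LeadsTo m f β 0 :=
  ⟨hf.1.trans h.le, m.coeff_eq_zero_of_lt (hf.1.trans_lt h)⟩

theorem LeadsTo.degree_eq (hf : LeadsTo m f α c) (hc : c ≠ 0) : m.degree f = α := by
  apply m.toSyn.injective
  refine hf.1.antisymm (m.le_degree ?_)
  rw [MvPolynomial.mem_support_iff, hf.2]
  exact hc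

/-- Allows the Vandermonde factor, whose leading coefficient is 1, to be cancelled after
denominators have been cleared. -/
theorem LeadsTo.of_mul_left (hf : LeadsTo m f α 1) (h : LeadsTo m (f * g) (α + β) c) :
    LeadsTo m g β c := by
  by_cases hg : g = 0
  · subst hg
    rw [mul_zero] at h
    rw [← h.2, MvPolynomial.coeff_zero]
    exact leadsTo_zero β
  have hf0 : f ≠ 0 := by
    rintro rfl
    exact zero_ne_one ((MvPolynomial.coeff_zero α).symm.trans hf.2)
  have h1 : m.toSyn (m.degree g) ≤ m.toSyn β := by
    have := h.1
    rw [m.degree_mul hf0 hg, hf.degree_eq one_ne_zero, map_add, map_add] at this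
    exact le_of_add_le_add_left this
  refine ⟨h1, ?_⟩
  rw [← h.2, m.coeff_mul_of_add_of_degree_le hf.1 h1, hf.2, one_mul]

theorem leadsTo_of_coeff (h : ∀ β, f.coeff β ≠ 0 → m.toSyn β ≤ m.toSyn α) :
    LeadsTo m f α (f.coeff α) :=
  ⟨m.degree_le_iff.2 fun β hβ => h β (MvPolynomial.mem_support_iff.1 hβ), rfl⟩

/-- Multiplication of the variable `i` by `t`. -/
noncomputable def scaleVar [DecidableEq σ] (t : K) (i : σ) : MvPolynomial σ K →ₐ[K] MvPolynomial σ K :=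
  MvPolynomial.aeval (Function.update MvPolynomial.X i (MvPolynomial.C t * MvPolynomial.X i))

theorem coeff_scaleVar [DecidableEq σ] (t : K) (i : σ) (f : MvPolynomial σ K) (β : σ →₀ ℕ) :
    (scaleVar t i f).coeff β = t ^ β i * f.coeff β := by
  induction f using MvPolynomial.induction_on generalizing β with
  | C a =>
    rw [scaleVar, MvPolynomial.algHom_C, MvPolynomial.algebraMap_eq, MvPolynomial.coeff_C]
    split_ifs with h
    · rw [← h, Finsupp.zero_apply, pow_zero, one_mul]
    · rw [mul_zero]
  | add f g hf hg => rw [map_add, MvPolynomial.coeff_add, MvPolynomial.coeff_add, hf, hg, mul_add]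
  | mul_X f j hf =>
    have hX : scaleVar t i (MvPolynomial.X j) =
        MvPolynomial.C (if i = j then t else 1) * MvPolynomial.X j := by
      rw [scaleVar, MvPolynomial.aeval_X]
      split_ifs with h
      · rw [h, Function.update_self]
      · rw [Function.update_of_ne (Ne.symm h), MvPolynomial.C_1, one_mul]
    rw [map_mul, hX, mul_left_comm, MvPolynomial.coeff_C_mul, MvPolynomial.coeff_mul_X',
      MvPolynomial.coeff_mul_X']
    by_cases h1 : j ∈ β.support
    · rw [if_pos h1, if_pos h1, hf]
      by_cases h : i = j
      · subst h
        rw [if_pos rfl, Finsupp.tsub_apply, Finsupp.single_eq_same, ← mul_assoc, ← pow_succ',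
          Nat.sub_add_cancel (Nat.one_le_iff_ne_zero.2 (Finsupp.mem_support_iff.1 h1))]
      · rw [if_neg h, one_mul, Finsupp.tsub_apply, Finsupp.single_eq_of_ne h, Nat.sub_zero]
    · rw [if_neg h1, if_neg h1, mul_zero, mul_zero]

theorem LeadsTo.scaleVar [DecidableEq σ] (t : K) (i : σ) (hf : LeadsTo m f α c) :
    LeadsTo m (scaleVar t i f) α (t ^ α i * c) := by
  rw [← hf.2, ← coeff_scaleVar]
  refine leadsTo_of_coeff fun β hβ => (m.le_degree ?_).trans hf.1
  rw [coeff_scaleVar] at hβ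
  exact MvPolynomial.mem_support_iff.2 (right_ne_zero_of_mul hβ)

end LeadingTerms

/-! ### Leading term of the Macdonald operator -/

section Vandermonde

variable {K : Type*} [Field K] {q t : K} {n : ℕ}

/-- The Vandermonde product `∏_{i < j} (x_i - x_j)`. -/
noncomputable def vandermondeProd (K : Type*) [Field K] (n : ℕ) : MvPolynomial (Fin n) K :=
  ∏ i, ∏ j, if i < j then MvPolynomial.X i - MvPolynomial.X j else 1

/-- The exponent of the leading monomial of the Vandermonde product. -/
noncomputable def staircase (n : ℕ) : Fin n →₀ ℕ :=
  ∑ i, ∑ j, if i < j then Finsupp.single i 1 else 0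

theorem staircase_apply (i : Fin n) : staircase n i = n - 1 - i := by
  have h : ∀ a b : Fin n, ((if a < b then Finsupp.single a 1 else 0 : Fin n →₀ ℕ) : Fin n → ℕ) i =
      if a = i then (if i < b then 1 else 0) else 0 := by
    intro a b
    by_cases h1 : a = i
    · subst h1
      by_cases h2 : a < b <;> simp [h2]
    · rw [if_neg h1]
      split_ifs
      · rw [Finsupp.single_eq_of_ne (Ne.symm h1)]
      · simp
  simp only [staircase, Finsupp.finsetSum_apply, h]
  rw [Finset.sum_eq_single i (fun a _ ha => by simp [ha]) (by simp)]
  simp only [if_true]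
  rw [← Finset.card_filter]
  have : Finset.univ.filter (i < ·) = Finset.Ioi i := by ext; simp
  rw [this, Fin.card_Ioi]

theorem leadsTo_vandermondeProd :
    LeadsTo MonomialOrder.lex (vandermondeProd K n) (staircase n) 1 := by
  refine leadsTo_prod _ _ _ fun i _ => leadsTo_prod _ _ _ fun j _ => ?_
  split_ifs with h
  · have h1 : LeadsTo MonomialOrder.lex (MvPolynomial.X i : MvPolynomial (Fin n) K)
        (Finsupp.single i 1) 1 :=
      ⟨MonomialOrder.degree_X_le_single, by simp⟩
    have h2 : LeadsTo MonomialOrder.lex (MvPolynomial.X j : MvPolynomial (Fin n) K)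
        (Finsupp.single j 1) 1 :=
      ⟨MonomialOrder.degree_X_le_single, by simp⟩
    have h3 := (h2.C_mul (-1)).of_lt (β := Finsupp.single i 1) (by
      rw [MonomialOrder.lex_lt_iff]
      refine ⟨i, fun k hk => ?_, ?_⟩
      · have h4 : k ≠ i := hk.ne
        have h5 : k ≠ j := (hk.trans h).ne
        simp [h4, h5]
      · simp [h.ne])
    have := h1.add h3
    rw [add_zero] at this
    convert this using 1
    rw [map_neg, MvPolynomial.C_1]; ring
  · rw [← MvPolynomial.C_1]
    exact leadsTo_C 1

theorem algebraMap_X_sub_ne_zero {i j : Fin n} (h : i ≠ j) :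
    fracVar K n i - fracVar K n j ≠ 0 :=
  sub_ne_zero.2 fun h' => h (fracVar_injective h')

/-- Scaling x_i by t affects only the factors that involve x_i, so the coefficients of D_n^1 are the
ratios of the scaled to the unscaled Vandermonde product. -/
theorem algebraMap_scaleVar_vandermondeProd (i : Fin n) :
    algebraMap (MvPolynomial (Fin n) K) (RatFun K n)
      (scaleVar t i (vandermondeProd K n)) =
    algebraMap _ _ (vandermondeProd K n) * ∏ j ∈ Finset.univ.erase i,
      (algebraMap K (RatFun K n) t * fracVar K n i - fracVar K n j) /
        (fracVar K n i - fracVar K n j) := by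
  classical
  let h : Fin n → Fin n → RatFun K n := fun a b =>
    if a < b then algebraMap (MvPolynomial (Fin n) K) _
      (scaleVar t i (MvPolynomial.X a - MvPolynomial.X b)) / (fracVar K n a - fracVar K n b) else 1
  have hX : ∀ j, algebraMap (MvPolynomial (Fin n) K) (RatFun K n)
      (scaleVar t i (MvPolynomial.X j)) = if j = i then algebraMap K _ t * fracVar K n i else
        fracVar K n j := by
    intro j
    rw [scaleVar, MvPolynomial.aeval_X]
    split_ifs with hj
    · rw [hj, Function.update_self, map_mul]
      rfl
    · rw [Function.update_of_ne hj]
      rfl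
  have h1 : algebraMap (MvPolynomial (Fin n) K) (RatFun K n)
      (scaleVar t i (vandermondeProd K n)) =
        algebraMap _ _ (vandermondeProd K n) * ∏ a, ∏ b, h a b := by
    simp only [vandermondeProd, map_prod]
    rw [← Finset.prod_mul_distrib]
    refine Finset.prod_congr rfl fun a _ => ?_
    rw [← Finset.prod_mul_distrib]
    refine Finset.prod_congr rfl fun b _ => ?_
    simp only [h]
    split_ifs with hab
    · have e : algebraMap (MvPolynomial (Fin n) K) (RatFun K n)
          (MvPolynomial.X a - MvPolynomial.X b) = fracVar K n a - fracVar K n b := map_sub _ _ _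
      rw [e, mul_div_cancel₀ _ (algebraMap_X_sub_ne_zero hab.ne)]
    · rw [map_one, map_one, one_mul]
  have h2 : ∀ a b, a ≠ i → b ≠ i → h a b = 1 := by
    intro a b ha hb
    simp only [h]
    split_ifs with hab
    · rw [map_sub, map_sub, hX, hX, if_neg ha, if_neg hb,
        div_self (algebraMap_X_sub_ne_zero hab.ne)]
    · rfl
  have h3 : h i i = 1 := if_neg (lt_irrefl i)
  rw [h1, ← Finset.mul_prod_erase Finset.univ (fun a => ∏ b, h a b) (Finset.mem_univ i),
    ← Finset.mul_prod_erase Finset.univ (fun b => h i b) (Finset.mem_univ i), h3, one_mul,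
    ← Finset.prod_mul_distrib]
  congr 1
  refine Finset.prod_congr rfl fun j hj => ?_
  have hji := Finset.ne_of_mem_erase hj
  rw [Finset.prod_eq_single i (fun b _ hb => h2 j b hji hb) (by simp)]
  simp only [h]
  rcases lt_or_gt_of_ne hji with hlt | hlt
  · rw [if_neg hlt.not_gt, if_pos hlt, one_mul, map_sub, map_sub, hX, hX, if_neg hji, if_pos rfl,
      ← neg_div_neg_eq, neg_sub, neg_sub]
  · rw [if_pos hlt, if_neg hlt.not_gt, mul_one, map_sub, map_sub, hX, hX, if_neg hji, if_pos rfl]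

theorem vandermondeProd_mul_restrict {E : Module.End K (Sym K)}
    (hE : IsModifiedMacdonaldOp q t E) (f : Sym K) :
    vandermondeProd K n * restrict n (E f) =
      MvPolynomial.C (t⁻¹ ^ n) * ∑ i, scaleVar t i (vandermondeProd K n) *
        scaleVar q i (restrict n f) +
      MvPolynomial.C (t⁻¹ ^ (n + 1) / (1 - t⁻¹)) * (vandermondeProd K n * restrict n f) := by
  apply IsFractionRing.injective (MvPolynomial (Fin n) K) (RatFun K n)
  have hC : ∀ c : K, algebraMap (MvPolynomial (Fin n) K)
      (RatFun K n) (MvPolynomial.C c) = algebraMap K _ c := fun c =>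
    (IsScalarTower.algebraMap_apply K (MvPolynomial (Fin n) K) _ c).symm
  rw [map_mul, hE n f, map_add, map_mul, map_mul, map_mul, map_sum, hC, hC, mul_add]
  congr 1
  · rw [macdonaldD, mul_left_comm, Finset.mul_sum]
    congr 1
    refine Finset.sum_congr rfl fun i _ => ?_
    rw [map_mul, algebraMap_scaleVar_vandermondeProd, mul_assoc]
    rfl
  · ring

/-- After multiplication by the Vandermonde product, the i-th summand only scales x_i in two
polynomials. This keeps the leading exponents and multiplies the coefficients by t^{n-1-i} and
q^{α_i}. -/
theorem LeadsTo.modifiedMacdonald {E : Module.End K (Sym K)}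
    (hE : IsModifiedMacdonaldOp q t E) {f : Sym K} {α : Fin n →₀ ℕ} {c : K}
    (hf : LeadsTo MonomialOrder.lex (restrict n f) α c) :
    LeadsTo MonomialOrder.lex (restrict n (E f)) α
      ((t⁻¹ ^ n * ∑ i : Fin n, t ^ (n - 1 - i) * q ^ α i + t⁻¹ ^ (n + 1) / (1 - t⁻¹)) * c) := by
  refine leadsTo_vandermondeProd.of_mul_left ?_
  rw [vandermondeProd_mul_restrict hE]
  have h1 := leadsTo_sum Finset.univ (fun i => MacFock.scaleVar t i (vandermondeProd K n) *
    MacFock.scaleVar q i (restrict n f)) _ fun i _ =>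
      ((leadsTo_vandermondeProd (K := K) (n := n)).scaleVar t i).mul (hf.scaleVar q i)
  have h2 := (h1.C_mul (t⁻¹ ^ n)).add
    ((leadsTo_vandermondeProd.mul hf).C_mul (t⁻¹ ^ (n + 1) / (1 - t⁻¹)))
  convert h2 using 1
  rw [add_mul, Finset.mul_sum, Finset.mul_sum, Finset.sum_mul, one_mul]
  congr 1
  refine Finset.sum_congr rfl fun i _ => ?_
  rw [staircase_apply]
  ring

end Vandermonde

/-! ### Exponent vectors, lexicographic order and dominance -/

section Exponents

variable {n N : ℕ}

/-- The row lengths of a Young diagram as an exponent vector in `N` variables. -/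
noncomputable def partVec (N : ℕ) (Y : YoungDiagram) : Fin N →₀ ℕ :=
  Finsupp.equivFunOnFinite.symm fun i => Y.rowLen i

theorem partVec_apply (Y : YoungDiagram) (i : Fin N) : partVec N Y i = Y.rowLen i := rfl

theorem rowLen_eq_zero (μ : n.Partition) {i : ℕ} (hi : n ≤ i) : (young μ).rowLen i = 0 := by
  exact rowLen_card_eq_zero _ (by rwa [card_young])

theorem filter_pos_partVec (μ : n.Partition) (hN : n ≤ N) :
    ((Finset.univ : Finset (Fin N)).val.map (partVec N (young μ))).filter (0 < ·) = μ.parts := by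
  have h1 : (Finset.univ : Finset (Fin N)).val.map (partVec N (young μ)) =
      (Finset.range N).val.map (young μ).rowLen := by
    have h2 : (Finset.range N).val =
        (Finset.univ : Finset (Fin N)).val.map (fun i : Fin N => (i : ℕ)) := by
      change ((List.range N : List ℕ) : Multiset ℕ) =
        Multiset.map _ ((List.finRange N : List (Fin N)) : Multiset (Fin N))
      rw [Multiset.map_coe, List.map_coe_finRange_eq_range]
    rw [h2, Multiset.map_map]
    rfl
  have h3 : (Finset.range N).filter (fun i => 0 < (young μ).rowLen i) =
      Finset.range ((young μ).colLen 0) := by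
    ext i
    rw [Finset.mem_filter, Finset.mem_range, Finset.mem_range, ← YoungDiagram.mem_iff_lt_colLen,
      YoungDiagram.mem_iff_lt_rowLen]
    refine ⟨fun h => h.2, fun h => ⟨?_, h⟩⟩
    by_contra hi
    rw [rowLen_eq_zero μ (by omega)] at h
    exact lt_irrefl _ h
  have h4 := congrArg (fun l : List ℕ => (l : Multiset ℕ)) (rowLens_young μ)
  simp only [Multiset.sort_eq] at h4
  rw [h1, Multiset.filter_map, ← h4, YoungDiagram.rowLens]
  change Multiset.map _ ((Finset.range N).filter (fun i => 0 < (young μ).rowLen i)).val = _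
  rw [h3]
  rfl

theorem filter_pos_toFinsupp (s : _root_.Sym (Fin N) n) :
    ((Finset.univ : Finset (Fin N)).val.map (Multiset.toFinsupp s.1)).filter (0 < ·) =
      (Nat.Partition.ofSym s).parts := by
  rw [Multiset.filter_map]
  change Multiset.map _
    ((Finset.univ : Finset (Fin N)).filter fun i => 0 < Multiset.toFinsupp s.1 i).val =
      Multiset.map _ s.1.toFinset.val
  have h : ((Finset.univ : Finset (Fin N)).filter fun i => 0 < Multiset.toFinsupp s.1 i) =
      s.1.toFinset := by
    ext i
    simp [Multiset.count_pos]
  rw [h]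
  rfl

theorem ofSym_eq_of_toFinsupp_eq (μ : n.Partition) (hN : n ≤ N) {s : _root_.Sym (Fin N) n}
    (hs : Multiset.toFinsupp s.1 = partVec N (young μ)) : Nat.Partition.ofSym s = μ := by
  apply Nat.Partition.ext
  rw [← filter_pos_toFinsupp, hs, filter_pos_partVec μ hN]

theorem card_filter_le_eq {α β : Fin N →₀ ℕ}
    (h : ((Finset.univ : Finset (Fin N)).val.map α).filter (0 < ·) =
      ((Finset.univ : Finset (Fin N)).val.map β).filter (0 < ·)) {v : ℕ} (hv : 0 < v) :
    (Finset.univ.filter fun i => v ≤ α i).card = (Finset.univ.filter fun i => v ≤ β i).card := by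
  have key : ∀ γ : Fin N →₀ ℕ, (Finset.univ.filter fun i => v ≤ γ i).card =
      (((Finset.univ : Finset (Fin N)).val.map γ).filter (0 < ·)).countP (v ≤ ·) := by
    intro γ
    rw [Multiset.countP_filter, Multiset.countP_map, Finset.card_def, Finset.filter_val]
    congr 1
    refine Multiset.filter_congr fun i _ => ?_
    omega
  rw [key, key, h]

/-- The weakly decreasing arrangement is the lexicographically largest. If another arrangement α
were first larger at place i, all row lengths ≥ α_i would lie before i, where the two agree, so α
would have at least one more entry ≥ α_i. -/
theorem toFinsupp_le_partVec (μ : n.Partition) (hN : n ≤ N) {s : _root_.Sym (Fin N) n}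
    (hs : Nat.Partition.ofSym s = μ) :
    MonomialOrder.lex.toSyn (Multiset.toFinsupp s.1) ≤
      MonomialOrder.lex.toSyn (partVec N (young μ)) := by
  by_contra hlt
  rw [not_le, MonomialOrder.lex_lt_iff] at hlt
  obtain ⟨i, hi, hi'⟩ := hlt
  set α := Multiset.toFinsupp s.1
  replace hi : ∀ j < i, (young μ).rowLen j = α j := hi
  replace hi' : (young μ).rowLen i < α i := hi'
  have hc := card_filter_le_eq (α := partVec N (young μ)) (β := α) (by
    rw [filter_pos_partVec μ hN, filter_pos_toFinsupp, hs]) (v := α i) (by omega)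
  refine (Finset.card_lt_card ?_).ne hc
  rw [Finset.ssubset_iff_of_subset]
  · refine ⟨i, Finset.mem_filter.2 ⟨Finset.mem_univ i, le_refl _⟩, fun h => ?_⟩
    have h1 : α i ≤ (young μ).rowLen i := (Finset.mem_filter.1 h).2
    omega
  · intro j hj
    have h1 : α i ≤ (young μ).rowLen j := (Finset.mem_filter.1 hj).2
    have hji : j < i := by
      by_contra h
      have := (young μ).rowLen_anti i j (not_lt.1 h)
      omega
    refine Finset.mem_filter.2 ⟨Finset.mem_univ j, ?_⟩
    rwa [← hi j hji]

theorem partVec_injective (μ lam : Parts) (hμ : μ.1 ≤ N) (hlam : lam.1 ≤ N)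
    (h : partVec N (young μ.2) = partVec N (young lam.2)) : μ = lam := by
  obtain ⟨k, μ⟩ := μ
  obtain ⟨l, lam⟩ := lam
  have h1 := filter_pos_partVec μ hμ
  rw [h, filter_pos_partVec lam hlam] at h1
  obtain rfl : k = l := by rw [← μ.parts_sum, ← lam.parts_sum, h1]
  rw [Nat.Partition.ext h1]

/-- Dominance is refined by the lexicographic order: at the first place where the rows differ, the
partial sums differ in the same direction. -/
theorem partVec_lt_of_strictlyDominated {μ lam : n.Partition} (hN : n ≤ N)
    (h : StrictlyDominated μ lam) :
    MonomialOrder.lex.toSyn (partVec N (young μ)) <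
      MonomialOrder.lex.toSyn (partVec N (young lam)) := by
  by_contra hlt
  rcases (not_lt.1 hlt).eq_or_lt with heq | hlt
  · have := partVec_injective ⟨n, lam⟩ ⟨n, μ⟩ hN hN (MonomialOrder.lex.toSyn.injective heq)
    exact h.1 (by simpa using this.symm)
  · rw [MonomialOrder.lex_lt_iff] at hlt
    obtain ⟨i, hi, hi'⟩ := hlt
    replace hi : ∀ j < i, (young lam).rowLen j = (young μ).rowLen j := hi
    replace hi' : (young lam).rowLen i < (young μ).rowLen i := hi'
    have h1 := h.2 (i + 1)
    have h2 : ∑ j ∈ Finset.range i, (young lam).rowLen j =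
        ∑ j ∈ Finset.range i, (young μ).rowLen j := Finset.sum_congr rfl fun j hj =>
      hi ⟨j, (Finset.mem_range.1 hj).trans i.2⟩ (Finset.mem_range.1 hj)
    rw [Finset.sum_range_succ, Finset.sum_range_succ, h2] at h1
    omega

end Exponents

/-! ### Leading terms of monomial and Macdonald functions -/

section Triangularity

variable {K : Type*} [Field K] {q t : K} {n N : ℕ}

theorem prod_map_X {σ : Type*} [DecidableEq σ] (s : Multiset σ) :
    (s.map (MvPolynomial.X : σ → MvPolynomial σ K)).prod =
      MvPolynomial.monomial (Multiset.toFinsupp s) 1 := by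
  induction s using Multiset.induction_on with
  | empty => simp
  | cons a s ih =>
    rw [Multiset.map_cons, Multiset.prod_cons, ih, ← Multiset.singleton_add, map_add,
      Multiset.toFinsupp_singleton, MvPolynomial.X, MvPolynomial.monomial_mul, one_mul]

theorem leadsTo_msymm (μ : n.Partition) (hN : n ≤ N) :
    LeadsTo MonomialOrder.lex (MvPolynomial.msymm (Fin N) K μ) (partVec N (young μ)) 1 := by
  classical
  have h := leadsTo_sum (K := K) (m := MonomialOrder.lex) (α := partVec N (young μ)) Finset.univ
    (fun s : {a : _root_.Sym (Fin N) n // Nat.Partition.ofSym a = μ} =>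
      (s.1.1.map (MvPolynomial.X : Fin N → MvPolynomial (Fin N) K)).prod)
    (fun s => if Multiset.toFinsupp s.1.1 = partVec N (young μ) then 1 else 0) (by
      intro s _
      simp only [prod_map_X]
      refine ⟨(MonomialOrder.degree_monomial_le 1).trans (toFinsupp_le_partVec μ hN s.2), ?_⟩
      rw [MvPolynomial.coeff_monomial])
  have hcard : (Finsupp.toMultiset (partVec N (young μ))).card = n := by
    have h1 := filter_pos_partVec μ hN
    rw [Finsupp.card_toMultiset, Finsupp.sum_fintype _ _ fun _ => rfl]
    conv_rhs => rw [← μ.parts_sum, ← h1]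
    have h2 : ∀ L : Multiset ℕ, (L.filter (0 < ·)).sum = L.sum := fun L => by
      induction L using Multiset.induction_on with
      | empty => rfl
      | cons a L ih =>
        rcases Nat.eq_zero_or_pos a with h3 | (h3 : 0 < a)
        · rw [Multiset.filter_cons_of_neg _ (by omega), ih, Multiset.sum_cons, h3, zero_add]
        · rw [Multiset.filter_cons_of_pos (p := (0 < ·)) _ h3, Multiset.sum_cons, ih, Multiset.sum_cons]
    rw [h2]
    rfl
  -- The only term of the monomial symmetric function with the sorted exponent; it yields the
  -- leading coefficient 1.
  let s₀ : _root_.Sym (Fin N) n := ⟨Finsupp.toMultiset (partVec N (young μ)), hcard⟩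
  have hs₀ : Multiset.toFinsupp s₀.1 = partVec N (young μ) := Finsupp.toMultiset_toFinsupp _
  have hsum : (∑ s : {a : _root_.Sym (Fin N) n // Nat.Partition.ofSym a = μ},
      if Multiset.toFinsupp s.1.1 = partVec N (young μ) then (1 : K) else 0) = 1 := by
    rw [Finset.sum_eq_single ⟨s₀, ofSym_eq_of_toFinsupp_eq μ hN hs₀⟩]
    · exact if_pos hs₀
    · intro s _ hs
      rw [if_neg]
      intro h1
      exact hs (Subtype.ext (Subtype.ext (Multiset.toFinsupp.injective (h1.trans hs₀.symm))))
    · intro h1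
      exact absurd (Finset.mem_univ _) h1
  rw [hsum] at h
  exact h

theorem IsMacdonaldBasis.leadsTo {P : Module.Basis Parts K (Sym K)} (hP : IsMacdonaldBasis q t P)
    (lam : Parts) (hN : lam.1 ≤ N) :
    LeadsTo MonomialOrder.lex (restrict N (P lam)) (partVec N (young lam.2)) 1 := by
  obtain ⟨n, lam⟩ := lam
  obtain ⟨c, hc, h⟩ := hP.1 n lam
  rw [h N]
  have h1 := (leadsTo_msymm (K := K) lam hN).add (leadsTo_sum Finset.univ
    (fun μ => c μ • MvPolynomial.msymm (Fin N) K μ) (fun _ => 0) (fun μ _ => by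
      rw [← MvPolynomial.C_mul']
      by_cases hμ : c μ = 0
      · rw [hμ, MvPolynomial.C_0, zero_mul]
        exact leadsTo_zero _
      · rw [← mul_zero (c μ)]
        exact ((leadsTo_msymm μ hN).of_lt
          (partVec_lt_of_strictlyDominated hN (hc μ hμ))).C_mul (c μ)))
  rwa [Finset.sum_const_zero, add_zero] at h1

/-- Each additional empty row takes over one term of the geometric tail, so the number of variables
may exceed the size of the partition. -/
theorem sum_add_geom_eq_e1Value (ht : t ≠ 0) (ht1 : t ≠ 1) (lam : Parts) (hN : lam.1 ≤ N) :
    t⁻¹ ^ N * ∑ i : Fin N, t ^ (N - 1 - i) * q ^ partVec N (young lam.2) i +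
      t⁻¹ ^ (N + 1) / (1 - t⁻¹) = e1Value q t lam := by
  have h1 : 1 - t⁻¹ ≠ 0 := sub_ne_zero.2 fun h => ht1 (inv_eq_one.1 h.symm)
  have h2 : t⁻¹ ^ N * ∑ i : Fin N, t ^ (N - 1 - i) * q ^ partVec N (young lam.2) i =
      ∑ i ∈ Finset.range N, q ^ (young lam.2).rowLen i * t⁻¹ ^ (i + 1) := by
    rw [Finset.sum_range fun i => q ^ (young lam.2).rowLen i * t⁻¹ ^ (i + 1), Finset.mul_sum]
    refine Finset.sum_congr rfl fun i _ => ?_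
    have h3 : t⁻¹ ^ N = t⁻¹ ^ (i.1 + 1) * t⁻¹ ^ (N - 1 - i) := by
      rw [← pow_add]; congr 1; omega
    have h4 : t⁻¹ ^ (N - 1 - i.1) * t ^ (N - 1 - i.1) = 1 := by
      rw [← mul_pow, inv_mul_cancel₀ ht, one_pow]
    rw [h3, partVec_apply]
    linear_combination (t⁻¹ ^ (i.1 + 1) * q ^ (young lam.2).rowLen i) * h4
  rw [h2]
  clear h2
  induction N, hN using Nat.le_induction with
  | base => rfl
  | succ N hN ih =>
    rw [← ih, Finset.sum_range_succ, rowLen_eq_zero lam.2 hN, pow_zero, one_mul, add_assoc]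
    congr 1
    rw [pow_succ t⁻¹ (N + 1)]
    rw [eq_div_iff h1, add_mul, div_mul_cancel₀ _ h1]
    ring

end Triangularity

/-! ### Eigenvalues of the modified Macdonald operator -/

section Eigenvalues

variable {K : Type*} [Field K] {q t : K} {N : ℕ} {P : Module.Basis Parts K (Sym K)}

/-- Different P_κ have different leading exponents once N bounds all sizes involved, so leading
terms cannot cancel. Partitions of different sizes are compared as well, which makes the grading
unnecessary. -/
theorem IsMacdonaldBasis.leadsTo_repr (hP : IsMacdonaldBasis q t P) {f : Sym K} {μ : Parts}
    (hf : ∀ κ ∈ (P.repr f).support, κ.1 ≤ N) (hμ : μ.1 ≤ N)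
    (h : ∀ κ ∈ (P.repr f).support, MonomialOrder.lex.toSyn (partVec N (young κ.2)) ≤
      MonomialOrder.lex.toSyn (partVec N (young μ.2))) :
    LeadsTo MonomialOrder.lex (restrict N f) (partVec N (young μ.2)) (P.repr f μ) := by
  classical
  have h1 := leadsTo_sum (P.repr f).support
    (fun κ => MvPolynomial.C (P.repr f κ) * restrict N (P κ))
    (fun κ => if κ = μ then P.repr f κ else 0) (α := partVec N (young μ.2))
    (m := MonomialOrder.lex) (by
      intro κ hκ
      have h2 := hP.leadsTo κ (hf κ hκ)
      split_ifs with hκμ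
      · subst hκμ
        have := h2.C_mul (P.repr f κ)
        rwa [mul_one] at this
      · have := (h2.of_lt ((h κ hκ).lt_of_ne fun h3 => hκμ (partVec_injective κ μ (hf κ hκ) hμ
          (MonomialOrder.lex.toSyn.injective h3)))).C_mul (P.repr f κ)
        rwa [mul_zero] at this)
  have h3 : restrict N f = ∑ κ ∈ (P.repr f).support,
      MvPolynomial.C (P.repr f κ) * restrict N (P κ) := by
    conv_lhs => rw [← P.linearCombination_repr f, Finsupp.linearCombination_apply, Finsupp.sum,
      map_sum]
    exact Finset.sum_congr rfl fun κ _ => by rw [map_smul, MvPolynomial.C_mul']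
  have h4 : (∑ κ ∈ (P.repr f).support, if κ = μ then P.repr f κ else 0) = P.repr f μ := by
    rw [Finset.sum_ite_eq']
    split_ifs with h5
    · rfl
    · exact (Finsupp.notMem_support_iff.1 h5).symm
  rw [h3, ← h4]
  exact h1

theorem IsMacdonaldBasis.exists_leadsTo (hP : IsMacdonaldBasis q t P) {f : Sym K} (hf0 : f ≠ 0)
    (hf : ∀ κ ∈ (P.repr f).support, κ.1 ≤ N) : ∃ μ ∈ (P.repr f).support,
    LeadsTo MonomialOrder.lex (restrict N f) (partVec N (young μ.2)) (P.repr f μ) ∧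
    ∀ κ ∈ (P.repr f).support, MonomialOrder.lex.toSyn (partVec N (young κ.2)) ≤
      MonomialOrder.lex.toSyn (partVec N (young μ.2)) := by
  have hne : (P.repr f).support.Nonempty := by
    rw [Finsupp.support_nonempty_iff]
    simpa using hf0
  obtain ⟨μ, hμ, hmax⟩ := Finset.exists_max_image _
    (fun κ : Parts => MonomialOrder.lex.toSyn (partVec N (young κ.2))) hne
  exact ⟨μ, hμ, hP.leadsTo_repr hf (hf μ hμ) hmax, hmax⟩

theorem IsMacdonaldBasis.repr_eq_of_leadsTo (hP : IsMacdonaldBasis q t P) {f : Sym K} {lam : Parts}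
    {c : K} (hf : ∀ κ ∈ (P.repr f).support, κ.1 ≤ N) (hlam : lam.1 ≤ N)
    (h : LeadsTo MonomialOrder.lex (restrict N f) (partVec N (young lam.2)) c) :
    (∀ κ ∈ (P.repr f).support, MonomialOrder.lex.toSyn (partVec N (young κ.2)) ≤
      MonomialOrder.lex.toSyn (partVec N (young lam.2))) ∧ P.repr f lam = c := by
  have h1 : ∀ κ ∈ (P.repr f).support, MonomialOrder.lex.toSyn (partVec N (young κ.2)) ≤
      MonomialOrder.lex.toSyn (partVec N (young lam.2)) := by
    by_cases hf0 : f = 0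
    · subst hf0
      simp
    · obtain ⟨μ, hμ, hlead, hmax⟩ := hP.exists_leadsTo hf0 hf
      intro κ hκ
      refine (hmax κ hκ).trans ?_
      rw [← hlead.degree_eq (Finsupp.mem_support_iff.1 hμ)]
      exact h.1
  exact ⟨h1, (hP.leadsTo_repr hf hlam h1).2.symm.trans h.2⟩

theorem exists_size_bound (S : Finset Parts) : ∃ N, ∀ κ ∈ S, κ.1 ≤ N :=
  ⟨S.sup fun κ => κ.1, fun _ hκ => Finset.le_sup (f := fun κ : Parts => κ.1) hκ⟩

theorem IsMacdonaldBasis.eq_zero_of_restrict (hP : IsMacdonaldBasis q t P) {f : Sym K}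
    (h : ∀ N, restrict N f = 0) : f = 0 := by
  by_contra hf0
  obtain ⟨N, hN⟩ := exists_size_bound (P.repr f).support
  obtain ⟨μ, hμ, hlead, -⟩ := hP.exists_leadsTo hf0 hN
  rw [h N] at hlead
  exact Finsupp.mem_support_iff.1 hμ (hlead.2.symm.trans (MvPolynomial.coeff_zero _))

theorem IsMacdonaldBasis.modifiedMacdonaldOp_unique (hP : IsMacdonaldBasis q t P)
    {E E' : Module.End K (Sym K)} (hE : IsModifiedMacdonaldOp q t E)
    (hE' : IsModifiedMacdonaldOp q t E') : E = E' := by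
  refine LinearMap.ext fun f => ?_
  refine sub_eq_zero.1 (hP.eq_zero_of_restrict fun N => ?_)
  rw [map_sub, sub_eq_zero]
  apply IsFractionRing.injective (MvPolynomial (Fin N) K) (RatFun K N)
  rw [hE N f, hE' N f]

theorem IsMacdonaldBasis.macForm_eq (hP : IsMacdonaldBasis q t P) (f : Sym K) (μ : Parts) :
    macForm q t f (P μ) = P.repr f μ * macForm q t (P μ) (P μ) := by
  conv_lhs => rw [← P.linearCombination_repr f, Finsupp.linearCombination_apply, Finsupp.sum,
    map_sum, LinearMap.sum_apply]
  simp only [map_smul, LinearMap.smul_apply, smul_eq_mul]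
  refine Finset.sum_eq_single μ (fun κ _ hκ => ?_) fun hμ => ?_
  · rw [macForm_apply, hP.2 κ μ hκ, mul_zero]
  · rw [Finsupp.notMem_support_iff.1 hμ, zero_mul]

theorem IsMacdonaldBasis.macForm_self_ne_zero [CharZero K] (hP : IsMacdonaldBasis q t P)
    (hqk : ∀ k : ℕ, q ^ (k + 1) ≠ 1) (htk : ∀ k : ℕ, t ^ (k + 1) ≠ 1) (μ : Parts) :
    macForm q t (P μ) (P μ) ≠ 0 := fun h =>
  P.ne_zero μ (eq_zero_of_macForm_eq_zero hqk htk fun B => by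
    rw [macForm_comm, hP.macForm_eq, h, mul_zero])

/-- By self-adjointness and orthogonality, a nonzero entry from λ to κ forces a nonzero entry from κ
to λ. Triangularity then gives κ ≤ λ ≤ κ in lexicographic order, so κ = λ. Distinctness of the
eigenvalues is not needed. -/
theorem IsMacdonaldBasis.macOp_apply_eq [CharZero K] (hP : IsMacdonaldBasis q t P) (ht : t ≠ 0)
    (hqk : ∀ k : ℕ, q ^ (k + 1) ≠ 1) (htk : ∀ k : ℕ, t ^ (k + 1) ≠ 1) (lam : Parts) :
    macOp q t (P lam) = e1Value q t lam • P lam := by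
  have ht1 : t ≠ 1 := by simpa using htk 0
  have tri : ∀ lam : Parts, ∀ N, (∀ κ ∈ (P.repr (macOp q t (P lam))).support, κ.1 ≤ N) →
      lam.1 ≤ N → (∀ κ ∈ (P.repr (macOp q t (P lam))).support,
        MonomialOrder.lex.toSyn (partVec N (young κ.2)) ≤
          MonomialOrder.lex.toSyn (partVec N (young lam.2))) ∧
        P.repr (macOp q t (P lam)) lam = e1Value q t lam := by
    intro lam N hN hlam
    have h := (hP.leadsTo lam hlam).modifiedMacdonald (macOp_isModified (q := q) ht ht1)
    rw [mul_one, sum_add_geom_eq_e1Value ht ht1 lam hlam] at h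
    exact hP.repr_eq_of_leadsTo hN hlam h
  have diag : ∀ μ : Parts, P.repr (macOp q t (P μ)) μ = e1Value q t μ := by
    intro μ
    obtain ⟨N, hN⟩ := exists_size_bound (P.repr (macOp q t (P μ))).support
    exact (tri μ (max N μ.1) (fun κ hκ => (hN κ hκ).trans (le_max_left _ _)) (le_max_right _ _)).2
  apply P.repr.injective
  ext κ
  rw [map_smul, P.repr_self, Finsupp.smul_single, smul_eq_mul, mul_one]
  rcases eq_or_ne κ lam with rfl | hκ
  · rw [diag, Finsupp.single_eq_same]
  · rw [Finsupp.single_eq_of_ne hκ]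
    by_contra h0
    have hsym : P.repr (macOp q t (P lam)) κ * macForm q t (P κ) (P κ) =
        P.repr (macOp q t (P κ)) lam * macForm q t (P lam) (P lam) := by
      rw [← hP.macForm_eq, ← hP.macForm_eq, macForm_macOp ht htk, macForm_comm]
    have h1 : P.repr (macOp q t (P κ)) lam ≠ 0 := by
      intro h2
      rw [h2, zero_mul, mul_eq_zero] at hsym
      exact hsym.elim h0 (hP.macForm_self_ne_zero hqk htk κ)
    obtain ⟨N₁, hN₁⟩ := exists_size_bound (P.repr (macOp q t (P lam))).support
    obtain ⟨N₂, hN₂⟩ := exists_size_bound (P.repr (macOp q t (P κ))).support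
    have hκs : κ ∈ (P.repr (macOp q t (P lam))).support := Finsupp.mem_support_iff.2 h0
    have hls : lam ∈ (P.repr (macOp q t (P κ))).support := Finsupp.mem_support_iff.2 h1
    set N := max N₁ N₂
    have hκN : κ.1 ≤ N := (hN₁ κ hκs).trans (le_max_left _ _)
    have hlN : lam.1 ≤ N := (hN₂ lam hls).trans (le_max_right _ _)
    have hle := (tri lam N (fun μ hμ => (hN₁ μ hμ).trans (le_max_left _ _)) hlN).1 κ hκs
    have hge := (tri κ N (fun μ hμ => (hN₂ μ hμ).trans (le_max_right _ _)) hκN).1 lam hls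
    exact hκ (partVec_injective κ lam hκN hlN
      (MonomialOrder.lex.toSyn.injective (hle.antisymm hge)))

end Eigenvalues

/-! ### From operators to functions on diagrams -/

section Assembly

variable {K : Type*} [Field K] {q t u v : K} {P : Module.Basis Parts K (Sym K)}

/-- The eigenvalue is t⁻¹/(1 - t⁻¹) times the first power sum of the corner alphabet, taken with L =
|μ|. -/
theorem e1Value_eq (ht1 : t ≠ 1) (μ : Parts) : e1Value q t μ =
    t⁻¹ / (1 - t⁻¹) * (1 - (1 - q) * (1 - t⁻¹) * contentPow q t 1 (young μ.2)) := by
  have h1 : 1 - t⁻¹ ≠ 0 := sub_ne_zero.2 fun h => ht1 (inv_eq_one.1 h.symm)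
  have h := cornerPow_eq (q := q) (t := t) μ.1 1 (young μ.2) (card_young μ.2).le
  rw [pow_one, pow_one] at h
  rw [← h, cornerPow, Finset.sum_range_succ, e1Value]
  have h2 : rowVar q t (young μ.2) μ.1 = t⁻¹ ^ μ.1 := by
    rw [rowVar, rowLen_eq_zero μ.2 le_rfl, pow_zero, one_mul]
  have h3 : ∑ i ∈ Finset.range μ.1, q ^ (young μ.2).rowLen i * t⁻¹ ^ (i + 1) =
      t⁻¹ * ∑ i ∈ Finset.range μ.1, rowVar q t (young μ.2) i := by
    rw [Finset.mul_sum]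
    exact Finset.sum_congr rfl fun i _ => by rw [rowVar]; ring
  simp only [pow_one, ← Finset.mul_sum]
  rw [h2, h3, div_mul_eq_mul_div, eq_div_iff h1, add_mul, div_mul_cancel₀ _ h1]
  ring

theorem bracket_eq (hq : q ≠ 0) (ht : t ≠ 0) (hu : u ≠ 0) {A : Module.End K (Sym K)}
    {f : YoungDiagram → K} (h : ∀ μ, A (P μ) = f (young μ.2) • P μ) :
    bracket q t u v P A = diagramBracket q t u v f := by
  ext n
  rw [bracket, diagramBracket, PowerSeries.coeff_mk, PowerSeries.coeff_mk,
    ← sum_partition_eq n fun Y => diagramWeight q t u v Y * f Y]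
  refine Finset.sum_congr rfl fun μ _ => ?_
  rw [h, weight_eq hq ht hu, map_smul, P.repr_self, Finsupp.smul_single, Finsupp.single_eq_same,
    smul_eq_mul, mul_one]

theorem normBracket_eq (hq : q ≠ 0) (ht : t ≠ 0) (hu : u ≠ 0) {A : Module.End K (Sym K)}
    {f : YoungDiagram → K} (h : ∀ μ, A (P μ) = f (young μ.2) • P μ) :
    normBracket q t u v P A = normDiagramBracket q t u v f := by
  rw [normBracket, normDiagramBracket, bracket_eq hq ht hu h,
    bracket_eq hq ht hu (A := 1) (f := fun _ => 1) fun μ => by rw [one_smul]; rfl]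

theorem normDiagramBracket_add (f g : YoungDiagram → K) :
    normDiagramBracket q t u v (fun Y => f Y + g Y) =
      normDiagramBracket q t u v f + normDiagramBracket q t u v g := by
  rw [normDiagramBracket, diagramBracket_add, add_mul]
  rfl

theorem normDiagramBracket_smul (c : K) (f : YoungDiagram → K) :
    normDiagramBracket q t u v (fun Y => c * f Y) =
      PowerSeries.C c * normDiagramBracket q t u v f := by
  rw [normDiagramBracket, diagramBracket_smul, mul_assoc]
  rfl

theorem Psi_apply (m : ℕ) (μ : Parts) :
    Psi q t P m (P μ) = contentPow q t m (young μ.2) • P μ := by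
  rw [Psi, diagOp, P.constr_basis, contents, Multiset.map_map]
  rfl

theorem two_mul_esymm_two (s : Multiset K) :
    2 * s.esymm 2 = s.sum ^ 2 - (s.map (· ^ 2)).sum := by
  induction s using Multiset.induction_on with
  | empty => simp [Multiset.esymm, Multiset.powersetCard_zero_right]
  | cons a s ih =>
    have h : (a ::ₘ s).esymm 2 = s.esymm 2 + a * s.sum := by
      rw [Multiset.esymm, Multiset.powersetCard_cons, Multiset.map_add, Multiset.sum_add,
        Multiset.powersetCard_one, Multiset.map_map, Multiset.map_map, Multiset.esymm]
      congr 1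
      simp only [Function.comp_def, Multiset.prod_cons, Multiset.prod_singleton]
      rw [Multiset.sum_map_mul_left, Multiset.map_id']
    rw [h, mul_add, ih, Multiset.sum_cons, Multiset.map_cons, Multiset.sum_cons]
    ring

theorem Lam_two_apply (h2 : (2 : K) ≠ 0) (μ : Parts) : Lam q t P 2 (P μ) =
    (2⁻¹ * (contentPow q t 1 (young μ.2) ^ 2 + -1 * contentPow q t 2 (young μ.2))) • P μ := by
  rw [Lam, diagOp, P.constr_basis]
  congr 1
  have h := two_mul_esymm_two (contents q t μ)
  have e1 : (contents q t μ).sum = contentPow q t 1 (young μ.2) := by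
    rw [contentPow]
    simp only [pow_one]
    rfl
  have e2 : ((contents q t μ).map (· ^ 2)).sum = contentPow q t 2 (young μ.2) := by
    rw [contents, Multiset.map_map]
    rfl
  rw [e1, e2] at h
  apply mul_left_cancel₀ h2
  rw [h, mul_inv_cancel_left₀ h2]
  ring

theorem mul_self_apply {A : Module.End K (Sym K)} {a : K} {x : Sym K} (h : A x = a • x) :
    (A * A) x = (a ^ 2) • x := by
  rw [Module.End.mul_apply, h, map_smul, h, smul_smul, sq]

end Assembly

end MacFock

/-! ### The bracket formulas -/

theorem mainTheorem8 {K : Type*} [Field K] [CharZero K] (q t u v : K)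
    (hq : q ≠ 0) (ht : t ≠ 0) (hu : u ≠ 0)
    (hqt : ∀ a b : ℕ, (a, b) ≠ (0, 0) → q ^ a * t ^ b ≠ 1)
    (P : Module.Basis MacFock.Parts K (MacFock.Sym K)) (hP : MacFock.IsMacdonaldBasis q t P) :
    let C : K → PowerSeries K := fun c => PowerSeries.C c
    let Q : PowerSeries K := PowerSeries.X
    (∃! E : Module.End K (MacFock.Sym K), MacFock.IsModifiedMacdonaldOp q t E) ∧
    (∀ E : Module.End K (MacFock.Sym K), MacFock.IsModifiedMacdonaldOp q t E →
      (∀ μ : MacFock.Parts, E (P μ) = MacFock.e1Value q t μ • P μ) ∧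
      MacFock.normBracket q t u v P (E * E) =
        C ((t⁻¹ / (1 - t⁻¹)) ^ 2) *
          ((1 - Q * C ((1 - u) * (1 - v)) * (1 - C u * Q)⁻¹) ^ 2 +
            Q * (1 - Q) * (1 - C (u * v) * Q) *
              C ((1 - u) * (1 - v) * (1 - q) * (1 - t⁻¹)) *
              ((1 - C u * Q) ^ 2 * (1 - C (u * q) * Q) * (1 - C (u * t⁻¹) * Q))⁻¹)) ∧
    MacFock.normBracket q t u v P (MacFock.Psi q t P 1 * MacFock.Psi q t P 1) =
      (Q * C ((1 - u) * (1 - v) / ((1 - q) * (1 - t⁻¹))) * (1 - C u * Q)⁻¹) ^ 2 +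
      C ((1 - u) * (1 - v) / ((1 - q) * (1 - t⁻¹))) * Q * (1 - Q) * (1 - C (u * v) * Q) *
        ((1 - C u * Q) ^ 2 * (1 - C (u * q) * Q) * (1 - C (u * t⁻¹) * Q))⁻¹ ∧
    MacFock.normBracket q t u v P (MacFock.Psi q t P 2) =
      C (1 / ((1 - q ^ 2) * (1 - t⁻¹ ^ 2))) -
      C (1 / ((1 - q ^ 2) * (1 - t⁻¹ ^ 2))) *
        (1 - Q * C ((1 - u) * (1 - v)) * (1 - C u * Q)⁻¹) ^ 2 +
      C (1 / ((1 - q ^ 2) * (1 - t⁻¹ ^ 2))) *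
        (C (-1 + q + t⁻¹ + q * t⁻¹) - C (2 * u * q * t⁻¹) * Q) *
        (Q * (1 - Q) * C ((1 - u) * (1 - v)) * (1 - C (u * v) * Q)) *
        ((1 - C u * Q) ^ 2 * (1 - C (u * q) * Q) * (1 - C (u * t⁻¹) * Q))⁻¹ ∧
    2 * MacFock.normBracket q t u v P (MacFock.Lam q t P 2) =
      (Q * C ((1 - u) * (1 - v) / ((1 - q) * (1 - t⁻¹))) * (1 - C u * Q)⁻¹) ^ 2 -
      C (1 / ((1 - q ^ 2) * (1 - t⁻¹ ^ 2))) +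
      C (1 / ((1 - q ^ 2) * (1 - t⁻¹ ^ 2))) *
        (1 - Q * C ((1 - u) * (1 - v)) * (1 - C u * Q)⁻¹) ^ 2 +
      C (1 / ((1 - q ^ 2) * (1 - t⁻¹ ^ 2))) *
        (2 + C (2 * u * q * t⁻¹) * Q) *
        (Q * (1 - Q) * C ((1 - u) * (1 - v)) * (1 - C (u * v) * Q)) *
        ((1 - C u * Q) ^ 2 * (1 - C (u * q) * Q) * (1 - C (u * t⁻¹) * Q))⁻¹ := by
  intro C Q
  have hqk : ∀ k : ℕ, q ^ (k + 1) ≠ 1 := fun k h => hqt (k + 1) 0 (by simp) (by simp [h])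
  have htk : ∀ k : ℕ, t ^ (k + 1) ≠ 1 := fun k h => hqt 0 (k + 1) (by simp) (by simp [h])
  have hq1 : q ≠ 1 := by simpa using hqk 0
  have ht1 : t ≠ 1 := by simpa using htk 0
  have hop := MacFock.macOp_isModified (q := q) ht ht1
  obtain ⟨v0, v1, v11, v2⟩ := MacFock.normDiagramBracket_values (u := u) (v := v) hq ht hqt
  have hPsi1 : MacFock.normBracket q t u v P (MacFock.Psi q t P 1 * MacFock.Psi q t P 1) =
      MacFock.normDiagramBracket q t u v fun Y => MacFock.contentPow q t 1 Y ^ 2 :=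
    MacFock.normBracket_eq hq ht hu fun μ => MacFock.mul_self_apply (MacFock.Psi_apply 1 μ)
  have hPsi2 : MacFock.normBracket q t u v P (MacFock.Psi q t P 2) =
      MacFock.normDiagramBracket q t u v (MacFock.contentPow q t 2) :=
    MacFock.normBracket_eq hq ht hu fun μ => MacFock.Psi_apply 2 μ
  refine ⟨⟨MacFock.macOp q t, hop, fun E hE => hP.modifiedMacdonaldOp_unique hE hop⟩, ?_,
    hPsi1.trans v11, hPsi2.trans v2, ?_⟩
  · intro E hE
    -- A symmetric function is determined by its restrictions, so E is the explicit operator.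
    obtain rfl := hP.modifiedMacdonaldOp_unique hE hop
    have heig := hP.macOp_apply_eq ht hqk htk
    refine ⟨heig, ?_⟩
    set m := (1 - q) * (1 - t⁻¹) with hm
    have hm0 : m ≠ 0 := mul_ne_zero (sub_ne_zero.2 hq1.symm)
      (sub_ne_zero.2 fun h => ht1 (inv_eq_one.1 h.symm))
    have h1 : MacFock.normBracket q t u v P (MacFock.macOp q t * MacFock.macOp q t) =
        MacFock.normDiagramBracket q t u v fun Y => (t⁻¹ / (1 - t⁻¹)) ^ 2 * (1 +
          (-2 * m * MacFock.contentPow q t 1 Y + m ^ 2 * MacFock.contentPow q t 1 Y ^ 2)) :=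
      MacFock.normBracket_eq hq ht hu fun μ => by
        rw [MacFock.mul_self_apply (heig μ), MacFock.e1Value_eq ht1 μ]
        congr 1
        ring
    rw [h1, MacFock.normDiagramBracket_smul,
      MacFock.normDiagramBracket_add (fun _ => 1), MacFock.normDiagramBracket_add,
      MacFock.normDiagramBracket_smul, MacFock.normDiagramBracket_smul (m ^ 2), v0, v1, v11]
    congr 1
    have hk : (1 - u) * (1 - v) * (1 - q) * (1 - t⁻¹) = (1 - u) * (1 - v) * m := by rw [hm]; ring
    have ha : C m * C m⁻¹ = 1 := by
      simp only [C]
      rw [← map_mul, mul_inv_cancel₀ hm0, map_one]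
    have e1 : C ((1 - u) * (1 - v) / m) = C ((1 - u) * (1 - v)) * C m⁻¹ := by
      simp only [C, div_eq_mul_inv, map_mul]
    have e2 : C ((1 - u) * (1 - v) * m) = C ((1 - u) * (1 - v)) * C m := map_mul _ _ _
    have e3 : C (-2 * m) = -2 * C m := by
      simp only [C, neg_mul, map_neg, map_mul, map_ofNat]
    have e4 : C (m ^ 2) = C m ^ 2 := map_pow _ _ _
    rw [hk]
    change 1 + (C (-2 * m) * (Q * C ((1 - u) * (1 - v) / m) * (1 - C u * Q)⁻¹) +
      C (m ^ 2) * ((Q * C ((1 - u) * (1 - v) / m) * (1 - C u * Q)⁻¹) ^ 2 +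
        C ((1 - u) * (1 - v) / m) * Q * (1 - Q) * (1 - C (u * v) * Q) *
        ((1 - C u * Q) ^ 2 * (1 - C (u * q) * Q) * (1 - C (u * t⁻¹) * Q))⁻¹)) = _
    rw [e1, e2, e3, e4]
    generalize (1 - C u * Q)⁻¹ = I
    generalize ((1 - C u * Q) ^ 2 * (1 - C (u * q) * Q) * (1 - C (u * t⁻¹) * Q))⁻¹ = D
    generalize C ((1 - u) * (1 - v)) = k
    generalize C m⁻¹ = a at *
    generalize C m = M at *
    linear_combination (-2 * Q * k * I + (M * a + 1) * (Q * k * I) ^ 2 +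
      M * k * Q * (1 - Q) * (1 - C (u * v) * Q) * D) * ha
  · have h1 : MacFock.normBracket q t u v P (MacFock.Lam q t P 2) =
        MacFock.normDiagramBracket q t u v fun Y => 2⁻¹ *
          (MacFock.contentPow q t 1 Y ^ 2 + -1 * MacFock.contentPow q t 2 Y) :=
      MacFock.normBracket_eq hq ht hu fun μ => MacFock.Lam_two_apply two_ne_zero μ
    have h2 : (2 : PowerSeries K) * PowerSeries.C (2⁻¹ : K) = 1 := by
      rw [← map_ofNat (PowerSeries.C (R := K)) 2, ← map_mul, mul_inv_cancel₀ two_ne_zero, map_one]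
    have h3 : PowerSeries.C (-1 : K) = -1 := by simp
    rw [h1, MacFock.normDiagramBracket_smul,
      MacFock.normDiagramBracket_add (fun Y => MacFock.contentPow q t 1 Y ^ 2),
      MacFock.normDiagramBracket_smul, ← mul_assoc, h2, one_mul, v11, v2, h3]
    have hq2 : 1 - q ^ 2 ≠ 0 := sub_ne_zero.2 (hqk 1).symm
    have ht2 : 1 - t⁻¹ ^ 2 ≠ 0 := sub_ne_zero.2 fun h => htk 1 (by
      rw [inv_pow, eq_comm, inv_eq_one] at h
      exact h)
    have hq3 : 1 - q ≠ 0 := sub_ne_zero.2 hq1.symm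
    have ht3 : 1 - t⁻¹ ≠ 0 := sub_ne_zero.2 fun h => ht1 (inv_eq_one.1 h.symm)
    -- The factor -1 + q + t⁻¹ + qt⁻¹ + 2 is (1 + q)(1 + t⁻¹). It puts the W-terms of (Ψ¹)² and Ψ²
    -- over a common denominator, and their difference has numerator 2 + 2uqt⁻¹Q.
    have hK : (1 - u) * (1 - v) / ((1 - q) * (1 - t⁻¹)) =
        1 / ((1 - q ^ 2) * (1 - t⁻¹ ^ 2)) * (-1 + q + t⁻¹ + q * t⁻¹ + 2) *
          ((1 - u) * (1 - v)) := by
      rw [div_eq_iff (mul_ne_zero hq3 ht3), one_div_mul_eq_div, div_mul_eq_mul_div,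
        div_mul_eq_mul_div, eq_div_iff (mul_ne_zero hq2 ht2)]
      ring
    have hkey : C ((1 - u) * (1 - v) / ((1 - q) * (1 - t⁻¹))) =
        C (1 / ((1 - q ^ 2) * (1 - t⁻¹ ^ 2))) * (C (-1 + q + t⁻¹ + q * t⁻¹) + 2) *
          C ((1 - u) * (1 - v)) := by
      rw [hK]
      simp only [C, map_mul, map_add, map_ofNat]
    change (Q * C ((1 - u) * (1 - v) / ((1 - q) * (1 - t⁻¹))) * (1 - C u * Q)⁻¹) ^ 2 +
      C ((1 - u) * (1 - v) / ((1 - q) * (1 - t⁻¹))) * Q * (1 - Q) * (1 - C (u * v) * Q) *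
        ((1 - C u * Q) ^ 2 * (1 - C (u * q) * Q) * (1 - C (u * t⁻¹) * Q))⁻¹ +
      -1 * (C (1 / ((1 - q ^ 2) * (1 - t⁻¹ ^ 2))) -
      C (1 / ((1 - q ^ 2) * (1 - t⁻¹ ^ 2))) *
        (1 - Q * C ((1 - u) * (1 - v)) * (1 - C u * Q)⁻¹) ^ 2 +
      C (1 / ((1 - q ^ 2) * (1 - t⁻¹ ^ 2))) *
        (C (-1 + q + t⁻¹ + q * t⁻¹) - C (2 * u * q * t⁻¹) * Q) *
        (Q * (1 - Q) * C ((1 - u) * (1 - v)) * (1 - C (u * v) * Q)) *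
        ((1 - C u * Q) ^ 2 * (1 - C (u * q) * Q) * (1 - C (u * t⁻¹) * Q))⁻¹) = _
    generalize ((1 - C u * Q) ^ 2 * (1 - C (u * q) * Q) * (1 - C (u * t⁻¹) * Q))⁻¹ = D
    linear_combination Q * (1 - Q) * (1 - C (u * v) * Q) * D * hkey
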